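/- A directed hypergraph is a pair $\mathcal{H}=(N,E)$, where $N$ is a finite set of nodes and $E$ is a set of pairs $e=(T(e),H(e))$ with $T(e),H(e)\subseteq N$ (the tail and the head of the hyperedge $e$). Its size is $\mathrm{size}(\mathcal{H})=|N|+\sum_{e\in E}(|T(e)|+|H(e)|)$. Reachability is defined recursively: $v$ is reachable from $u$ if $u=v$, or if there is $e\in E$ such that $v\in H(e)$ and all elements of $T(e)$ are reachable from $u$. The strongly connected components of $\mathcal{H}$ are the equivalence classes of the relation "$u$ is reachable from $v$ and $v$ is reachable from $u$"; they are partially ordered by: $C_1\preceq C_2$ if some $u\in C_1$ is reachable from some $v\in C_2$. Let $\alpha(n)=\min\{k\ge 1 : A(k,k)\ge n\}$, where $A$ is the Ackermann function, given by $A(0,n)=n+1$, $A(m+1,0)=A(m,1)$ and $A(m+1,n+1)=A(m,A(m+1,n))$. **Theorem.** The set of minimal (for $\preceq$) strongly connected components of a directed hypergraph $\mathcal{H}=(N,E)$ can be computed in time $O(\mathrm{size}(\mathcal{H})\,\alpha(|N|))$. Precisely: there are a program $P$ for a unit-cost random access machine and a constant $c$ such that, for every directed hypergraph $\mathcal{H}=(N,E)$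 and every numbering of $N$ by $0,\dots,|N|-1$, the program $P$, given $|N|$, $|E|$ and the list of the hyperedges (in any order, each as its tail and its head, written as a list of distinct node numbers preceded by its length), halts after at most $c\cdot\mathrm{size}(\mathcal{H})\,\alpha(|N|)+c$ steps and has then written the number of minimal strongly connected components followed by a list of them, without repetition, each as the list of its distinct node numbers preceded by its length. The machine has finitely many registers and arrays of natural numbers; the input is in one array, everything else is initially $0$, and the output is written to another array. In one step it assigns a constant to a register, copies a register, increments or decrements a register ($0$ stays $0$ when decremented), loads or stores an array entry whose position is given by a register, or compares two registers ($=,\neq,<,\le$) to control a conditional or a loop. -/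

import Mathlib

/-! ### The inverse Ackermann function -/

theorem exists_le_ack_diag (n : ℕ) : ∃ k : ℕ, 1 ≤ k ∧ n ≤ ack k k :=
  ⟨n + 1, Nat.succ_pos n, (Nat.le_succ n).trans (lt_ack_right (n + 1) (n + 1)).le⟩

/-- The inverse Ackermann function: the least `k ≥ 1` with `n ≤ A(k, k)`. -/
noncomputable def inverseAckermann (n : ℕ) : ℕ :=
  sInf {k : ℕ | 1 ≤ k ∧ n ≤ ack k k}

/-! ### Directed hypergraphs -/

/-- A directed hypergraph with set of nodes `N`: a finite set of hyperedges `(T, H)`, where the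
tail `T` and the head `H` are (possibly empty) subsets of `N`. -/
structure DirectedHypergraph (N : Type*) where
  edges : Finset (Finset N × Finset N)

namespace DirectedHypergraph

variable {N : Type*}

/-- `size(H) = |N| + ∑ (|T(e)| + |H(e)|)`, the sum over all hyperedges `e`. -/
def size [Fintype N] (H : DirectedHypergraph N) : ℕ :=
  Fintype.card N + ∑ e ∈ H.edges, (e.1.card + e.2.card)

/-- `H.Reaches u v`: the node `v` is reachable from the node `u`. -/
inductive Reaches (H : DirectedHypergraph N) (u : N) : N → Prop
  | refl : Reaches H u u
  | step (e : Finset N × Finset N) (v : N) (he : e ∈ H.edges) (hv : v ∈ e.2)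
      (hT : ∀ w ∈ e.1, Reaches H u w) : Reaches H u v

theorem Reaches.trans {H : DirectedHypergraph N} {u v w : N} (huv : H.Reaches u v)
    (hvw : H.Reaches v w) : H.Reaches u w := by
  induction hvw with
  | refl => exact huv
  | step e x he hx _ ih => exact Reaches.step e x he hx ih

/-- Mutual reachability. -/
def sccSetoid (H : DirectedHypergraph N) : Setoid N where
  r u v := H.Reaches u v ∧ H.Reaches v u
  iseqv :=
    { refl := fun _ => ⟨Reaches.refl, Reaches.refl⟩
      symm := fun h => ⟨h.2, h.1⟩
      trans := fun h k => ⟨h.1.trans k.1, k.2.trans h.2⟩ }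

/-- The strongly connected components: the classes of mutual reachability. -/
def sccs (H : DirectedHypergraph N) : Set (Set N) := H.sccSetoid.classes

/-- `C₁ ≼ C₂`: some node of `C₁` is reachable from some node of `C₂`. -/
def SccLE (H : DirectedHypergraph N) (C₁ C₂ : Set N) : Prop :=
  ∃ u ∈ C₁, ∃ v ∈ C₂, H.Reaches v u

/-- The strongly connected components that are minimal for `≼`. -/
def minimalSccs (H : DirectedHypergraph N) : Set (Set N) :=
  {C | C ∈ H.sccs ∧ ∀ C' ∈ H.sccs, H.SccLE C' C → C' = C}

end DirectedHypergraph

/-! ### A random access machine with unit cost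

The machine has registers and arrays of natural numbers. Which register or array an instruction
uses is fixed in the program, so that a program uses finitely many of them; the position in an
array is read from a register (indirect addressing). The only arithmetic is `± 1`, so that after
`t` steps no word exceeds `t` plus the largest number in the input and the program. -/

namespace RAM

/-- A memory configuration: `reg r` is the content of register `r`, and `arr a i` the entry of
array `a` at position `i`. -/
structure State where
  reg : ℕ → ℕ
  arr : ℕ → ℕ → ℕ

/-- The elementary instructions. -/
inductive Instr
  /-- `r := k` for a number `k` that is fixed in the program -/
  | const (r k : ℕ)
  /-- `r := r'` -/
  | copy (r r' : ℕ)
  /-- `r := r + 1` -/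
  | inc (r : ℕ)
  /-- `r := r - 1`, and `0` stays `0` -/
  | dec (r : ℕ)
  /-- `r := a[i]`, the position being the content of register `i` -/
  | load (r a i : ℕ)
  /-- `a[i] := r`, the position being the content of register `i` -/
  | store (a i r : ℕ)

/-- The effect of an elementary instruction. -/
def Instr.apply (s : State) : Instr → State
  | .const r k => { s with reg := Function.update s.reg r k }
  | .copy r r' => { s with reg := Function.update s.reg r (s.reg r') }
  | .inc r => { s with reg := Function.update s.reg r (s.reg r + 1) }
  | .dec r => { s with reg := Function.update s.reg r (s.reg r - 1) }
  | .load r a i => { s with reg := Function.update s.reg r (s.arr a (s.reg i)) }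
  | .store a i r =>
      { s with arr := Function.update s.arr a (Function.update (s.arr a) (s.reg i) (s.reg r)) }

/-- The elementary tests: comparisons of the contents of two registers. -/
inductive Test
  | eq (r r' : ℕ)
  | ne (r r' : ℕ)
  | lt (r r' : ℕ)
  | le (r r' : ℕ)

def Test.Holds (s : State) : Test → Prop
  | .eq r r' => s.reg r = s.reg r'
  | .ne r r' => s.reg r ≠ s.reg r'
  | .lt r r' => s.reg r < s.reg r'
  | .le r r' => s.reg r ≤ s.reg r'

/-- Programs: instructions, sequences, conditionals and loops. -/
inductive Program
  | skip
  | instr (i : Instr)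
  | seq (p q : Program)
  | cond (b : Test) (p q : Program)
  | loop (b : Test) (p : Program)

/-- `Runs p s s' t`: the program `p`, started in configuration `s`, halts in configuration `s'`
after exactly `t` steps. Each execution of an elementary instruction and each evaluation of a
test is one step. -/
inductive Runs : Program → State → State → ℕ → Prop
  | skip (s : State) : Runs .skip s s 0
  | instr (i : Instr) (s : State) : Runs (.instr i) s (i.apply s) 1
  | seq {p q : Program} {s s' s'' : State} {t t' : ℕ} (hp : Runs p s s' t)
      (hq : Runs q s' s'' t') : Runs (.seq p q) s s'' (t + t')
  | condTrue {b : Test} {p q : Program} {s s' : State} {t : ℕ} (hb : b.Holds s)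
      (hp : Runs p s s' t) : Runs (.cond b p q) s s' (t + 1)
  | condFalse {b : Test} {p q : Program} {s s' : State} {t : ℕ} (hb : ¬ b.Holds s)
      (hq : Runs q s s' t) : Runs (.cond b p q) s s' (t + 1)
  | loopTrue {b : Test} {p : Program} {s s' s'' : State} {t t' : ℕ} (hb : b.Holds s)
      (hp : Runs p s s' t) (hl : Runs (.loop b p) s' s'' t') :
      Runs (.loop b p) s s'' (t + t' + 1)
  | loopFalse {b : Test} {p : Program} {s : State} (hb : ¬ b.Holds s) :
      Runs (.loop b p) s s 1

/-- The initial configuration: the input word is in array `0`, and everything else is `0`. -/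
def initial (w : List ℕ) : State where
  reg _ := 0
  arr a i := if a = 0 then w.getD i 0 else 0

/-- The output word `w` is in array `1`, from position `0` on. -/
def State.HasOutput (s : State) (w : List ℕ) : Prop :=
  ∀ i < w.length, s.arr 1 i = w.getD i 0

end RAM

/-! ### Hypergraphs and families of node sets as words of numbers -/

/-- The list `l` enumerates the set `S` in some order, without repetition. -/
def Enumerates {X : Type*} (l : List X) (S : Set X) : Prop :=
  l.Nodup ∧ ∀ x, x ∈ l ↔ x ∈ S

/-- `L` lists the hyperedges of `H` in some order, without repetition, each as a pair of lists
that enumerate its tail and its head. -/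
def ListsEdges {N : Type*} (L : List (List N × List N)) (H : DirectedHypergraph N) : Prop :=
  ∃ es : List (Finset N × Finset N), Enumerates es {e | e ∈ H.edges} ∧
    List.Forall₂ (fun e p => Enumerates p.1 {v | v ∈ e.1} ∧ Enumerates p.2 {v | v ∈ e.2}) es L

/-- `L` lists the members of a family of sets in some order, without repetition, each as a list
that enumerates its elements. -/
def ListsFamily {N : Type*} (L : List (List N)) (F : Set (Set N)) : Prop :=
  ∃ Cs : List (Set N), Enumerates Cs F ∧ List.Forall₂ (fun C l => Enumerates l C) Cs L

section Encoding

variable {N : Type*} [Fintype N] (ν : N ≃ Fin (Fintype.card N))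

/-- A list of nodes: its length, followed by the numbers of the nodes. -/
def encodeNodes (l : List N) : List ℕ :=
  l.length :: l.map (fun v => (ν v : ℕ))

/-- A hypergraph: the number of nodes, the number of hyperedges, and then for each hyperedge its
tail and its head. -/
def encodeHypergraph (L : List (List N × List N)) : List ℕ :=
  Fintype.card N :: L.length :: L.flatMap (fun p => encodeNodes ν p.1 ++ encodeNodes ν p.2)

/-- A family of sets of nodes: the number of its members, followed by the members. -/
def encodeFamily (L : List (List N)) : List ℕ :=
  L.length :: L.flatMap (encodeNodes ν)

end Encoding

/-!
The minimal strongly connected components are found by a path-based search. The search visits each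
node once and numbers the nodes in the order of the visits. The last nodes visited form a path:
each of its nodes reaches all later ones. The path is divided into intervals of mutually reachable
nodes. The nodes visited before the path are dead: each of them reaches a component that has been
found. The search explores nodes `w` that are reachable from the top interval, which is the last
one.

* If `w` has not been visited, it becomes a new interval on top of the path.
* If `w` lies on the path below the top interval, the top interval is merged with the one below
  it.
* If `w` is dead, then all nodes of the path reach a component that has been found. None of them
  lies in a further minimal component, and the whole path dies (`SearchInv.outInv_of_dead`). This
  is why minimal components are easier to find than all strongly connected components.
* If there is nothing left to explore, the top interval is closed under reachability. It is a
  minimal component, and the whole path dies (`SearchInv.outInv_of_closed`).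

A hyperedge can be used from an interval only if its whole tail is reachable from it. So each
hyperedge counts the tail nodes that have not been visited, and stores the least position of the
others. When the count reaches `0`, the hyperedge is put into the list of the interval that
contains the least position. As soon as that interval is on top, the whole tail lies in it, and
the heads become nodes to explore (`SearchInv.activate`). If a tail node is dead at that time, the
hyperedge is dropped, since its tail is then contained in no component yet to be found. A
hyperedge with an empty tail leads from every node to its heads. One such head `y` is fixed, and
explored from every interval before the interval is declared a component; then `y` can replace the
empty tails.

The interval of a given position is found by a union-find forest with union by rank and path
compression. There are at most `n` links and at most one find operation for each hyperedge;
everything else takes linear time. The amortized cost of a find operation is bounded with the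
potential `rankPotential`: a node of rank `r` whose parent has rank `s > r` has as its level the
`k` with `ack k r ≤ s < ack (k + 1) r`. A find operation whose path meets that level again further
up replaces the parent by one of rank at least `ack k s`, which takes one application of `ack k`
away from those that the node can still afford (`rankPotential_drop`). So only one node for each
level is not paid for (`Forest.exists_compress`), and there are at most `inverseAckermann n + 2`
levels (`lt_ack_inverseAckermann_add_two`).

The correctness is the invariant `SearchInv`, the running time the potential `searchPotential`;
each step of the program preserves the one and pays from the other (`RAM.ends_body`).
-/

/-! ### The inverse Ackermann function and the potential of a rank -/

/-- With `K = inverseAckermann n + 2`, all ranks below `n` have a level less than `K` in the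
analysis of the union-find forest. -/
theorem lt_ack_inverseAckermann_add_two (n : ℕ) : n < ack (inverseAckermann n + 2) 1 := by
  have h : inverseAckermann n ∈ {k : ℕ | 1 ≤ k ∧ n ≤ ack k k} := Nat.sInf_mem (exists_le_ack_diag n)
  set k := inverseAckermann n
  have h1 : ack (k + 2) 1 = ack (k + 1) (ack (k + 1) 1) := by
    rw [show (1 : ℕ) = 0 + 1 from rfl, ack_succ_succ, ack_succ_zero]
  have h2 : k + 1 + 1 < ack (k + 1) 1 := add_lt_ack _ _
  calc n ≤ ack k k := h.2
    _ < ack k (ack (k + 1) 1) := ack_strictMono_right k (by omega)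
    _ ≤ ack (k + 1) (ack (k + 1) 1) := ack_mono_left _ (by omega)
    _ = _ := h1.symm

theorem one_le_inverseAckermann (n : ℕ) : 1 ≤ inverseAckermann n :=
  (Nat.sInf_mem (s := {k : ℕ | 1 ≤ k ∧ n ≤ ack k k}) (exists_le_ack_diag n)).1

theorem ack_succ_eq_iterate (k r : ℕ) : ack (k + 1) r = (ack k)^[r + 1] 1 := by
  induction r with
  | zero => simp
  | succ r ih => rw [ack_succ_succ, ih, ← Function.iterate_succ_apply' (ack k) (r + 1)]

theorem ack_iterate_mono (k i : ℕ) : Monotone (ack k)^[i] :=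
  (ack_mono_right k).iterate i

theorem lt_ack_iterate (k i r : ℕ) (hi : 1 ≤ i) : r < (ack k)^[i] r := by
  induction i, hi using Nat.le_induction with
  | base => exact lt_ack_right k r
  | succ i _ ih => rw [Function.iterate_succ_apply']; exact ih.trans (lt_ack_right _ _)

/-- The potential of a node of rank `r` whose parent has rank `s`: the number of pairs `(k, i)` with
`k < K` and `1 ≤ i ≤ r + 1` for which the `i`-fold iterate of `ack k`, started at `r`, still
exceeds `s`. For a root, where `s = r`, all pairs count. -/
def rankPotential (K r s : ℕ) : ℕ :=
  ((Finset.range K ×ˢ Finset.Icc 1 (r + 1)).filter (fun q => s < (ack q.1)^[q.2] r)).card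

theorem rankPotential_anti (K r : ℕ) {s s' : ℕ} (h : s ≤ s') :
    rankPotential K r s' ≤ rankPotential K r s := by
  apply Finset.card_le_card
  intro q
  simp only [Finset.mem_filter]
  exact fun hq => ⟨hq.1, h.trans_lt hq.2⟩

theorem rankPotential_self (K r : ℕ) : rankPotential K r r = K * (r + 1) := by
  rw [rankPotential, Finset.filter_true_of_mem]
  · simp
  · intro q hq
    simp only [Finset.mem_product, Finset.mem_Icc] at hq
    exact lt_ack_iterate _ _ _ hq.2.1

/-- If `k` is the largest index with `ack k r ≤ s`, then the step from `s` to `ack k s` applies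
`ack k` to `r` once more, and so loses at least one pair `(k, i)`. -/
theorem rankPotential_drop {K r s s' k : ℕ} (hr : 1 ≤ r) (hk : k < K) (hs : r ≤ s)
    (hlev : s < ack (k + 1) r) (hs' : ack k s ≤ s') :
    rankPotential K r s' + 1 ≤ rankPotential K r s := by
  have hex : ∃ i, s < (ack k)^[i] r :=
    ⟨r + 1, hlev.trans_le ((ack_succ_eq_iterate k r).le.trans (ack_iterate_mono k (r + 1) hr))⟩
  have hle : Nat.find hex ≤ r + 1 := Nat.find_le
    (hlev.trans_le ((ack_succ_eq_iterate k r).le.trans (ack_iterate_mono k (r + 1) hr)))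
  have hpos : Nat.find hex ≠ 0 := by
    intro h0
    have := Nat.find_spec hex
    rw [h0] at this
    simp at this
    omega
  obtain ⟨i, hi⟩ := Nat.exists_eq_succ_of_ne_zero hpos
  have hnot : (ack k)^[i] r ≤ s := by
    have := Nat.find_min hex (m := i) (by omega)
    omega
  have hspec : s < (ack k)^[i + 1] r := by
    have := Nat.find_spec hex
    rwa [hi] at this
  apply Finset.card_lt_card
  rw [Finset.ssubset_iff_of_subset]
  · refine ⟨(k, i + 1), ?_, ?_⟩
    · simp only [Finset.mem_filter, Finset.mem_product, Finset.mem_range, Finset.mem_Icc]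
      exact ⟨⟨hk, by omega, by omega⟩, hspec⟩
    · simp only [Finset.mem_filter, not_and, not_lt]
      intro _
      rw [Function.iterate_succ_apply']
      exact (ack_mono_right k hnot).trans hs'
  · intro q
    simp only [Finset.mem_filter]
    have : s ≤ s' := (lt_ack_right k s).le.trans hs'
    exact fun hq => ⟨hq.1, this.trans_lt hq.2⟩

/-- The level `k` of a node of rank `r` whose parent has rank `s`. -/
theorem exists_ack_level {K r s : ℕ} (hrs : r < s) (hK : s < ack K r) :
    ∃ k < K, ack k r ≤ s ∧ s < ack (k + 1) r := by
  have hex : ∃ k, s < ack k r := ⟨K, hK⟩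
  have hpos : Nat.find hex ≠ 0 := by
    intro h0
    have := Nat.find_spec hex
    rw [h0] at this
    simp at this
    omega
  obtain ⟨i, hi⟩ := Nat.exists_eq_succ_of_ne_zero hpos
  have h1 := Nat.find_min hex (m := i) (by omega)
  have h2 := Nat.find_spec hex
  rw [hi] at h2
  have h3 : Nat.find hex ≤ K := Nat.find_le hK
  exact ⟨i, by omega, by omega, h2⟩

/-! ### Union-find forests -/

open Finset in
/-- A union-find forest on `1, …, len`: `par` is the parent function, `rk` the rank, and `rt x`
is the root of the tree of `x`. Ranks increase towards the root and are bounded by the number of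
links made so far. -/
structure Forest (len : ℕ) (par rk rt : ℕ → ℕ) : Prop where
  par_mem : ∀ x, 1 ≤ x → x ≤ len → 1 ≤ par x ∧ par x ≤ len
  rt_mem : ∀ x, 1 ≤ x → x ≤ len → 1 ≤ rt x ∧ rt x ≤ len
  rt_par : ∀ x, 1 ≤ x → x ≤ len → rt (par x) = rt x
  par_rt : ∀ x, 1 ≤ x → x ≤ len → par (rt x) = rt x
  rt_eq : ∀ x, 1 ≤ x → x ≤ len → par x = x → rt x = x
  rank_lt : ∀ x, 1 ≤ x → x ≤ len → par x ≠ x → rk x < rk (par x)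
  rank_le : ∀ x, 1 ≤ x → x ≤ len → rk x + ((Icc 1 len).filter (fun y => par y = y)).card ≤ len

/-- The potential of a node of a union-find forest. A root carries enough to pay for one link. The
ranks are increased by `1`, since `rankPotential_drop` needs a positive rank. -/
def nodePotential (K c : ℕ) (par rk : ℕ → ℕ) (x : ℕ) : ℕ :=
  rankPotential K (rk x + 1) (rk (par x) + 1) + if par x = x then K + c else 0

/-- The potential of a union-find forest on `1, …, len`. It pays for the steps of the find
operations, except for `K` steps of each, and each link releases `c`. -/
def forestPotential (K c len : ℕ) (par rk : ℕ → ℕ) : ℕ :=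
  ∑ x ∈ Finset.Icc 1 len, nodePotential K c par rk x

/-- `Climb par x r l`: the root `r` is reached from `x` by `l` parent steps. -/
inductive Climb (par : ℕ → ℕ) : ℕ → ℕ → ℕ → Prop
  | root (r : ℕ) (h : par r = r) : Climb par r r 0
  | step (x r l : ℕ) (h : par x ≠ x) (hc : Climb par (par x) r l) : Climb par x r (l + 1)

/-- `Compress r par x par' l`: path compression from `x` towards the root `r` redirects `l`
nodes, and turns the parent function `par` into `par'`. -/
inductive Compress (r : ℕ) : (ℕ → ℕ) → ℕ → (ℕ → ℕ) → ℕ → Prop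
  | done (par : ℕ → ℕ) : Compress r par r par 0
  | step (par : ℕ → ℕ) (x : ℕ) (par' : ℕ → ℕ) (l : ℕ) (h : x ≠ r)
      (hc : Compress r (Function.update par x r) (par x) par' l) : Compress r par x par' (l + 1)

namespace Forest

variable {len : ℕ} {par rk rt : ℕ → ℕ}

theorem rank_lt_len (F : Forest len par rk rt) {x : ℕ} (h1 : 1 ≤ x) (h2 : x ≤ len) :
    rk x < len := by
  have h := F.rank_le x h1 h2
  have : 0 < ((Finset.Icc 1 len).filter (fun y => par y = y)).card := by
    apply Finset.card_pos.2
    refine ⟨rt x, ?_⟩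
    simp only [Finset.mem_filter, Finset.mem_Icc]
    exact ⟨F.rt_mem x h1 h2, F.par_rt x h1 h2⟩
  omega

theorem exists_climb (F : Forest len par rk rt) {x : ℕ} (h1 : 1 ≤ x) (h2 : x ≤ len) :
    ∃ l, Climb par x (rt x) l := by
  induction hd : len - rk x using Nat.strong_induction_on generalizing x with
  | _ d ih =>
    by_cases hx : par x = x
    · exact ⟨0, by rw [F.rt_eq x h1 h2 hx]; exact .root x hx⟩
    · have hlt := F.rank_lt x h1 h2 hx
      obtain ⟨h3, h4⟩ := F.par_mem x h1 h2
      have := F.rank_lt_len h3 h4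
      obtain ⟨l, hl⟩ := ih (len - rk (par x)) (by omega) h3 h4 rfl
      rw [F.rt_par x h1 h2] at hl
      exact ⟨l + 1, .step x _ l hx hl⟩

theorem rank_le_root (F : Forest len par rk rt) {x : ℕ} (h1 : 1 ≤ x) (h2 : x ≤ len) :
    rk x ≤ rk (rt x) := by
  obtain ⟨l, hl⟩ := F.exists_climb h1 h2
  generalize rt x = r at hl
  induction hl with
  | root r h => exact le_rfl
  | step x r l h _ ih =>
    obtain ⟨h3, h4⟩ := F.par_mem x h1 h2
    exact (F.rank_lt x h1 h2 h).le.trans (ih h3 h4)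

theorem rank_lt_root (F : Forest len par rk rt) {x : ℕ} (h1 : 1 ≤ x) (h2 : x ≤ len)
    (hx : x ≠ rt x) : rk x < rk (rt x) := by
  have hp : par x ≠ x := fun h => hx (F.rt_eq x h1 h2 h).symm
  obtain ⟨h3, h4⟩ := F.par_mem x h1 h2
  have := F.rank_le_root h3 h4
  rw [F.rt_par x h1 h2] at this
  exact (F.rank_lt x h1 h2 hp).trans_le this

theorem climb_update (F : Forest len par rk rt) {x y r l : ℕ} (v : ℕ) (h1 : 1 ≤ y) (h2 : y ≤ len)
    (hlt : rk x < rk y) (hc : Climb par y r l) : Climb (Function.update par x v) y r l := by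
  induction hc with
  | root r h =>
    refine .root r ?_
    rw [Function.update_of_ne (by rintro rfl; omega)]
    exact h
  | step y r l h _ ih =>
    obtain ⟨h3, h4⟩ := F.par_mem y h1 h2
    have hne : y ≠ x := by rintro rfl; omega
    have := ih h3 h4 (hlt.trans (F.rank_lt y h1 h2 h))
    refine .step y r l ?_ ?_ <;> rw [Function.update_of_ne hne] <;> assumption

theorem redirect (F : Forest len par rk rt) {x : ℕ} (h1 : 1 ≤ x) (h2 : x ≤ len)
    (hx : x ≠ rt x) : Forest len (Function.update par x (rt x)) rk rt := by
  have hp : par x ≠ x := fun h => hx (F.rt_eq x h1 h2 h).symm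
  have hroot : ∀ y, (Function.update par x (rt x) y = y ↔ par y = y) := by
    intro y
    by_cases hy : y = x
    · subst hy
      simp only [Function.update_self]
      exact ⟨fun h => absurd h.symm hx, fun h => absurd h hp⟩
    · rw [Function.update_of_ne hy]
  have hrt : rt (rt x) = rt x :=
    F.rt_eq _ (F.rt_mem x h1 h2).1 (F.rt_mem x h1 h2).2 (F.par_rt x h1 h2)
  refine ⟨?_, F.rt_mem, ?_, ?_, ?_, ?_, ?_⟩
  · intro y h3 h4
    by_cases hy : y = x
    · subst hy; simpa using F.rt_mem y h1 h2
    · rw [Function.update_of_ne hy]; exact F.par_mem y h3 h4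
  · intro y h3 h4
    by_cases hy : y = x
    · subst hy; simpa using hrt
    · rw [Function.update_of_ne hy]; exact F.rt_par y h3 h4
  · intro y h3 h4
    rw [hroot]; exact F.par_rt y h3 h4
  · intro y h3 h4
    rw [hroot]; exact F.rt_eq y h3 h4
  · intro y h3 h4
    by_cases hy : y = x
    · subst hy
      intro _
      simpa using F.rank_lt_root h1 h2 hx
    · rw [Function.update_of_ne hy]; exact F.rank_lt y h3 h4
  · intro y h3 h4
    simp only [hroot]
    exact F.rank_le y h3 h4

theorem potential_redirect (F : Forest len par rk rt) (K c : ℕ) {x d : ℕ} (h1 : 1 ≤ x)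
    (h2 : x ≤ len) (hx : x ≠ rt x)
    (hd : rankPotential K (rk x + 1) (rk (rt x) + 1) + d ≤
      rankPotential K (rk x + 1) (rk (par x) + 1)) :
    forestPotential K c len (Function.update par x (rt x)) rk + d ≤
      forestPotential K c len par rk := by
  have hp : par x ≠ x := fun h => hx (F.rt_eq x h1 h2 h).symm
  have hmem : x ∈ Finset.Icc 1 len := Finset.mem_Icc.2 ⟨h1, h2⟩
  unfold forestPotential
  rw [← Finset.add_sum_erase _ _ hmem, ← Finset.add_sum_erase _ _ hmem]
  have hrest : ∑ y ∈ (Finset.Icc 1 len).erase x,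
        nodePotential K c (Function.update par x (rt x)) rk y =
      ∑ y ∈ (Finset.Icc 1 len).erase x, nodePotential K c par rk y := by
    refine Finset.sum_congr rfl fun y hy => ?_
    have hy : y ≠ x := Finset.ne_of_mem_erase hy
    simp only [nodePotential, Function.update_of_ne hy]
  have hxx : nodePotential K c (Function.update par x (rt x)) rk x + d ≤
      nodePotential K c par rk x := by
    simp only [nodePotential, Function.update_self, if_neg hp, if_neg hx.symm]
    omega
  omega

/-- Amortized cost of path compression. The nodes on the path whose level occurs again above them
lose potential; the others have distinct levels, collected in `Lv`. -/
theorem exists_compress (F : Forest len par rk rt) {K : ℕ} (hK : len < ack K 1) (c : ℕ)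
    {x r l : ℕ} (h1 : 1 ≤ x) (h2 : x ≤ len) (hr : rt x = r) (hc : Climb par x r l) :
    ∃ (par' : ℕ → ℕ) (Lv : Finset ℕ), Compress r par x par' l ∧ Forest len par' rk rt ∧
      (∀ k ∈ Lv, k < K ∧ ack k (rk x + 1) ≤ rk r + 1) ∧
      forestPotential K c len par' rk + l ≤ forestPotential K c len par rk + Lv.card := by
  induction l generalizing x par with
  | zero =>
    cases hc
    exact ⟨par, ∅, .done par, F, by simp, by simp⟩
  | succ l ih =>
    cases hc with
    | step _ _ _ hx hc =>
    have hxr : x ≠ rt x := fun h => hx (by have := F.par_rt x h1 h2; rwa [← h] at this)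
    obtain ⟨h3, h4⟩ := F.par_mem x h1 h2
    have hlt := F.rank_lt x h1 h2 hx
    have F' := F.redirect h1 h2 hxr
    have hrt : rt (par x) = r := (F.rt_par x h1 h2).trans hr
    have hle : rk (par x) ≤ rk r := by
      have := F.rank_le_root h3 h4
      rwa [hrt] at this
    have hc' := F.climb_update (x := x) (rt x) h3 h4 hlt hc
    obtain ⟨par', Lv, hcomp, hF, hLv, hpot⟩ := ih F' h3 h4 hrt hc'
    subst hr
    have hbound : rk (par x) + 1 < ack K (rk x + 1) := by
      have := F.rank_lt_len h3 h4
      have := ack_mono_right K (show 1 ≤ rk x + 1 by omega)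
      omega
    obtain ⟨k, hk, hk1, hk2⟩ := exists_ack_level (K := K) (r := rk x + 1)
      (s := rk (par x) + 1) (by omega) hbound
    have hup : ∀ j, ack j (rk x + 1) ≤ ack j (rk (par x) + 1) := fun j =>
      ack_mono_right j (by omega)
    -- if the level `k` of `x` occurs again above, then `ack k (rk (par x) + 1) ≤ rk (rt x) + 1`
    by_cases hmem : k ∈ Lv
    · have hd := rankPotential_drop (K := K) (s' := rk (rt x) + 1) (by omega) hk (by omega) hk2
        (hLv k hmem).2
      have := F.potential_redirect K c h1 h2 hxr hd
      refine ⟨par', Lv, .step _ _ _ _ hxr hcomp, hF, ?_, by omega⟩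
      exact fun j hj => ⟨(hLv j hj).1, (hup j).trans (hLv j hj).2⟩
    · have := F.potential_redirect K c (d := 0) h1 h2 hxr
        (rankPotential_anti K _ (by omega))
      refine ⟨par', insert k Lv, .step _ _ _ _ hxr hcomp, hF, ?_, ?_⟩
      · intro j hj
        rcases Finset.mem_insert.1 hj with rfl | hj
        · exact ⟨hk, by omega⟩
        · exact ⟨(hLv j hj).1, (hup j).trans (hLv j hj).2⟩
      · rw [Finset.card_insert_of_notMem hmem]
        omega

/-- A find operation from `x` with path compression: the path has some length `l`, and all but
`K` of its steps are paid for by a loss of potential. -/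
theorem find (F : Forest len par rk rt) {K : ℕ} (hK : len < ack K 1) (c : ℕ)
    {x : ℕ} (h1 : 1 ≤ x) (h2 : x ≤ len) :
    ∃ (par' : ℕ → ℕ) (l : ℕ), Climb par x (rt x) l ∧ Compress (rt x) par x par' l ∧
      Forest len par' rk rt ∧
      forestPotential K c len par' rk + l ≤ forestPotential K c len par rk + K := by
  obtain ⟨l, hl⟩ := F.exists_climb h1 h2
  obtain ⟨par', Lv, hcomp, hF, hLv, hpot⟩ := F.exists_compress hK c h1 h2 rfl hl
  refine ⟨par', l, hl, hcomp, hF, hpot.trans ?_⟩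
  have : Lv.card ≤ K := by
    have hsub : Lv ⊆ Finset.range K := fun k hk => Finset.mem_range.2 (hLv k hk).1
    simpa using Finset.card_le_card hsub
  omega

/-- Linking a root `a` below another root `b`. If the ranks agree, the rank of `b` grows by one. -/
theorem link (F : Forest len par rk rt) {a b : ℕ} {rk' : ℕ → ℕ} (ha1 : 1 ≤ a) (ha2 : a ≤ len)
    (hb1 : 1 ≤ b) (hb2 : b ≤ len) (hab : a ≠ b) (ha : par a = a) (hb : par b = b)
    (hrk : ∀ x, x ≠ b → rk' x = rk x) (hrb : rk' b = if rk a = rk b then rk b + 1 else rk b)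
    (hle : rk a ≤ rk b) :
    Forest len (Function.update par a b) rk' (fun x => if rt x = a then b else rt x) := by
  have hra := F.rt_eq a ha1 ha2 ha
  have hrtb := F.rt_eq b hb1 hb2 hb
  have hab' : rk' a < rk' b := by
    rw [hrk a hab, hrb]; split_ifs <;> omega
  have hbge : rk b ≤ rk' b := by rw [hrb]; split_ifs <;> omega
  have hble : rk' b ≤ rk b + 1 := by rw [hrb]; split_ifs <;> omega
  refine ⟨?_, ?_, ?_, ?_, ?_, ?_, ?_⟩
  · intro x h1 h2
    by_cases hx : x = a
    · subst hx; simp [hb1, hb2]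
    · rw [Function.update_of_ne hx]; exact F.par_mem x h1 h2
  · intro x h1 h2
    split_ifs
    · exact ⟨hb1, hb2⟩
    · exact F.rt_mem x h1 h2
  · intro x h1 h2
    by_cases hx : x = a
    · subst hx; simp [hra, hrtb]
    · rw [Function.update_of_ne hx]; simp only [F.rt_par x h1 h2]
  · intro x h1 h2
    split_ifs with h
    · rw [Function.update_of_ne hab.symm, hb]
    · rw [Function.update_of_ne h]; exact F.par_rt x h1 h2
  · intro x h1 h2 hx
    by_cases hxa : x = a
    · subst hxa; simp at hx; exact absurd hx.symm hab
    · rw [Function.update_of_ne hxa] at hx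
      simp only [F.rt_eq x h1 h2 hx, if_neg hxa]
  · intro x h1 h2 hx
    by_cases hxa : x = a
    · subst hxa; simpa using hab'
    · rw [Function.update_of_ne hxa] at hx ⊢
      have hlt := F.rank_lt x h1 h2 hx
      have hxb : x ≠ b := by rintro rfl; exact hx hb
      rw [hrk x hxb]
      by_cases hpb : par x = b
      · rw [hpb] at hlt ⊢; omega
      · rw [hrk _ hpb]; exact hlt
  · intro x h1 h2
    have hroots : (Finset.Icc 1 len).filter (fun y => Function.update par a b y = y) =
        ((Finset.Icc 1 len).filter (fun y => par y = y)).erase a := by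
      ext y
      simp only [Finset.mem_filter, Finset.mem_erase]
      by_cases hy : y = a
      · subst hy; simp [hab.symm]
      · simp [hy]
    have hmem : a ∈ (Finset.Icc 1 len).filter (fun y => par y = y) := by simp [ha1, ha2, ha]
    rw [hroots, Finset.card_erase_of_mem hmem]
    have hpos := Finset.card_pos.2 ⟨a, hmem⟩
    have h3 := F.rank_le x h1 h2
    by_cases hxb : x = b
    · subst hxb; omega
    · rw [hrk x hxb]; omega

/-- A link releases the amount `c`, although the rank of the new root may grow: the growth is
paid for by the other root, which stops being a root. -/
theorem potential_link (K c : ℕ) {a b : ℕ} {rk' : ℕ → ℕ} (ha1 : 1 ≤ a)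
    (ha2 : a ≤ len) (hb1 : 1 ≤ b) (hb2 : b ≤ len) (hab : a ≠ b) (ha : par a = a) (hb : par b = b)
    (hrk : ∀ x, x ≠ b → rk' x = rk x) (hrb : rk' b = if rk a = rk b then rk b + 1 else rk b)
    (hle : rk a ≤ rk b) :
    forestPotential K c len (Function.update par a b) rk' + c ≤ forestPotential K c len par rk := by
  have hbge : rk b ≤ rk' b := by rw [hrb]; split_ifs <;> omega
  have hble : rk' b ≤ rk b + 1 := by rw [hrb]; split_ifs <;> omega
  have hma : a ∈ Finset.Icc 1 len := Finset.mem_Icc.2 ⟨ha1, ha2⟩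
  have hmb : b ∈ (Finset.Icc 1 len).erase a :=
    Finset.mem_erase.2 ⟨hab.symm, Finset.mem_Icc.2 ⟨hb1, hb2⟩⟩
  unfold forestPotential
  rw [← Finset.add_sum_erase _ _ hma, ← Finset.add_sum_erase _ _ hmb,
    ← Finset.add_sum_erase _ _ hma, ← Finset.add_sum_erase _ _ hmb]
  have hrest : ∑ y ∈ ((Finset.Icc 1 len).erase a).erase b,
        nodePotential K c (Function.update par a b) rk' y ≤
      ∑ y ∈ ((Finset.Icc 1 len).erase a).erase b, nodePotential K c par rk y := by
    refine Finset.sum_le_sum fun y hy => ?_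
    have hyb : y ≠ b := Finset.ne_of_mem_erase hy
    have hya : y ≠ a := Finset.ne_of_mem_erase (Finset.mem_of_mem_erase hy)
    simp only [nodePotential, Function.update_of_ne hya, hrk y hyb]
    have : rk (par y) ≤ rk' (par y) := by
      by_cases h : par y = b
      · rw [h]; exact hbge
      · rw [hrk _ h]
    have := rankPotential_anti K (rk y + 1) (Nat.add_le_add_right this 1)
    omega
  have h1 : nodePotential K c (Function.update par a b) rk' a + K + c ≤
      nodePotential K c par rk a := by
    simp only [nodePotential, Function.update_self, if_neg hab.symm, ha, if_true, hrk a hab]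
    have := rankPotential_anti K (rk a + 1) (show rk a + 1 ≤ rk' b + 1 by omega)
    omega
  have h2 : nodePotential K c (Function.update par a b) rk' b ≤
      nodePotential K c par rk b + K := by
    simp only [nodePotential, Function.update_of_ne hab.symm, hb, if_true, rankPotential_self]
    have : K * (rk' b + 1 + 1) ≤ K * (rk b + 1 + 1) + K := by
      calc K * (rk' b + 1 + 1) ≤ K * (rk b + 1 + 1 + 1) := Nat.mul_le_mul_left _ (by omega)
        _ = _ := by ring
    omega
  omega

/-- A new singleton tree. -/
theorem grow (F : Forest len par rk rt) (hrk : rk (len + 1) = 0) :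
    Forest (len + 1) (Function.update par (len + 1) (len + 1)) rk
      (Function.update rt (len + 1) (len + 1)) := by
  have hne : ∀ x, x ≤ len → x ≠ len + 1 := fun x h => by omega
  have key : ∀ x, 1 ≤ x → x ≤ len + 1 → (1 ≤ x ∧ x ≤ len) ∨ x = len + 1 := fun x _ _ => by omega
  refine ⟨?_, ?_, ?_, ?_, ?_, ?_, ?_⟩
  · intro x h1 h2
    rcases key x h1 h2 with ⟨h3, h4⟩ | rfl
    · rw [Function.update_of_ne (hne x h4)]; have := F.par_mem x h3 h4; omega
    · simp
  · intro x h1 h2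
    rcases key x h1 h2 with ⟨h3, h4⟩ | rfl
    · rw [Function.update_of_ne (hne x h4)]; have := F.rt_mem x h3 h4; omega
    · simp
  · intro x h1 h2
    rcases key x h1 h2 with ⟨h3, h4⟩ | rfl
    · rw [Function.update_of_ne (hne x h4), Function.update_of_ne (hne x h4),
        Function.update_of_ne (hne _ (F.par_mem x h3 h4).2), F.rt_par x h3 h4]
    · simp
  · intro x h1 h2
    rcases key x h1 h2 with ⟨h3, h4⟩ | rfl
    · rw [Function.update_of_ne (hne x h4), Function.update_of_ne (hne _ (F.rt_mem x h3 h4).2),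
        F.par_rt x h3 h4]
    · simp
  · intro x h1 h2
    rcases key x h1 h2 with ⟨h3, h4⟩ | rfl
    · rw [Function.update_of_ne (hne x h4), Function.update_of_ne (hne x h4)]
      exact F.rt_eq x h3 h4
    · simp
  · intro x h1 h2
    rcases key x h1 h2 with ⟨h3, h4⟩ | rfl
    · rw [Function.update_of_ne (hne x h4)]
      exact F.rank_lt x h3 h4
    · simp
  · have hcard : ((Finset.Icc 1 (len + 1)).filter
        (fun y => Function.update par (len + 1) (len + 1) y = y)).card ≤
        ((Finset.Icc 1 len).filter (fun y => par y = y)).card + 1 := by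
      rw [← Finset.card_insert_of_notMem (a := len + 1) (by simp)]
      apply Finset.card_le_card
      intro y
      simp only [Finset.mem_filter, Finset.mem_Icc, Finset.mem_insert]
      rintro ⟨⟨h1, h2⟩, h3⟩
      rcases key y h1 h2 with ⟨h4, h5⟩ | rfl
      · rw [Function.update_of_ne (hne y h5)] at h3
        exact .inr ⟨⟨h4, h5⟩, h3⟩
      · exact .inl rfl
    have hcard' : ((Finset.Icc 1 len).filter (fun y => par y = y)).card ≤ len := by
      simpa using Finset.card_filter_le (Finset.Icc 1 len) (fun y => par y = y)
    intro x h1 h2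
    rcases key x h1 h2 with ⟨h3, h4⟩ | rfl
    · have := F.rank_le x h3 h4
      omega
    · omega

theorem potential_grow (K c : ℕ) (hrk : rk (len + 1) = 0) :
    forestPotential K c (len + 1) (Function.update par (len + 1) (len + 1)) rk ≤
      forestPotential K c len par rk + (3 * K + c) := by
  unfold forestPotential
  rw [Finset.sum_Icc_succ_top (by omega)]
  have h1 : ∑ x ∈ Finset.Icc 1 len,
      nodePotential K c (Function.update par (len + 1) (len + 1)) rk x =
      ∑ x ∈ Finset.Icc 1 len, nodePotential K c par rk x := by
    refine Finset.sum_congr rfl fun x hx => ?_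
    have : x ≠ len + 1 := by have := Finset.mem_Icc.1 hx; omega
    simp only [nodePotential, Function.update_of_ne this]
  have h2 : nodePotential K c (Function.update par (len + 1) (len + 1)) rk (len + 1) =
      3 * K + c := by
    simp only [nodePotential, Function.update_self, hrk, if_true, rankPotential_self]
    ring
  omega

end Forest

/-! ### Reasoning about programs -/

namespace RAM

/-- `p`, started in `s`, halts after some number `t` of steps in some configuration `s'` with
`Q s' t`. -/
def Ends (p : Program) (s : State) (Q : State → ℕ → Prop) : Prop :=
  ∃ s' t, Runs p s s' t ∧ Q s' t

theorem Ends.mono {p : Program} {s : State} {Q Q' : State → ℕ → Prop} (h : Ends p s Q)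
    (hQ : ∀ s' t, Q s' t → Q' s' t) : Ends p s Q' := by
  obtain ⟨s', t, hr, hq⟩ := h
  exact ⟨s', t, hr, hQ _ _ hq⟩

theorem Ends.skip {s : State} {Q : State → ℕ → Prop} (h : Q s 0) : Ends .skip s Q :=
  ⟨s, 0, .skip s, h⟩

theorem Ends.seq {p q : Program} {s : State} {Q : State → ℕ → Prop}
    (h : Ends p s fun s₁ t₁ => Ends q s₁ fun s₂ t₂ => Q s₂ (t₁ + t₂)) : Ends (.seq p q) s Q := by
  obtain ⟨s₁, t₁, h₁, s₂, t₂, h₂, hQ⟩ := h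
  exact ⟨s₂, t₁ + t₂, .seq h₁ h₂, hQ⟩

theorem Ends.cond {b : Test} {p q : Program} {s : State} {Q : State → ℕ → Prop}
    (h₁ : b.Holds s → Ends p s fun s' t => Q s' (t + 1))
    (h₂ : ¬ b.Holds s → Ends q s fun s' t => Q s' (t + 1)) : Ends (.cond b p q) s Q := by
  by_cases hb : b.Holds s
  · obtain ⟨s', t, hr, hQ⟩ := h₁ hb
    exact ⟨s', t + 1, .condTrue hb hr, hQ⟩
  · obtain ⟨s', t, hr, hQ⟩ := h₂ hb
    exact ⟨s', t + 1, .condFalse hb hr, hQ⟩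

/-- A loop, with a relation `I s d` between configurations and potentials: a round pays for itself
and for the evaluation of the test by a decrease of the potential. -/
theorem Ends.loop {b : Test} {p : Program} (I : State → ℕ → Prop)
    (hp : ∀ s d, I s d → b.Holds s →
      Ends p s fun s' t => ∃ d', I s' d' ∧ t + 1 + d' ≤ d)
    {s : State} {d : ℕ} (h : I s d) :
    Ends (.loop b p) s fun s' t => ∃ d', I s' d' ∧ ¬ b.Holds s' ∧ t + d' ≤ d + 1 := by
  induction d using Nat.strong_induction_on generalizing s with
  | _ d ih =>
    by_cases hb : b.Holds s
    · obtain ⟨s₁, t₁, h₁, d₁, hI, hd⟩ := hp s d h hb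
      obtain ⟨s₂, t₂, h₂, d₂, hI₂, hb₂, hd₂⟩ := ih d₁ (by omega) hI
      exact ⟨s₂, t₁ + t₂ + 1, .loopTrue hb h₁ h₂, d₂, hI₂, hb₂, by omega⟩
    · exact ⟨s, 1, .loopFalse hb, d, h, hb, by omega⟩

/-- A sequence of elementary instructions. -/
def block : List Instr → Program
  | [] => .skip
  | i :: l => .seq (.instr i) (block l)

/-- The configuration after the instructions of a list. -/
def execs (s : State) : List Instr → State
  | [] => s
  | i :: l => execs (i.apply s) l

theorem runs_block (l : List Instr) (s : State) : Runs (block l) s (execs s l) l.length := by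
  induction l generalizing s with
  | nil => exact .skip s
  | cons i l ih =>
    have := Runs.seq (.instr i s) (ih (i.apply s))
    rwa [Nat.add_comm] at this

theorem Ends.block {l : List Instr} {s : State} {Q : State → ℕ → Prop}
    (h : Q (execs s l) l.length) : Ends (block l) s Q :=
  ⟨_, _, runs_block l s, h⟩

end RAM

/-! ### Linked lists in arrays -/

/-- In the array `next`, the list `l` of nonzero entries is stored as a linked list starting
at `h`; the number `0` marks the end. -/
def Chain (next : ℕ → ℕ) : ℕ → List ℕ → Prop
  | h, [] => h = 0
  | h, x :: l => h = x ∧ x ≠ 0 ∧ Chain next (next x) l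

theorem Chain.update {next : ℕ → ℕ} {h : ℕ} {l : List ℕ} (hc : Chain next h l) {y : ℕ} (v : ℕ)
    (hy : y ∉ l) : Chain (Function.update next y v) h l := by
  induction l generalizing h with
  | nil => exact hc
  | cons x l ih =>
    simp only [List.mem_cons, not_or] at hy
    refine ⟨hc.1, hc.2.1, ?_⟩
    rw [Function.update_of_ne (Ne.symm hy.1)]
    exact ih hc.2.2 hy.2

theorem Chain.eq_nil {next : ℕ → ℕ} {l : List ℕ} (hc : Chain next 0 l) : l = [] := by
  cases l with
  | nil => rfl
  | cons x l => exact absurd hc.1.symm hc.2.1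

theorem Chain.exists_cons {next : ℕ → ℕ} {h : ℕ} {l : List ℕ} (hc : Chain next h l) (hh : h ≠ 0) :
    ∃ l', l = h :: l' ∧ Chain next (next h) l' := by
  cases l with
  | nil => exact absurd hc hh
  | cons x l => obtain ⟨rfl, _, h2⟩ := hc; exact ⟨l, rfl, h2⟩

/-! ### The state of the search and its invariants -/

/-- A hypergraph on the nodes `0, …, n - 1` with hyperedges `1, …, m`, prepared for the search: `tl`
and `hd` are the tails and heads, `hl e` is the length of the list of the elements of `hd e` in the
input, and `Reach` is reachability. A hyperedge with an empty tail counts as having no heads. The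
original hyperedges with an empty tail and a nonempty head are represented by `z`: if `z ≠ 0`, the
node `z - 1` is reachable from all nodes, and stands in for their empty tails. The field `closed`
expresses that `Reach` is the least relation with these properties. -/
structure SearchProblem where
  n : ℕ
  m : ℕ
  z : ℕ
  tl : ℕ → Finset ℕ
  hd : ℕ → Finset ℕ
  hl : ℕ → ℕ
  Reach : ℕ → ℕ → Prop
  refl : ∀ u < n, Reach u u
  trans : ∀ u v w, Reach u v → Reach v w → Reach u w
  tl_lt : ∀ e, 1 ≤ e → e ≤ m → ∀ v ∈ tl e, v < n
  hd_lt : ∀ e, 1 ≤ e → e ≤ m → ∀ v ∈ hd e, v < n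
  edge : ∀ e, 1 ≤ e → e ≤ m → ∀ u < n, (∀ v ∈ tl e, Reach u v) → ∀ w ∈ hd e, Reach u w
  z_lt : z ≠ 0 → z - 1 < n
  z_reach : z ≠ 0 → ∀ u < n, Reach u (z - 1)
  closed : ∀ C : Set ℕ, (∀ u ∈ C, u < n) →
    (∀ e, 1 ≤ e → e ≤ m → (tl e).Nonempty → (∀ v ∈ tl e, v ∈ C) → ∀ w ∈ hd e, w ∈ C) →
    (z ≠ 0 → z - 1 ∈ C) → ∀ u ∈ C, ∀ v, Reach u v → v ∈ C

/-- The registers and arrays that the search uses. The search visits nodes; the node visited as the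
`x`-th one has position `x ≥ 1`, and position `0` means that the node has not been visited.
* `n`: the number of nodes; `len`: the number of nodes visited; `pos v`: the position of the node
  `v`; `stk x`: the node at position `x`; `cur`: all nodes below are dead.
* `base`: the nodes at positions `1, …, base` are dead, those at `base + 1, …, len` form the path,
  which is divided into intervals of mutually reachable nodes. An interval is represented by its
  least position, its bottom.
* `top`: the bottom of the last interval; `prevb b`: the bottom of the interval below the one with
  bottom `b`.
* `par`, `rk`: parents and ranks in a union-find forest on positions, whose trees are the intervals;
  `low r`: the bottom of the interval with root `r`; `root b`: the root of the interval with
  bottom `b`.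
* `work i` for `i < wl`: a stack of nodes to explore; `wb b`: the beginning of the segment that
  belongs to the interval with bottom `b`.
* `cnt e`: the number of tail nodes of the hyperedge `e` that are not yet accounted for; `minp e`:
  the least position of the others, or `0`.
* `pend b`, `nextp`: the linked list of hyperedges that wait at the interval with bottom `b`.
* `occ`: the tail occurrences of the last node that are still to be processed, in a linked list with
  links `nexto`; `occh v`: the list of all tail occurrences of `v`; `edgeof x`: the hyperedge of the
  occurrence `x`.
* `inp`: the input; `hp e`: the position of the head of `e` in the input; `z`: see `SearchProblem`.
* `out`, `op`: the output and its next free position; `cc`: the number of components found. -/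
structure Memory where
  (n len base top cur wl occ z op cc : ℕ)
  (inp out pos stk work wb prevb par rk low root pend nextp cnt minp hp occh nexto edgeof : ℕ → ℕ)

/-- Auxiliary data that the machine does not hold: `lo x` is the bottom of the interval of
position `x`, `rt x` its root in the union-find forest, `pl b` the list of waiting hyperedges of the
interval with bottom `b`, `fresh` the set of hyperedges whose heads have not been copied to the
work stack, `un e` the set of tail nodes of `e` not yet accounted for, `rest` the list of
occurrences of the last node still to be processed, and `comps` the list of components found. -/
structure Ghost where
  lo : ℕ → ℕ
  rt : ℕ → ℕ
  pl : ℕ → List ℕ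
  fresh : Finset ℕ
  un : ℕ → Finset ℕ
  rest : List ℕ
  comps : List (List ℕ)

/-- The nodes visited are `stk 1, …, stk len`, and `pos` is the inverse numbering. -/
structure StackInv (n len : ℕ) (pos stk : ℕ → ℕ) : Prop where
  len_le : len ≤ n
  stk_lt : ∀ x, 1 ≤ x → x ≤ len → stk x < n
  pos_stk : ∀ x, 1 ≤ x → x ≤ len → pos (stk x) = x
  stk_pos : ∀ v < n, pos v ≠ 0 → stk (pos v) = v
  pos_le : ∀ v < n, pos v ≤ len

/-- The positions `base + 1, …, len` are divided into intervals. -/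
structure IntervalInv (base len : ℕ) (lo : ℕ → ℕ) (top : ℕ) (prevb : ℕ → ℕ) : Prop where
  base_le : base ≤ len
  lo_gt : ∀ x, base < x → x ≤ len → base < lo x
  lo_le : ∀ x, base < x → x ≤ len → lo x ≤ x
  lo_lo : ∀ x, base < x → x ≤ len → lo (lo x) = lo x
  lo_mono : ∀ x y, base < x → x ≤ y → y ≤ len → lo x ≤ lo y
  top_eq : base < len → top = lo len
  prevb_eq : ∀ b, base + 1 < b → b ≤ len → lo b = b → prevb b = lo (b - 1)

/-- The intervals are trees of the union-find forest. -/
structure LinkInv (base len : ℕ) (lo par rk rt low root : ℕ → ℕ) : Prop where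
  forest : Forest len par rk rt
  rk_zero : ∀ x, len < x → rk x = 0
  low_rt : ∀ x, base < x → x ≤ len → low (rt x) = lo x
  root_lo : ∀ x, base < x → x ≤ len → root (lo x) = rt x

/-- Later positions are reachable from earlier ones, and the bottom of an interval from all of
its positions. -/
structure PathInv (D : SearchProblem) (base len : ℕ) (lo stk : ℕ → ℕ) : Prop where
  up : ∀ x y, base < x → x ≤ y → y ≤ len → D.Reach (stk x) (stk y)
  down : ∀ x, base < x → x ≤ len → D.Reach (stk x) (stk (lo x))

/-- The segment of the work stack from `wb b` on holds nodes that are reachable from the interval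
with bottom `b`. -/
structure WorkInv (D : SearchProblem) (base len wl : ℕ) (lo stk work wb : ℕ → ℕ) : Prop where
  wb_le : ∀ b, base < b → b ≤ len → lo b = b → wb b ≤ wl
  wb_mono : ∀ b b', base < b → b ≤ b' → b' ≤ len → lo b = b → lo b' = b' → wb b ≤ wb b'
  reach : ∀ b, base < b → b ≤ len → lo b = b → ∀ i, wb b ≤ i → i < wl →
    work i < D.n ∧ D.Reach (stk b) (work i)

/-- All heads of `e` lie in the interval with bottom `b`, or in its segment of the work stack. -/
def HeadsSeen (D : SearchProblem) (base len wl : ℕ) (lo pos work wb : ℕ → ℕ) (b e : ℕ) : Prop :=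
  ∀ h ∈ D.hd e, (base < pos h ∧ lo (pos h) = b) ∨
    ∃ i < wl, wb b ≤ i ∧ (∀ b', b < b' → b' ≤ len → lo b' = b' → i < wb b') ∧ work i = h

/-- The bookkeeping of tails: `cnt e` tail nodes of `e` are not yet accounted for, and the others
have least position `minp e`. -/
structure TailInv (D : SearchProblem) (len : ℕ) (pos stk cnt minp : ℕ → ℕ) (un : ℕ → Finset ℕ)
    (rest : List ℕ) : Prop where
  un_iff : ∀ e, 1 ≤ e → e ≤ D.m → ∀ v, v ∈ un e ↔
    v ∈ D.tl e ∧ (pos v = 0 ∨ (v = stk len ∧ e ∈ rest))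
  cnt_eq : ∀ e, 1 ≤ e → e ≤ D.m → cnt e = (un e).card
  minp_le : ∀ e, 1 ≤ e → e ≤ D.m → ∀ v ∈ D.tl e, v ∉ un e → minp e ≠ 0 ∧ minp e ≤ pos v
  exists_minp : ∀ e, 1 ≤ e → e ≤ D.m → minp e ≠ 0 → ∃ v ∈ D.tl e, v ∉ un e ∧ pos v = minp e

/-- A hyperedge whose tail is completely visited waits at the interval of the least position of
its tail, or its heads are taken care of. -/
structure EdgeInv (D : SearchProblem) (base len wl : ℕ) (lo pos work wb minp pend nextp : ℕ → ℕ)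
    (un : ℕ → Finset ℕ) (pl : ℕ → List ℕ) (fresh : Finset ℕ) : Prop where
  registered : ∀ e, 1 ≤ e → e ≤ D.m → un e = ∅ → (D.tl e).Nonempty → base < minp e →
    e ∈ pl (lo (minp e)) ∨ HeadsSeen D base len wl lo pos work wb (lo (minp e)) e
  fresh_of_un : ∀ e, 1 ≤ e → e ≤ D.m → un e ≠ ∅ → e ∈ fresh
  chain : ∀ b, base < b → b ≤ len → lo b = b → Chain nextp (pend b) (pl b)
  nodup : ∀ b, base < b → b ≤ len → lo b = b → (pl b).Nodup
  mem_pl : ∀ b, base < b → b ≤ len → lo b = b → ∀ e ∈ pl b, (1 ≤ e ∧ e ≤ D.m) ∧ e ∈ fresh ∧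
    un e = ∅ ∧ (D.tl e).Nonempty ∧ base < minp e ∧ lo (minp e) = b
  pend_zero : ∀ x, len < x → pend x = 0

/-- The tail occurrences of the last node `v` of the path that are still to be processed. -/
structure OccInv (D : SearchProblem) (base len occ v : ℕ) (nexto edgeof : ℕ → ℕ)
    (rest : List ℕ) : Prop where
  chain : Chain nexto occ rest
  nodup : (rest.map edgeof).Nodup
  mem : ∀ e ∈ rest.map edgeof, (1 ≤ e ∧ e ≤ D.m) ∧ v ∈ D.tl e
  rest_nil : base = len → rest = []

/-- A list of numbers, preceded by its length. -/
def withLength (l : List ℕ) : List ℕ := l.length :: l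

/-- The components found are minimal, and every node that has left the path reaches one. -/
structure OutInv (D : SearchProblem) (base op cc : ℕ) (pos stk out : ℕ → ℕ)
    (comps : List (List ℕ)) : Prop where
  op_eq : op = (comps.flatMap withLength).length + 1
  cc_eq : cc = comps.length
  out_eq : ∀ i < (comps.flatMap withLength).length,
    out (i + 1) = (comps.flatMap withLength).getD i 0
  nodup : ∀ l ∈ comps, l.Nodup
  ne_nil : ∀ l ∈ comps, l ≠ []
  dead : ∀ l ∈ comps, ∀ v ∈ l, v < D.n ∧ pos v ≠ 0 ∧ pos v ≤ base
  scc : ∀ l ∈ comps, ∀ u ∈ l, ∀ v, v ∈ l ↔ D.Reach u v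
  disjoint : comps.Pairwise List.Disjoint
  reach : ∀ x, 1 ≤ x → x ≤ base → ∃ l ∈ comps, ∃ u ∈ l, D.Reach (stk x) u

/-- The part of the memory that the search only reads. -/
structure StaticInv (D : SearchProblem) (ol : ℕ → List ℕ) (M : Memory) : Prop where
  n_eq : M.n = D.n
  z_eq : M.z = D.z
  hl_eq : ∀ e, 1 ≤ e → e ≤ D.m → M.inp (M.hp e) = D.hl e
  hd_iff : ∀ e, 1 ≤ e → e ≤ D.m → ∀ v, v ∈ D.hd e ↔ ∃ i < D.hl e, M.inp (M.hp e + 1 + i) = v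
  chain : ∀ v < D.n, Chain M.nexto (M.occh v) (ol v)
  nodup : ∀ v < D.n, ((ol v).map M.edgeof).Nodup
  mem_iff : ∀ v < D.n, ∀ e, e ∈ (ol v).map M.edgeof ↔ (1 ≤ e ∧ e ≤ D.m) ∧ v ∈ D.tl e

/-- The invariant of the search. -/
structure SearchInv (D : SearchProblem) (ol : ℕ → List ℕ) (M : Memory) (G : Ghost) : Prop where
  static : StaticInv D ol M
  cur_le : M.cur ≤ D.n
  cur_dead : ∀ v < M.cur, M.pos v ≠ 0 ∧ M.pos v ≤ M.base
  stack : StackInv D.n M.len M.pos M.stk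
  interval : IntervalInv M.base M.len G.lo M.top M.prevb
  link : LinkInv M.base M.len G.lo M.par M.rk G.rt M.low M.root
  path : PathInv D M.base M.len G.lo M.stk
  workInv : WorkInv D M.base M.len M.wl G.lo M.stk M.work M.wb
  tail : TailInv D M.len M.pos M.stk M.cnt M.minp G.un (G.rest.map M.edgeof)
  edge : EdgeInv D M.base M.len M.wl G.lo M.pos M.work M.wb M.minp M.pend M.nextp G.un G.pl G.fresh
  occInv : OccInv D M.base M.len M.occ (M.stk M.len) M.nexto M.edgeof G.rest
  outInv : OutInv D M.base M.op M.cc M.pos M.stk M.out G.comps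

/-- The potential of the search: an upper bound for the number of steps still to be made. The terms
pay for find operations and merging, for visits of nodes, for the output, for the choice of new
starting nodes, for the processing of tail occurrences, for copying heads to the work stack, and for
exploring the nodes on the work stack. The factor `7` of the forest potential is the number of
program steps for each node on the path of a find operation. -/
def searchPotential (D : SearchProblem) (K : ℕ) (M : Memory) (G : Ghost) : ℕ :=
  7 * forestPotential K 10 M.len M.par M.rk + (21 * K + 200) * (D.n - M.len) +
    60 * (M.len - M.base) + 60 * (D.n - M.cur) +
    (7 * K + 60) * ∑ e ∈ Finset.Icc 1 D.m, M.cnt e + 50 * ∑ e ∈ G.fresh, (D.hl e + 1) + 40 * M.wl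

/-! ### The steps of the search -/

/-- The node `x` is visited and put on top of the path. -/
def Memory.push (M : Memory) (x : ℕ) : Memory :=
  { M with
    len := M.len + 1
    top := M.len + 1
    occ := M.occh x
    pos := Function.update M.pos x (M.len + 1)
    stk := Function.update M.stk (M.len + 1) x
    wb := Function.update M.wb (M.len + 1) M.wl
    prevb := Function.update M.prevb (M.len + 1) M.top
    par := Function.update M.par (M.len + 1) (M.len + 1)
    low := Function.update M.low (M.len + 1) (M.len + 1)
    root := Function.update M.root (M.len + 1) (M.len + 1) }

/-- The auxiliary data after a visit, where `slots` is the list of tail occurrences of the node: the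
new position is an interval by itself. -/
def Ghost.push (G : Ghost) (len : ℕ) (slots : List ℕ) : Ghost :=
  { G with
    lo := Function.update G.lo (len + 1) (len + 1)
    rt := Function.update G.rt (len + 1) (len + 1)
    pl := Function.update G.pl (len + 1) []
    rest := slots }

section Steps

variable {D : SearchProblem} {ol : ℕ → List ℕ} {M : Memory} {G : Ghost}

/-- A node that has not been visited is put on the path, which is either empty or reaches
the node. -/
theorem SearchInv.push (h : SearchInv D ol M G) {x : ℕ} (hx : x < D.n) (hpos : M.pos x = 0)
    (hrest : G.rest = []) (hreach : M.base < M.len → D.Reach (M.stk M.top) x) :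
    SearchInv D ol (M.push x) (G.push M.len (ol x)) := by
  have hbl := h.interval.base_le
  have key : ∀ y, y ≤ M.len + 1 → y ≤ M.len ∨ y = M.len + 1 := fun y _ => by omega
  have hne : ∀ y, y ≤ M.len → y ≠ M.len + 1 := fun y _ => by omega
  have hlo : ∀ y, y ≤ M.len → Function.update G.lo (M.len + 1) (M.len + 1) y = G.lo y :=
    fun y hy => Function.update_of_ne (hne y hy) _ _
  have hlo' : Function.update G.lo (M.len + 1) (M.len + 1) (M.len + 1) = M.len + 1 :=
    Function.update_self ..
  have hstk : ∀ y, y ≤ M.len → Function.update M.stk (M.len + 1) x y = M.stk y :=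
    fun y hy => Function.update_of_ne (hne y hy) _ _
  have hstk' : Function.update M.stk (M.len + 1) x (M.len + 1) = x := Function.update_self ..
  have hwb : ∀ y, y ≤ M.len → Function.update M.wb (M.len + 1) M.wl y = M.wb y :=
    fun y hy => Function.update_of_ne (hne y hy) _ _
  have hwb' : Function.update M.wb (M.len + 1) M.wl (M.len + 1) = M.wl := Function.update_self ..
  have hposne : ∀ v, M.pos v ≠ 0 → Function.update M.pos x (M.len + 1) v = M.pos v := fun v hv =>
    Function.update_of_ne (by rintro rfl; exact hv hpos) _ _
  have hpl : ∀ y, y ≤ M.len → Function.update G.pl (M.len + 1) [] y = G.pl y :=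
    fun y hy => Function.update_of_ne (hne y hy) _ _
  have hpl' : Function.update G.pl (M.len + 1) [] (M.len + 1) = [] := Function.update_self ..
  have hvis : ∀ v, (Function.update M.pos x (M.len + 1) v = 0) ↔ M.pos v = 0 ∧ v ≠ x := by
    intro v
    by_cases hv : v = x
    · subst hv; simp
    · rw [Function.update_of_ne hv]; simp [hv]
  have hminp : ∀ e, 1 ≤ e → e ≤ D.m → M.minp e ≤ M.len := by
    intro e h1 h2
    by_cases h0 : M.minp e = 0
    · omega
    · obtain ⟨v, hv, _, hv'⟩ := h.tail.exists_minp e h1 h2 h0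
      rw [← hv']; exact h.stack.pos_le v (D.tl_lt e h1 h2 v hv)
  have hlen : M.len + 1 ≤ D.n := by
    -- the map `stk` embeds the visited positions into the nodes other than `x`
    have hcard := Finset.card_le_card_of_injOn (s := Finset.Icc 1 M.len)
      (t := (Finset.range D.n).erase x) M.stk (by
        intro y hy
        simp only [Finset.coe_Icc, Set.mem_Icc] at hy
        simp only [Finset.coe_erase, Set.mem_sdiff, Finset.mem_coe, Finset.mem_range,
          Set.mem_singleton_iff]
        refine ⟨h.stack.stk_lt y hy.1 hy.2, ?_⟩
        intro hyx
        have := h.stack.pos_stk y hy.1 hy.2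
        rw [hyx, hpos] at this
        omega) (by
        intro y hy y' hy' hyy
        simp only [Finset.coe_Icc, Set.mem_Icc] at hy hy'
        have h1 := h.stack.pos_stk y hy.1 hy.2
        have h2 := h.stack.pos_stk y' hy'.1 hy'.2
        rw [← h1, ← h2, hyy])
    rw [Finset.card_erase_of_mem (Finset.mem_range.2 hx)] at hcard
    simp at hcard
    omega
  have htop : M.base < M.len → M.top = G.lo M.len := h.interval.top_eq
  have hup : ∀ y, M.base < y → y ≤ M.len → D.Reach (M.stk y) x := by
    intro y h1 h2
    have h3 := h.path.up y M.len h1 h2 le_rfl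
    have h4 := h.path.down M.len (by omega) le_rfl
    have h5 := hreach (by omega)
    rw [htop (by omega)] at h5
    exact D.trans _ _ _ (D.trans _ _ _ h3 h4) h5
  refine ⟨?_, h.cur_le, ?_, ?_, ?_, ?_, ?_, ?_, ?_, ?_, ?_, ?_⟩
  · exact ⟨h.static.n_eq, h.static.z_eq, h.static.hl_eq, h.static.hd_iff, h.static.chain,
      h.static.nodup, h.static.mem_iff⟩
  · intro v hv
    have := h.cur_dead v hv
    simp only [Memory.push]
    rwa [hposne v this.1]
  · refine ⟨hlen, ?_, ?_, ?_, ?_⟩ <;> simp only [Memory.push]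
    · intro y h1 h2
      rcases key y h2 with h2 | rfl
      · rw [hstk y h2]; exact h.stack.stk_lt y h1 h2
      · rwa [hstk']
    · intro y h1 h2
      rcases key y h2 with h2 | rfl
      · rw [hstk y h2]
        have := h.stack.pos_stk y h1 h2
        rw [hposne _ (by omega), this]
      · rw [hstk', Function.update_self]
    · intro v hv hv0
      by_cases hvx : v = x
      · subst hvx; rw [Function.update_self, hstk']
      · rw [Function.update_of_ne hvx] at hv0 ⊢
        rw [hstk _ (h.stack.pos_le v hv)]
        exact h.stack.stk_pos v hv hv0
    · intro v hv
      by_cases hvx : v = x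
      · subst hvx; rw [Function.update_self]
      · rw [Function.update_of_ne hvx]
        exact (h.stack.pos_le v hv).trans (Nat.le_succ _)
  · refine ⟨?_, ?_, ?_, ?_, ?_, ?_, ?_⟩ <;> simp only [Memory.push, Ghost.push]
    · omega
    · intro y h1 h2
      rcases key y h2 with h2 | rfl
      · rw [hlo y h2]; exact h.interval.lo_gt y h1 h2
      · rwa [hlo']
    · intro y h1 h2
      rcases key y h2 with h2 | rfl
      · rw [hlo y h2]; exact h.interval.lo_le y h1 h2
      · rw [hlo']
    · intro y h1 h2
      rcases key y h2 with h2 | rfl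
      · rw [hlo y h2, hlo _ ((h.interval.lo_le y h1 h2).trans h2)]; exact h.interval.lo_lo y h1 h2
      · rw [hlo', hlo']
    · intro y y' h1 h2 h3
      rcases key y' h3 with h3 | rfl
      · rw [hlo y (h2.trans h3), hlo y' h3]; exact h.interval.lo_mono y y' h1 h2 h3
      · rw [hlo']
        rcases key y h2 with h2 | rfl
        · rw [hlo y h2]; have := h.interval.lo_le y h1 h2; omega
        · rw [hlo']
    · intro _; rw [hlo']
    · intro b h1 h2 h3
      rcases key b h2 with h2 | rfl
      · rw [hlo b h2] at h3
        rw [hlo (b - 1) (by omega), Function.update_of_ne (hne b h2)]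
        exact h.interval.prevb_eq b h1 h2 h3
      · rw [Function.update_self, Nat.add_sub_cancel, hlo _ le_rfl]
        exact htop (by omega)
  · refine ⟨h.link.forest.grow (h.link.rk_zero _ (by omega)), ?_, ?_, ?_⟩ <;>
      simp only [Memory.push, Ghost.push]
    · exact fun y hy => h.link.rk_zero y (by omega)
    · intro y h1 h2
      rcases key y h2 with h2 | rfl
      · rw [hlo y h2, Function.update_of_ne (hne y h2), Function.update_of_ne
          (hne _ (h.link.forest.rt_mem y (by omega) h2).2)]
        exact h.link.low_rt y h1 h2
      · simp
    · intro y h1 h2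
      rcases key y h2 with h2 | rfl
      · rw [hlo y h2, Function.update_of_ne (hne y h2), Function.update_of_ne
          (hne _ ((h.interval.lo_le y h1 h2).trans h2))]
        exact h.link.root_lo y h1 h2
      · simp
  · refine ⟨?_, ?_⟩ <;> simp only [Memory.push, Ghost.push]
    · intro y y' h1 h2 h3
      rcases key y' h3 with h3 | rfl
      · rw [hstk y (h2.trans h3), hstk y' h3]; exact h.path.up y y' h1 h2 h3
      · rw [hstk']
        rcases key y h2 with h2 | rfl
        · rw [hstk y h2]; exact hup y h1 h2
        · rw [hstk']; exact D.refl x hx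
    · intro y h1 h2
      rcases key y h2 with h2 | rfl
      · rw [hlo y h2, hstk y h2, hstk _ ((h.interval.lo_le y h1 h2).trans h2)]
        exact h.path.down y h1 h2
      · rw [hlo', hstk']; exact D.refl x hx
  · refine ⟨?_, ?_, ?_⟩ <;> simp only [Memory.push, Ghost.push]
    · intro b h1 h2 h3
      rcases key b h2 with h2 | rfl
      · rw [hlo b h2] at h3; rw [hwb b h2]; exact h.workInv.wb_le b h1 h2 h3
      · rw [hwb']
    · intro b b' h1 h2 h3 h4 h5
      rcases key b' h3 with h3 | rfl
      · rw [hlo b (h2.trans h3)] at h4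
        rw [hlo b' h3] at h5
        rw [hwb b (h2.trans h3), hwb b' h3]
        exact h.workInv.wb_mono b b' h1 h2 h3 h4 h5
      · rw [hwb']
        rcases key b h2 with h2 | rfl
        · rw [hlo b h2] at h4; rw [hwb b h2]; exact h.workInv.wb_le b h1 h2 h4
        · rw [hwb']
    · intro b h1 h2 h3 i h4 h5
      rcases key b h2 with h2 | rfl
      · rw [hlo b h2] at h3
        rw [hwb b h2] at h4
        rw [hstk b h2]; exact h.workInv.reach b h1 h2 h3 i h4 h5
      · rw [hwb'] at h4; omega
  · refine ⟨?_, h.tail.cnt_eq, ?_, ?_⟩ <;> simp only [Memory.push, Ghost.push]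
    · intro e h1 h2 v
      rw [h.tail.un_iff e h1 h2, hrest, hstk', hvis]
      constructor
      · rintro ⟨hv, h0 | ⟨_, h0⟩⟩
        · refine ⟨hv, ?_⟩
          by_cases hvx : v = x
          · subst hvx
            exact .inr ⟨rfl, (h.static.mem_iff v hx e).2 ⟨⟨h1, h2⟩, hv⟩⟩
          · exact .inl ⟨h0, hvx⟩
        · simp at h0
      · rintro ⟨hv, ⟨h0, _⟩ | ⟨rfl, _⟩⟩
        · exact ⟨hv, .inl h0⟩
        · exact ⟨hv, .inl hpos⟩
    · intro e h1 h2 v hv hun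
      have h3 := h.tail.minp_le e h1 h2 v hv hun
      have h4 := h.tail.un_iff e h1 h2 v
      rw [hposne v (fun h0 => hun (h4.2 ⟨hv, .inl h0⟩))]
      exact h3
    · intro e h1 h2 h0
      obtain ⟨v, hv, hun, hv'⟩ := h.tail.exists_minp e h1 h2 h0
      have h4 := h.tail.un_iff e h1 h2 v
      exact ⟨v, hv, hun, by rw [hposne v (fun h0 => hun (h4.2 ⟨hv, .inl h0⟩)), hv']⟩
  · refine ⟨?_, h.edge.fresh_of_un, ?_, ?_, ?_, ?_⟩ <;> simp only [Memory.push, Ghost.push]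
    · intro e h1 h2 h3 h4 h5
      have hm := hminp e h1 h2
      have hm' := (h.interval.lo_le _ h5 hm).trans hm
      rw [hlo _ hm, hpl _ hm']
      refine (h.edge.registered e h1 h2 h3 h4 h5).imp_right fun hs v hv => ?_
      rcases hs v hv with ⟨h6, h7⟩ | ⟨i, hi, h6, h7, h8⟩
      · refine .inl ?_
        have hv := h.stack.pos_le v (D.hd_lt e h1 h2 v hv)
        rw [hposne v (by omega), hlo _ hv]
        exact ⟨h6, h7⟩
      · refine .inr ⟨i, hi, by rwa [hwb _ hm'], ?_, h8⟩
        intro b' h9 h10 h11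
        rcases key b' h10 with h10 | rfl
        · rw [hlo b' h10] at h11; rw [hwb b' h10]; exact h7 b' h9 h10 h11
        · rwa [hwb']
    · intro b h1 h2 h3
      rcases key b h2 with h2 | rfl
      · rw [hlo b h2] at h3; rw [hpl b h2]; exact h.edge.chain b h1 h2 h3
      · rw [hpl']; exact h.edge.pend_zero _ (by omega)
    · intro b h1 h2 h3
      rcases key b h2 with h2 | rfl
      · rw [hlo b h2] at h3; rw [hpl b h2]; exact h.edge.nodup b h1 h2 h3
      · rw [hpl']; exact List.nodup_nil
    · intro b h1 h2 h3 e he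
      rcases key b h2 with h2 | rfl
      · rw [hlo b h2] at h3; rw [hpl b h2] at he
        obtain ⟨h4, h5, h6, h7, h8, h9⟩ := h.edge.mem_pl b h1 h2 h3 e he
        refine ⟨h4, h5, h6, h7, h8, ?_⟩
        rwa [hlo _ (hminp e h4.1 h4.2)]
      · rw [hpl'] at he; simp at he
    · exact fun y hy => h.edge.pend_zero y (by omega)
  · refine ⟨h.static.chain x hx, h.static.nodup x hx, ?_, ?_⟩
    · simp only [Memory.push, hstk']
      exact fun e he => (h.static.mem_iff x hx e).1 he
    · simp only [Memory.push]
      omega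
  · refine ⟨h.outInv.op_eq, h.outInv.cc_eq, h.outInv.out_eq, h.outInv.nodup, h.outInv.ne_nil, ?_,
      h.outInv.scc, h.outInv.disjoint, ?_⟩ <;> simp only [Memory.push, Ghost.push]
    · intro l hl v hv
      have := h.outInv.dead l hl v hv
      rwa [hposne v this.2.1]
    · intro y h1 h2
      rw [hstk y (h2.trans hbl)]
      exact h.outInv.reach y h1 h2

theorem SearchInv.push_potential (h : SearchInv D ol M G) {x : ℕ} (slots : List ℕ) (K : ℕ)
    (hlen : M.len + 1 ≤ D.n) :
    searchPotential D K (M.push x) (G.push M.len slots) + 70 ≤ searchPotential D K M G := by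
  have h1 := Forest.potential_grow (par := M.par) K 10 (h.link.rk_zero (M.len + 1) (by omega))
  simp only [searchPotential, Memory.push, Ghost.push]
  obtain ⟨d, hd⟩ := Nat.exists_eq_add_of_le hlen
  have h2 : D.n - (M.len + 1) = d := by omega
  have h3 : D.n - M.len = d + 1 := by omega
  have h4 := h.interval.base_le
  have h5 : M.len + 1 - M.base = M.len - M.base + 1 := by omega
  rw [h2, h3, h5]
  ring_nf at h1 ⊢
  omega

end Steps

section Steps

variable {D : SearchProblem} {ol : ℕ → List ℕ} {M : Memory} {G : Ghost}

theorem TailInv.minp_le_len {len n' : ℕ} {pos stk cnt minp : ℕ → ℕ} {un : ℕ → Finset ℕ}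
    {rest : List ℕ} (h : TailInv D len pos stk cnt minp un rest) (hs : StackInv n' len pos stk)
    (hn : D.n = n') {e : ℕ} (h1 : 1 ≤ e) (h2 : e ≤ D.m) : minp e ≤ len := by
  subst hn
  by_cases h0 : minp e = 0
  · omega
  · obtain ⟨v, hv, _, hv'⟩ := h.exists_minp e h1 h2 h0
    rw [← hv']; exact hs.pos_le v (D.tl_lt e h1 h2 v hv)

/-- The path is abandoned: all its nodes are declared dead. -/
theorem SearchInv.kill (h : SearchInv D ol M G) (hrest : G.rest = []) {op cc : ℕ} {out : ℕ → ℕ}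
    {comps : List (List ℕ)} (hout : OutInv D M.len op cc M.pos M.stk out comps) :
    SearchInv D ol { M with base := M.len, op := op, cc := cc, out := out }
      { G with comps := comps } := by
  have habs : ∀ {x : ℕ} {p : Prop}, M.len < x → x ≤ M.len → p := fun h1 h2 =>
    absurd h1 (Nat.not_lt.2 h2)
  refine ⟨⟨h.static.n_eq, h.static.z_eq, h.static.hl_eq, h.static.hd_iff, h.static.chain,
      h.static.nodup, h.static.mem_iff⟩, h.cur_le, fun v hv => ⟨(h.cur_dead v hv).1,
      (h.cur_dead v hv).2.trans h.interval.base_le⟩, h.stack, ?_, ?_, ?_, ?_, h.tail,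
      ?_, ?_, hout⟩
  · exact ⟨le_rfl, fun _ h1 h2 => habs h1 h2, fun _ h1 h2 => habs h1 h2, fun _ h1 h2 => habs h1 h2,
      fun _ _ h1 h2 h3 => habs h1 (h2.trans h3), fun h1 => habs h1 le_rfl,
      fun _ h1 h2 => habs ((Nat.lt_succ_self _).trans h1) h2⟩
  · exact ⟨h.link.forest, h.link.rk_zero, fun _ h1 h2 => habs h1 h2, fun _ h1 h2 => habs h1 h2⟩
  · exact ⟨fun _ _ h1 h2 h3 => habs h1 (h2.trans h3), fun _ h1 h2 => habs h1 h2⟩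
  · exact ⟨fun _ h1 h2 => habs h1 h2, fun _ _ h1 h2 h3 => habs h1 (h2.trans h3),
      fun _ h1 h2 => habs h1 h2⟩
  · exact ⟨fun e h1 h2 _ _ h3 => habs h3 (h.tail.minp_le_len h.stack rfl h1 h2),
      h.edge.fresh_of_un, fun _ h1 h2 => habs h1 h2, fun _ h1 h2 => habs h1 h2,
      fun _ h1 h2 => habs h1 h2, h.edge.pend_zero⟩
  · exact ⟨h.occInv.chain, h.occInv.nodup, h.occInv.mem, fun _ => hrest⟩

/-- If the path reaches a dead node, then all its nodes reach a component that has been found, and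
the path can be abandoned. -/
theorem SearchInv.outInv_of_dead (h : SearchInv D ol M G) (hbl : M.base < M.len) {w : ℕ}
    (hw : w < D.n) (hreach : D.Reach (M.stk M.top) w) (hpos : M.pos w ≠ 0)
    (hdead : M.pos w ≤ M.base) : OutInv D M.len M.op M.cc M.pos M.stk M.out G.comps := by
  refine ⟨h.outInv.op_eq, h.outInv.cc_eq, h.outInv.out_eq, h.outInv.nodup, h.outInv.ne_nil, ?_,
    h.outInv.scc, h.outInv.disjoint, ?_⟩
  · intro l hl v hv
    obtain ⟨h1, h2, h3⟩ := h.outInv.dead l hl v hv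
    exact ⟨h1, h2, by omega⟩
  · intro x h1 h2
    by_cases hx : x ≤ M.base
    · exact h.outInv.reach x h1 hx
    · obtain ⟨l, hl, u, hu, hr⟩ := h.outInv.reach (M.pos w) (by omega) hdead
      rw [h.stack.stk_pos w hw hpos] at hr
      refine ⟨l, hl, u, hu, D.trans _ _ _ ?_ hr⟩
      refine D.trans _ _ _ ?_ hreach
      rw [h.interval.top_eq hbl]
      exact D.trans _ _ _ (h.path.up x M.len (by omega) h2 le_rfl) (h.path.down _ hbl le_rfl)

theorem SearchInv.lo_top (h : SearchInv D ol M G) (hbl : M.base < M.len) :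
    M.base < M.top ∧ M.top ≤ M.len ∧ G.lo M.top = M.top := by
  rw [h.interval.top_eq hbl]
  exact ⟨h.interval.lo_gt _ hbl le_rfl, h.interval.lo_le _ hbl le_rfl,
    h.interval.lo_lo _ hbl le_rfl⟩

/-- All positions from `top` on lie in the top interval. -/
theorem SearchInv.lo_eq_top (h : SearchInv D ol M G) (hbl : M.base < M.len) {x : ℕ}
    (h1 : M.top ≤ x) (h2 : x ≤ M.len) : G.lo x = M.top := by
  obtain ⟨h3, h4, h5⟩ := h.lo_top hbl
  apply le_antisymm
  · rw [h.interval.top_eq hbl]; exact h.interval.lo_mono _ _ (by omega) h2 le_rfl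
  · rw [← h5]; exact h.interval.lo_mono _ _ h3 h1 h2

theorem SearchInv.le_top (h : SearchInv D ol M G) (hbl : M.base < M.len) {b : ℕ}
    (h1 : M.base < b) (h2 : b ≤ M.len) (h3 : G.lo b = b) : b ≤ M.top := by
  rw [h.interval.top_eq hbl, ← h3]
  exact h.interval.lo_mono _ _ h1 h2 le_rfl

theorem SearchInv.minp_le_len (h : SearchInv D ol M G) {e : ℕ} (h1 : 1 ≤ e) (h2 : e ≤ D.m) :
    M.minp e ≤ M.len := h.tail.minp_le_len h.stack rfl h1 h2

/-- A minimal component is found: the top interval has no unexplored hyperedges left. -/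
theorem SearchInv.outInv_of_closed (h : SearchInv D ol M G) (hbl : M.base < M.len)
    (hrest : G.rest = []) (hpend : M.pend M.top = 0) (hwl : M.wl ≤ M.wb M.top)
    (hz : D.z ≠ 0 → M.top ≤ M.pos (D.z - 1)) {out : ℕ → ℕ}
    (hout : ∀ i < M.op, out i = M.out i) (hout0 : out M.op = M.len + 1 - M.top)
    (hout1 : ∀ j < M.len + 1 - M.top, out (M.op + 1 + j) = M.stk (M.top + j)) :
    OutInv D M.len (M.op + 1 + (M.len + 1 - M.top)) (M.cc + 1) M.pos M.stk out
      (G.comps ++ [(List.range' M.top (M.len + 1 - M.top)).map M.stk]) := by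
  obtain ⟨ht1, ht2, ht3⟩ := h.lo_top hbl
  set C := (List.range' M.top (M.len + 1 - M.top)).map M.stk with hC
  have hmem : ∀ v, v ∈ C ↔ v < D.n ∧ M.top ≤ M.pos v := by
    intro v
    simp only [hC, List.mem_map, List.mem_range'_1]
    constructor
    · rintro ⟨x, ⟨h1, h2⟩, rfl⟩
      rw [h.stack.pos_stk x (by omega) (by omega)]
      exact ⟨h.stack.stk_lt x (by omega) (by omega), h1⟩
    · rintro ⟨h1, h2⟩
      have := h.stack.pos_le v h1
      exact ⟨M.pos v, ⟨h2, by omega⟩, h.stack.stk_pos v h1 (by omega)⟩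
  have hmut : ∀ u ∈ C, ∀ v ∈ C, D.Reach u v := by
    intro u hu v hv
    rw [hmem] at hu hv
    have hpu := h.stack.pos_le u hu.1
    have hpv := h.stack.pos_le v hv.1
    have h1 := h.path.down (M.pos u) (by omega) hpu
    rw [h.lo_eq_top hbl hu.2 hpu, h.stack.stk_pos u hu.1 (by omega)] at h1
    have h2 := h.path.up M.top (M.pos v) ht1 hv.2 hpv
    rw [h.stack.stk_pos v hv.1 (by omega)] at h2
    exact D.trans _ _ _ h1 h2
  have hclosed : ∀ u ∈ C, ∀ v, D.Reach u v → v ∈ C := by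
    refine D.closed {v | v ∈ C} (fun u hu => ((hmem u).1 hu).1) ?_ ?_
    · intro e h1 h2 hne htl w hw
      have hun : G.un e = ∅ := by
        ext v
        simp only [h.tail.un_iff e h1 h2, hrest, List.map_nil, List.not_mem_nil, and_false,
          or_false, Finset.notMem_empty, iff_false, not_and]
        intro hv
        have := ((hmem v).1 (htl v hv)).2
        omega
      obtain ⟨v, hv⟩ := hne
      have hm0 := (h.tail.minp_le e h1 h2 v hv (by simp [hun])).1
      obtain ⟨u, hu, _, hu'⟩ := h.tail.exists_minp e h1 h2 hm0
      have htop : M.top ≤ M.minp e := hu' ▸ ((hmem u).1 (htl u hu)).2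
      have hlo := h.lo_eq_top hbl htop (h.minp_le_len h1 h2)
      have hpl : G.pl M.top = [] := by
        have := h.edge.chain M.top ht1 ht2 ht3
        rw [hpend] at this
        exact this.eq_nil
      rcases h.edge.registered e h1 h2 hun ⟨v, hv⟩ (by omega) with h3 | h3
      · rw [hlo, hpl] at h3; simp at h3
      · rw [hlo] at h3
        rcases h3 w hw with ⟨h4, h5⟩ | ⟨i, hi, h4, _⟩
        · have hwn := D.hd_lt e h1 h2 w hw
          refine (hmem w).2 ⟨hwn, ?_⟩
          rw [← h5]
          exact h.interval.lo_le _ h4 (h.stack.pos_le w hwn)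
        · omega
    · exact fun h0 => (hmem _).2 ⟨D.z_lt h0, hz h0⟩
  have hword : (G.comps ++ [C]).flatMap withLength =
      G.comps.flatMap withLength ++ (M.len + 1 - M.top) :: C := by
    simp [withLength, hC]
  have hlenC : C.length = M.len + 1 - M.top := by simp [hC]
  refine ⟨?_, ?_, ?_, ?_, ?_, ?_, ?_, ?_, ?_⟩
  · rw [hword, h.outInv.op_eq]
    simp only [List.length_append, List.length_cons, hlenC]
    omega
  · simp [h.outInv.cc_eq]
  · intro i hi
    rw [hword] at hi ⊢
    have hop := h.outInv.op_eq
    set w := G.comps.flatMap withLength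
    simp only [List.length_append, List.length_cons, hlenC] at hi
    rcases lt_or_ge i w.length with hi' | hi'
    · rw [List.getD_append _ _ _ _ hi', hout _ (by omega), h.outInv.out_eq i hi']
    · rw [List.getD_append_right _ _ _ _ hi']
      rcases Nat.eq_or_lt_of_le hi' with hi'' | hi''
      · rw [← hi'', ← hop, hout0]; simp
      · obtain ⟨j, rfl⟩ : ∃ j, i = w.length + 1 + j := ⟨i - (w.length + 1), by omega⟩
        have hj : j < M.len + 1 - M.top := by omega
        rw [show w.length + 1 + j - w.length = j + 1 by omega, List.getD_cons_succ,
          show w.length + 1 + j + 1 = M.op + 1 + j by omega, hout1 j hj]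
        rw [hC, List.getD_eq_getElem _ _ (by simpa using hj)]
        simp
  · intro l hl
    rcases List.mem_append.1 hl with hl | hl
    · exact h.outInv.nodup l hl
    · rw [List.mem_singleton.1 hl, hC]
      refine List.Nodup.map_on ?_ List.nodup_range'
      intro x hx y hy hxy
      simp only [List.mem_range'_1] at hx hy
      rw [← h.stack.pos_stk x (by omega) (by omega), ← h.stack.pos_stk y (by omega) (by omega), hxy]
  · intro l hl
    rcases List.mem_append.1 hl with hl | hl
    · exact h.outInv.ne_nil l hl
    · rw [List.mem_singleton.1 hl]
      intro h0
      rw [h0] at hlenC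
      simp at hlenC
      omega
  · intro l hl v hv
    rcases List.mem_append.1 hl with hl | hl
    · have := h.outInv.dead l hl v hv
      exact ⟨this.1, this.2.1, by omega⟩
    · rw [List.mem_singleton.1 hl, hmem] at hv
      exact ⟨hv.1, by omega, h.stack.pos_le v hv.1⟩
  · intro l hl u hu v
    rcases List.mem_append.1 hl with hl | hl
    · exact h.outInv.scc l hl u hu v
    · rw [List.mem_singleton.1 hl] at hu ⊢
      exact ⟨hmut u hu v, hclosed u hu v⟩
  · rw [List.pairwise_append]
    refine ⟨h.outInv.disjoint, List.pairwise_singleton _ _, ?_⟩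
    intro l hl l' hl' v hv hv'
    rw [List.mem_singleton.1 hl', hmem] at hv'
    have := h.outInv.dead l hl v hv
    omega
  · intro x h1 h2
    by_cases hx : x ≤ M.base
    · obtain ⟨l, hl, u, hu, hr⟩ := h.outInv.reach x h1 hx
      exact ⟨l, List.mem_append_left _ hl, u, hu, hr⟩
    · refine ⟨C, by simp, M.stk M.len, ?_, h.path.up x M.len (by omega) h2 le_rfl⟩
      rw [hmem, h.stack.pos_stk _ (by omega) le_rfl]
      exact ⟨h.stack.stk_lt _ (by omega) le_rfl, ht2⟩

/-- A node that is dead need not be considered as a starting node. -/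
theorem SearchInv.next (h : SearchInv D ol M G) (hcur : M.cur < D.n) (hpos : M.pos M.cur ≠ 0)
    (hbase : M.base = M.len) : SearchInv D ol { M with cur := M.cur + 1 } G := by
  refine ⟨⟨h.static.n_eq, h.static.z_eq, h.static.hl_eq, h.static.hd_iff, h.static.chain,
      h.static.nodup, h.static.mem_iff⟩, hcur, ?_, h.stack, h.interval, h.link, h.path,
      h.workInv, h.tail, h.edge, h.occInv, h.outInv⟩
  intro v hv
  rcases Nat.lt_succ_iff_lt_or_eq.1 hv with hv | rfl
  · exact h.cur_dead v hv
  · exact ⟨hpos, hbase ▸ h.stack.pos_le _ hcur⟩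

/-- The last entry of the work stack lies in the top interval and is removed. -/
theorem SearchInv.pop (h : SearchInv D ol M G) (hbl : M.base < M.len) (hwl : M.wb M.top < M.wl)
    (hpos : M.top ≤ M.pos (M.work (M.wl - 1))) :
    SearchInv D ol { M with wl := M.wl - 1 } G := by
  obtain ⟨ht1, ht2, ht3⟩ := h.lo_top hbl
  have hw := (h.workInv.reach M.top ht1 ht2 ht3 (M.wl - 1) (by omega) (by omega)).1
  refine ⟨⟨h.static.n_eq, h.static.z_eq, h.static.hl_eq, h.static.hd_iff, h.static.chain,
      h.static.nodup, h.static.mem_iff⟩, h.cur_le, h.cur_dead, h.stack, h.interval, h.link,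
      h.path, ?_, h.tail, ?_, h.occInv, h.outInv⟩
  · refine ⟨?_, h.workInv.wb_mono, ?_⟩
    · intro b h1 h2 h3
      have := h.workInv.wb_mono b M.top h1 (h.le_top hbl h1 h2 h3) ht2 h3 ht3
      dsimp only
      omega
    · intro b h1 h2 h3 i h4 h5
      dsimp only at h5
      exact h.workInv.reach b h1 h2 h3 i h4 (by omega)
  · refine ⟨?_, h.edge.fresh_of_un, h.edge.chain, h.edge.nodup, h.edge.mem_pl, h.edge.pend_zero⟩
    intro e h1 h2 h3 h4 h5
    refine (h.edge.registered e h1 h2 h3 h4 h5).imp_right fun hs v hv => ?_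
    rcases hs v hv with h6 | ⟨i, hi, h6, h7, h8⟩
    · exact .inl h6
    · by_cases hi' : i = M.wl - 1
      · left
        subst hi'
        rw [h8] at hpos hw
        have hpv := h.stack.pos_le v hw
        refine ⟨ht1.trans_le hpos, ?_⟩
        rw [h.lo_eq_top hbl hpos hpv]
        -- an entry above the segment of the top interval belongs to no lower interval
        have hm := h.minp_le_len h1 h2
        have hle := h.le_top hbl (h.interval.lo_gt _ h5 hm)
          ((h.interval.lo_le _ h5 hm).trans hm) (h.interval.lo_lo _ h5 hm)
        rcases Nat.eq_or_lt_of_le hle with h9 | h9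
        · exact h9.symm
        · have := h7 M.top h9 ht2 ht3
          omega
      · exact .inr ⟨i, by dsimp only; omega, h6, h7, h8⟩

/-- The heads of a hyperedge waiting at the top interval are copied to the work stack. -/
theorem SearchInv.activate (h : SearchInv D ol M G) (hbl : M.base < M.len)
    (hpend : M.pend M.top ≠ 0) {work : ℕ → ℕ} (hwork : ∀ i < M.wl, work i = M.work i)
    (hwork' : ∀ j < D.hl (M.pend M.top),
      work (M.wl + j) = M.inp (M.hp (M.pend M.top) + 1 + j)) :
    (1 ≤ M.pend M.top ∧ M.pend M.top ≤ D.m) ∧ M.pend M.top ∈ G.fresh ∧ ∃ l, SearchInv D ol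
      { M with
        pend := Function.update M.pend M.top (M.nextp (M.pend M.top))
        wl := M.wl + D.hl (M.pend M.top)
        work := work }
      { G with
        pl := Function.update G.pl M.top l
        fresh := G.fresh.erase (M.pend M.top) } := by
  obtain ⟨ht1, ht2, ht3⟩ := h.lo_top hbl
  obtain ⟨l, hl, hchain⟩ := (h.edge.chain M.top ht1 ht2 ht3).exists_cons hpend
  set e := M.pend M.top with he
  have hnodup := h.edge.nodup M.top ht1 ht2 ht3
  rw [hl, List.nodup_cons] at hnodup
  obtain ⟨⟨he1, he2⟩, hfresh, hun, htl, hbase, hlo⟩ :=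
    h.edge.mem_pl M.top ht1 ht2 ht3 e (by simp [hl])
  have hm := h.minp_le_len he1 he2
  have hreach : ∀ w ∈ D.hd e, D.Reach (M.stk M.top) w := by
    apply D.edge e he1 he2 _ (h.stack.stk_lt _ (by omega) ht2)
    intro v hv
    have h1 := h.tail.minp_le e he1 he2 v hv (by simp [hun])
    have h2 := h.interval.lo_le _ hbase hm
    have hvn := D.tl_lt e he1 he2 v hv
    have h3 := h.path.up M.top (M.pos v) ht1 (by omega) (h.stack.pos_le v hvn)
    rwa [h.stack.stk_pos v hvn (by omega)] at h3
  refine ⟨⟨he1, he2⟩, hfresh, l, ⟨h.static.n_eq, h.static.z_eq, h.static.hl_eq, h.static.hd_iff,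
      h.static.chain, h.static.nodup, h.static.mem_iff⟩, h.cur_le, h.cur_dead, h.stack,
      h.interval, h.link, h.path, ?_, h.tail, ?_, h.occInv, h.outInv⟩
  · refine ⟨?_, h.workInv.wb_mono, ?_⟩
    · intro b h1 h2 h3
      exact (h.workInv.wb_le b h1 h2 h3).trans (Nat.le_add_right _ _)
    · intro b h1 h2 h3 i h4 h5
      dsimp only at h4 h5 ⊢
      rcases lt_or_ge i M.wl with hi | hi
      · rw [hwork i hi]; exact h.workInv.reach b h1 h2 h3 i h4 hi
      · obtain ⟨j, rfl⟩ := Nat.exists_eq_add_of_le hi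
        have hj : j < D.hl e := by omega
        rw [hwork' j hj]
        have hmem := (h.static.hd_iff e he1 he2 _).2 ⟨j, hj, rfl⟩
        refine ⟨D.hd_lt e he1 he2 _ hmem, D.trans _ _ _ ?_ (hreach _ hmem)⟩
        exact h.path.up b M.top h1 (h.le_top hbl h1 h2 h3) ht2
  · have hmono : ∀ b e', HeadsSeen D M.base M.len M.wl G.lo M.pos M.work M.wb b e' →
        HeadsSeen D M.base M.len (M.wl + D.hl e) G.lo M.pos work M.wb b e' := by
      intro b e' hs v hv
      refine (hs v hv).imp_right ?_
      rintro ⟨i, hi, h1, h2, h3⟩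
      exact ⟨i, by omega, h1, h2, by rw [hwork i hi, h3]⟩
    have hsub : ∀ b, ∀ e' ∈ Function.update G.pl M.top l b, e' ∈ G.pl b := by
      intro b e' he'
      by_cases hb : b = M.top
      · subst hb; rw [Function.update_self] at he'; rw [hl]; exact List.mem_cons_of_mem _ he'
      · rwa [Function.update_of_ne hb] at he'
    refine ⟨?_, ?_, ?_, ?_, ?_, ?_⟩ <;> dsimp only
    · intro e' h1 h2 h3 h4 h5
      by_cases hee : e' = e
      · right
        subst hee
        intro v hv
        obtain ⟨j, hj, hj'⟩ := (h.static.hd_iff e he1 he2 v).1 hv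
        refine .inr ⟨M.wl + j, by omega, ?_, ?_, by rw [hwork' j hj, hj']⟩
        · rw [hlo]; exact (h.workInv.wb_le M.top ht1 ht2 ht3).trans (Nat.le_add_right _ _)
        · intro b' h6 h7 h8
          rw [hlo] at h6
          have := h.le_top hbl (by omega) h7 h8
          omega
      · rcases h.edge.registered e' h1 h2 h3 h4 h5 with h6 | h6
        · left
          by_cases hb : G.lo (M.minp e') = M.top
          · rw [hb, Function.update_self]
            rw [hb, hl, List.mem_cons] at h6
            exact h6.resolve_left hee
          · rwa [Function.update_of_ne hb]
        · exact .inr (hmono _ _ h6)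
    · intro e' h1 h2 h3
      refine Finset.mem_erase.2 ⟨?_, h.edge.fresh_of_un e' h1 h2 h3⟩
      rintro rfl
      exact h3 hun
    · intro b h1 h2 h3
      by_cases hb : b = M.top
      · subst hb; rw [Function.update_self, Function.update_self]; exact hchain
      · rw [Function.update_of_ne hb, Function.update_of_ne hb]; exact h.edge.chain b h1 h2 h3
    · intro b h1 h2 h3
      by_cases hb : b = M.top
      · subst hb; rw [Function.update_self]; exact hnodup.2
      · rw [Function.update_of_ne hb]; exact h.edge.nodup b h1 h2 h3
    · intro b h1 h2 h3 e' he'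
      obtain ⟨h4, h5, h6⟩ := h.edge.mem_pl b h1 h2 h3 e' (hsub b e' he')
      refine ⟨h4, Finset.mem_erase.2 ⟨?_, h5⟩, h6⟩
      rintro rfl
      have hb : b = M.top := by rw [← hlo]; exact h6.2.2.2.symm
      subst hb
      rw [Function.update_self] at he'
      exact hnodup.1 he'
    · intro x hx
      rw [Function.update_of_ne (by omega)]
      exact h.edge.pend_zero x hx

theorem SearchInv.activate_potential {e : ℕ} (he : e ∈ G.fresh) (K : ℕ) (pend work : ℕ → ℕ)
    (pl : ℕ → List ℕ) :
    searchPotential D K { M with pend := pend, wl := M.wl + D.hl e, work := work }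
      { G with pl := pl, fresh := G.fresh.erase e } + (10 * D.hl e + 50) ≤
    searchPotential D K M G := by
  simp only [searchPotential]
  rw [← Finset.add_sum_erase _ _ he]
  ring_nf
  omega

/-- The top interval, with bottom `t`, is merged with the one below it, as its nodes reach a
node further down the path. The smaller tree, with root `x`, is linked below the root `y`. -/
theorem SearchInv.merge (h : SearchInv D ol M G) (hbl : M.base < M.len) {w : ℕ}
    (hw : w < D.n) (hreach : D.Reach (M.stk M.top) w) (hlive : M.base < M.pos w)
    (hpos : M.pos w < M.top) (hpend : M.pend M.top = 0) {x y : ℕ}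
    (hxy : (x = M.root M.top ∧ y = M.root (M.prevb M.top)) ∨
      (y = M.root M.top ∧ x = M.root (M.prevb M.top)))
    (hrk : M.rk x ≤ M.rk y) {rk : ℕ → ℕ} (hrk' : ∀ v, v ≠ y → rk v = M.rk v)
    (hrky : rk y = if M.rk x = M.rk y then M.rk y + 1 else M.rk y) (K : ℕ) :
    SearchInv D ol
      { M with
        top := M.prevb M.top
        par := Function.update M.par x y
        rk := rk
        root := Function.update M.root (M.prevb M.top) y
        low := Function.update M.low y (M.prevb M.top) }
      { G with
        lo := fun p => if G.lo p = M.top then M.prevb M.top else G.lo p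
        rt := fun p => if G.rt p = x then y else G.rt p } ∧
    forestPotential K 10 M.len (Function.update M.par x y) rk + 10 ≤
      forestPotential K 10 M.len M.par M.rk := by
  obtain ⟨ht1, ht2, ht3⟩ := h.lo_top hbl
  have hprev := h.interval.prevb_eq M.top (by omega) ht2 ht3
  set t := M.top with ht
  set a := M.prevb t with ha
  have hI := h.interval
  have ha1 : M.base < a := hprev ▸ hI.lo_gt (t - 1) (by omega) (by omega)
  have ha2 : a < t := by
    have := hI.lo_le (t - 1) (by omega) (by omega)
    omega
  have ha3 : G.lo a = a := by rw [hprev]; exact hI.lo_lo (t - 1) (by omega) (by omega)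
  have hrt_t : M.root t = G.rt t := by
    have := h.link.root_lo t ht1 ht2
    rwa [ht3] at this
  have hrt_a : M.root a = G.rt a := by
    have := h.link.root_lo a ha1 (by omega)
    rwa [ha3] at this
  have hlow_t : M.low (M.root t) = t := by rw [hrt_t, h.link.low_rt t ht1 ht2, ht3]
  have hlow_a : M.low (M.root a) = a := by rw [hrt_a, h.link.low_rt a ha1 (by omega), ha3]
  have hF := h.link.forest
  have hroot : ∀ r, (r = M.root t ∨ r = M.root a) → (1 ≤ r ∧ r ≤ M.len) ∧ M.par r = r := by
    rintro r (rfl | rfl)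
    · rw [hrt_t]; exact ⟨hF.rt_mem t (by omega) ht2, hF.par_rt t (by omega) ht2⟩
    · rw [hrt_a]; exact ⟨hF.rt_mem a (by omega) (by omega), hF.par_rt a (by omega) (by omega)⟩
  obtain ⟨⟨hx1, hx2⟩, hx3⟩ := hroot x (by rcases hxy with h | h <;> simp [h])
  obtain ⟨⟨hy1, hy2⟩, hy3⟩ := hroot y (by rcases hxy with h | h <;> simp [h])
  have hne : x ≠ y := by
    intro h0
    rcases hxy with ⟨h1, h2⟩ | ⟨h1, h2⟩
    · rw [← h1] at hlow_t; rw [← h2] at hlow_a; rw [h0] at hlow_t; omega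
    · rw [← h1] at hlow_t; rw [← h2] at hlow_a; rw [h0] at hlow_a; omega
  have hlowx : M.low x = t ∨ M.low x = a := by
    rcases hxy with ⟨h1, h2⟩ | ⟨h1, h2⟩
    · exact .inl (h1 ▸ hlow_t)
    · exact .inr (h2 ▸ hlow_a)
  have hlowy : M.low y = t ∨ M.low y = a := by
    rcases hxy with ⟨h1, h2⟩ | ⟨h1, h2⟩
    · exact .inr (h2 ▸ hlow_a)
    · exact .inl (h1 ▸ hlow_t)
  have hrootxy : ∀ b, b = t ∨ b = a → M.root b = x ∨ M.root b = y := by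
    rintro b (rfl | rfl) <;> rcases hxy with ⟨h1, h2⟩ | ⟨h1, h2⟩ <;> simp [h1, h2]
  refine ⟨?_, Forest.potential_link K 10 hx1 hx2 hy1 hy2 hne hx3 hy3 hrk' hrky hrk⟩
  have hbd : ∀ b, (if G.lo b = t then a else G.lo b) = b → G.lo b = b ∧ b ≠ t := by
    intro b hb
    split_ifs at hb with h0
    · subst hb; omega
    · exact ⟨hb, fun h1 => h0 (hb.trans h1)⟩
  have hbda : ∀ b, M.base < b → b ≤ M.len → G.lo b = b → b ≠ t → b ≤ a := by
    intro b h1 h2 h3 h4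
    have h5 := h.le_top hbl h1 h2 h3
    rw [hprev, ← h3]
    exact hI.lo_mono _ _ h1 (by omega) (by omega)
  refine ⟨⟨h.static.n_eq, h.static.z_eq, h.static.hl_eq, h.static.hd_iff, h.static.chain,
      h.static.nodup, h.static.mem_iff⟩, h.cur_le, h.cur_dead, h.stack, ?_, ?_, ?_, ?_, h.tail,
      ?_, h.occInv, h.outInv⟩
  · refine ⟨hI.base_le, ?_, ?_, ?_, ?_, ?_, ?_⟩ <;> dsimp only
    · intro p h1 h2
      split_ifs
      · exact ha1
      · exact hI.lo_gt p h1 h2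
    · intro p h1 h2
      have := hI.lo_le p h1 h2
      split_ifs <;> omega
    · intro p h1 h2
      by_cases h0 : G.lo p = t
      · rw [if_pos h0, if_neg (by omega), ha3]
      · rw [if_neg h0, if_neg (by rwa [hI.lo_lo p h1 h2]), hI.lo_lo p h1 h2]
    · intro p q h1 h2 h3
      have hmono := hI.lo_mono p q h1 h2 h3
      by_cases hp : G.lo p = t
      · have hq : G.lo q = t := by
          have := hI.lo_mono q M.len (by omega) h3 le_rfl
          rw [← hI.top_eq hbl] at this
          omega
        rw [if_pos hp, if_pos hq]
      · rw [if_neg hp]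
        split_ifs with hq
        · rw [hprev]
          refine hI.lo_mono _ _ h1 ?_ (by omega)
          by_contra hlt
          exact hp (h.lo_eq_top hbl (by omega) (by omega))
        · exact hmono
    · intro _
      rw [if_pos (hI.top_eq hbl).symm]
    · intro b h1 h2 h3
      obtain ⟨h4, h5⟩ := hbd b h3
      rw [hI.prevb_eq b h1 h2 h4, if_neg]
      have := hI.lo_le (b - 1) (by omega) (by omega)
      have := h.le_top hbl (by omega) h2 h4
      omega
  · refine ⟨hF.link hx1 hx2 hy1 hy2 hne hx3 hy3 hrk' hrky hrk, ?_, ?_, ?_⟩ <;> dsimp only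
    · intro v hv
      rw [hrk' v (by omega)]; exact h.link.rk_zero v hv
    · intro p h1 h2
      have hlow := h.link.low_rt p h1 h2
      have hroot := h.link.root_lo p h1 h2
      by_cases hpx : G.rt p = x
      · rw [if_pos hpx, Function.update_self]
        rw [hpx] at hlow
        split_ifs with h0
        · rfl
        · omega
      · rw [if_neg hpx]
        by_cases hpy : G.rt p = y
        · rw [hpy, Function.update_self]
          rw [hpy] at hlow
          split_ifs with h0
          · rfl
          · omega
        · rw [Function.update_of_ne hpy, hlow, if_neg]
          intro h0
          rcases hrootxy (G.lo p) (.inl h0) with h3 | h3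
          · exact hpx (hroot.symm.trans h3)
          · exact hpy (hroot.symm.trans h3)
    · intro p h1 h2
      have hlow := h.link.low_rt p h1 h2
      have hroot := h.link.root_lo p h1 h2
      by_cases h0 : G.lo p = t ∨ G.lo p = a
      · have h3 : (if G.lo p = t then a else G.lo p) = a := by
          split_ifs with h4
          · rfl
          · exact h0.resolve_left h4
        rw [h3, Function.update_self]
        rcases hrootxy (G.lo p) h0 with h4 | h4
        · rw [if_pos (hroot.symm.trans h4)]
        · rw [← hroot, h4]; simp
      · rw [not_or] at h0
        rw [if_neg h0.1, Function.update_of_ne h0.2, if_neg, hroot]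
        intro h3
        rw [h3] at hlow
        omega
  · refine ⟨h.path.up, ?_⟩
    intro p h1 h2
    dsimp only
    have h3 := h.path.down p h1 h2
    split_ifs with h0
    · rw [h0] at h3
      have h4 := h.path.up (M.pos w) (t - 1) hlive (by omega) (by omega)
      rw [h.stack.stk_pos w hw (by omega)] at h4
      have h5 := h.path.down (t - 1) (by omega) (by omega)
      rw [← hprev] at h5
      exact D.trans _ _ _ h3 (D.trans _ _ _ hreach (D.trans _ _ _ h4 h5))
    · exact h3
  · refine ⟨?_, ?_, ?_⟩
    · exact fun b h1 h2 h3 => h.workInv.wb_le b h1 h2 (hbd b h3).1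
    · exact fun b b' h1 h2 h3 h4 h5 =>
        h.workInv.wb_mono b b' h1 h2 h3 (hbd b h4).1 (hbd b' h5).1
    · exact fun b h1 h2 h3 => h.workInv.reach b h1 h2 (hbd b h3).1
  · refine ⟨?_, h.edge.fresh_of_un, ?_, ?_, ?_, h.edge.pend_zero⟩ <;> dsimp only
    · intro e h1 h2 h3 h4 h5
      have hm := h.minp_le_len h1 h2
      rcases h.edge.registered e h1 h2 h3 h4 h5 with h6 | h6
      · left
        rw [if_neg]
        · exact h6
        · intro h0
          have := h.edge.chain t ht1 ht2 ht3
          rw [hpend] at this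
          rw [h0, this.eq_nil] at h6
          simp at h6
      · right
        intro v hv
        rcases h6 v hv with ⟨h7, h8⟩ | ⟨i, hi, h7, h8, h9⟩
        · exact .inl ⟨h7, by dsimp only; rw [h8]⟩
        · refine .inr ⟨i, hi, ?_, ?_, h9⟩
          · split_ifs with h0
            · rw [h0] at h7
              exact (h.workInv.wb_mono a t ha1 ha2.le ht2 ha3 ht3).trans h7
            · exact h7
          · intro b' h10 h11 h12
            obtain ⟨h13, h14⟩ := hbd b' h12
            split_ifs at h10 with h0
            · have := hbda b' (by omega) h11 h13 h14
              omega
            · exact h8 b' h10 h11 h13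
    · exact fun b h1 h2 h3 => h.edge.chain b h1 h2 (hbd b h3).1
    · exact fun b h1 h2 h3 => h.edge.nodup b h1 h2 (hbd b h3).1
    · intro b h1 h2 h3 e he
      obtain ⟨h4, h5, h6, h7, h8, h9⟩ := h.edge.mem_pl b h1 h2 (hbd b h3).1 e he
      refine ⟨h4, h5, h6, h7, h8, ?_⟩
      rw [h9, if_neg (hbd b h3).2]

theorem TailInv.slot {len : ℕ} {pos stk cnt minp : ℕ → ℕ} {un : ℕ → Finset ℕ} {e : ℕ}
    {rest : List ℕ} (h : TailInv D len pos stk cnt minp un (e :: rest))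
    (hs : StackInv D.n len pos stk) (h1 : 1 ≤ len) (he1 : 1 ≤ e) (he2 : e ≤ D.m)
    (htl : stk len ∈ D.tl e) (hnd : e ∉ rest) :
    TailInv D len pos stk (Function.update cnt e (cnt e - 1))
      (Function.update minp e (if minp e = 0 then len else minp e))
      (Function.update un e ((un e).erase (stk len))) rest := by
  have hpos := hs.pos_stk len h1 le_rfl
  have hmem : stk len ∈ un e := (h.un_iff e he1 he2 _).2 ⟨htl, .inr ⟨rfl, by simp⟩⟩
  refine ⟨?_, ?_, ?_, ?_⟩
  · intro e' h3 h4 v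
    by_cases hee : e' = e
    · subst hee
      rw [Function.update_self, Finset.mem_erase, h.un_iff e' h3 h4]
      constructor
      · rintro ⟨h5, h6, h7 | ⟨h7, _⟩⟩
        · exact ⟨h6, .inl h7⟩
        · exact absurd h7 h5
      · rintro ⟨h5, h6 | ⟨_, h6⟩⟩
        · exact ⟨by rintro rfl; omega, h5, .inl h6⟩
        · exact absurd h6 hnd
    · rw [Function.update_of_ne hee, h.un_iff e' h3 h4]
      simp [hee]
  · intro e' h3 h4
    by_cases hee : e' = e
    · subst hee
      rw [Function.update_self, Function.update_self, Finset.card_erase_of_mem hmem,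
        h.cnt_eq e' h3 h4]
    · rw [Function.update_of_ne hee, Function.update_of_ne hee, h.cnt_eq e' h3 h4]
  · intro e' h3 h4 v hv hun
    by_cases hee : e' = e
    · subst hee
      rw [Function.update_self] at hun ⊢
      by_cases hvl : v = stk len
      · subst hvl
        rw [hpos]
        split_ifs with h0
        · exact ⟨by omega, le_rfl⟩
        · obtain ⟨u, hu, _, hu'⟩ := h.exists_minp e' h3 h4 h0
          exact ⟨h0, hu' ▸ hs.pos_le u (D.tl_lt e' h3 h4 u hu)⟩
      · have := h.minp_le e' h3 h4 v hv (fun h0 => hun (Finset.mem_erase.2 ⟨hvl, h0⟩))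
        rwa [if_neg this.1]
    · rw [Function.update_of_ne hee] at hun ⊢
      exact h.minp_le e' h3 h4 v hv hun
  · intro e' h3 h4 h0
    by_cases hee : e' = e
    · subst hee
      rw [Function.update_self] at h0 ⊢
      rw [Function.update_self]
      by_cases h5 : minp e' = 0
      · rw [if_pos h5]
        exact ⟨stk len, htl, Finset.notMem_erase _ _, hpos⟩
      · rw [if_neg h5]
        obtain ⟨u, hu, h6, hu'⟩ := h.exists_minp e' h3 h4 h5
        exact ⟨u, hu, fun h7 => h6 (Finset.mem_of_mem_erase h7), hu'⟩
    · rw [Function.update_of_ne hee] at h0 ⊢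
      rw [Function.update_of_ne hee]
      exact h.exists_minp e' h3 h4 h0

/-- One tail occurrence of the last node of the path is processed. -/
def Memory.slot (M : Memory) : Memory :=
  { M with
    occ := M.nexto M.occ
    cnt := Function.update M.cnt (M.edgeof M.occ) (M.cnt (M.edgeof M.occ) - 1)
    minp := Function.update M.minp (M.edgeof M.occ)
      (if M.minp (M.edgeof M.occ) = 0 then M.len else M.minp (M.edgeof M.occ)) }

/-- The auxiliary data after an occurrence of the node `v` in the tail of `e` has been processed. -/
def Ghost.slot (G : Ghost) (e v : ℕ) : Ghost :=
  { G with
    rest := G.rest.tail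
    un := Function.update G.un e ((G.un e).erase v) }

/-- What the processing of an occurrence does to the bookkeeping of tails, whether or not the
hyperedge is then registered. -/
theorem SearchInv.slot (h : SearchInv D ol M G) (hocc : M.occ ≠ 0) :
    (1 ≤ M.edgeof M.occ ∧ M.edgeof M.occ ≤ D.m) ∧ M.base < M.len ∧
    G.un (M.edgeof M.occ) ≠ ∅ ∧
    TailInv D M.len M.pos M.stk M.slot.cnt M.slot.minp
      (G.slot (M.edgeof M.occ) (M.stk M.len)).un
      ((G.slot (M.edgeof M.occ) (M.stk M.len)).rest.map M.edgeof) ∧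
    OccInv D M.base M.len M.slot.occ (M.stk M.len) M.nexto M.edgeof
      (G.slot (M.edgeof M.occ) (M.stk M.len)).rest := by
  obtain ⟨rest, hrest, hchain⟩ := h.occInv.chain.exists_cons hocc
  have hbl : M.base < M.len := by
    have := h.interval.base_le
    rcases Nat.eq_or_lt_of_le this with h0 | h0
    · have := h.occInv.rest_nil h0
      rw [hrest] at this; simp at this
    · exact h0
  have hT := h.tail
  have hnd := h.occInv.nodup
  rw [hrest, List.map_cons] at hT hnd
  rw [List.nodup_cons] at hnd
  set e := M.edgeof M.occ
  have hmemr := h.occInv.mem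
  rw [hrest, List.map_cons] at hmemr
  have he : (1 ≤ e ∧ e ≤ D.m) ∧ M.stk M.len ∈ D.tl e := hmemr e List.mem_cons_self
  obtain ⟨⟨he1, he2⟩, htl⟩ := he
  have hmem : M.stk M.len ∈ G.un e := (hT.un_iff e he1 he2 _).2 ⟨htl, .inr ⟨rfl, by simp⟩⟩
  refine ⟨⟨he1, he2⟩, hbl, ?_, ?_, ?_⟩
  · intro h0; rw [h0] at hmem; simp at hmem
  · have := hT.slot h.stack (by omega) he1 he2 htl hnd.1
    simpa only [Memory.slot, Ghost.slot, hrest, List.tail_cons] using this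
  · simp only [Memory.slot, Ghost.slot, hrest, List.tail_cons]
    exact ⟨hchain, hnd.2, fun e' he' => hmemr e' (by simp [he']), by omega⟩

/-- After processing an occurrence, a hyperedge whose tail is not yet completely visited, or has
a dead node, need not be registered. -/
theorem SearchInv.slot_skip (h : SearchInv D ol M G) (hocc : M.occ ≠ 0)
    (hskip : M.slot.cnt (M.edgeof M.occ) = 0 → M.slot.minp (M.edgeof M.occ) ≤ M.base) :
    SearchInv D ol M.slot (G.slot (M.edgeof M.occ) (M.stk M.len)) := by
  obtain ⟨⟨he1, he2⟩, hbl, hune, hT, hO⟩ := h.slot hocc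
  set e := M.edgeof M.occ with he
  have hm : ∀ e', e' ≠ e → M.slot.minp e' = M.minp e' := fun e' hee =>
    Function.update_of_ne hee _ _
  have hu : ∀ e', e' ≠ e → (G.slot e (M.stk M.len)).un e' = G.un e' := fun e' hee =>
    Function.update_of_ne hee _ _
  refine ⟨⟨h.static.n_eq, h.static.z_eq, h.static.hl_eq, h.static.hd_iff, h.static.chain,
      h.static.nodup, h.static.mem_iff⟩, h.cur_le, h.cur_dead, h.stack, h.interval, h.link,
      h.path, h.workInv, hT, ⟨?_, ?_, h.edge.chain, h.edge.nodup, ?_, h.edge.pend_zero⟩, hO,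
      h.outInv⟩
  · intro e' h1 h2 h3 h4 h5
    by_cases hee : e' = e
    · subst hee
      have := hskip (by rw [hT.cnt_eq e he1 he2, h3, Finset.card_empty])
      exact absurd h5 (Nat.not_lt.2 this)
    · rw [hu e' hee] at h3
      rw [hm e' hee] at h5 ⊢
      exact h.edge.registered e' h1 h2 h3 h4 h5
  · intro e' h1 h2 h3
    by_cases hee : e' = e
    · subst hee; exact h.edge.fresh_of_un e h1 h2 hune
    · rw [hu e' hee] at h3; exact h.edge.fresh_of_un e' h1 h2 h3
  · intro b h1 h2 h3 e' he'
    obtain ⟨h4, h5, h6, h7⟩ := h.edge.mem_pl b h1 h2 h3 e' he'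
    have hee : e' ≠ e := by rintro rfl; exact hune h6
    rw [hu e' hee, hm e' hee]
    exact ⟨h4, h5, h6, h7⟩

/-- After processing the last occurrence of a hyperedge whose tail lies on the path, the hyperedge
is registered at the interval of the least position of its tail, which a find operation yields. -/
theorem SearchInv.slot_register (h : SearchInv D ol M G) (hocc : M.occ ≠ 0)
    (hcnt : M.slot.cnt (M.edgeof M.occ) = 0)
    (hbase : M.base < M.slot.minp (M.edgeof M.occ)) {par : ℕ → ℕ}
    (hF : Forest M.len par M.rk G.rt) :
    M.slot.minp (M.edgeof M.occ) ≤ M.len ∧ ∃ pl, SearchInv D ol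
      { M.slot with
        par := par
        nextp := Function.update M.nextp (M.edgeof M.occ)
          (M.pend (G.lo (M.slot.minp (M.edgeof M.occ))))
        pend := Function.update M.pend (G.lo (M.slot.minp (M.edgeof M.occ))) (M.edgeof M.occ) }
      { G.slot (M.edgeof M.occ) (M.stk M.len) with pl := pl } := by
  obtain ⟨⟨he1, he2⟩, hbl, hune, hT, hO⟩ := h.slot hocc
  set e := M.edgeof M.occ with he
  have hme : M.slot.minp e ≤ M.len := hT.minp_le_len h.stack rfl he1 he2
  have hun0 : (G.slot e (M.stk M.len)).un e = ∅ := by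
    rw [hT.cnt_eq e he1 he2] at hcnt
    exact Finset.card_eq_zero.1 hcnt
  have hne : (D.tl e).Nonempty := by
    obtain ⟨v, hv, _⟩ := hT.exists_minp e he1 he2 (by omega)
    exact ⟨v, hv⟩
  have hm : ∀ e', e' ≠ e → M.slot.minp e' = M.minp e' := fun e' hee =>
    Function.update_of_ne hee _ _
  have hu : ∀ e', e' ≠ e → (G.slot e (M.stk M.len)).un e' = G.un e' := fun e' hee =>
    Function.update_of_ne hee _ _
  have hI := h.interval
  set b₀ := G.lo (M.slot.minp e) with hb₀
  have hb1 : M.base < b₀ := hI.lo_gt _ hbase hme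
  have hb2 : b₀ ≤ M.len := (hI.lo_le _ hbase hme).trans hme
  have hb3 : G.lo b₀ = b₀ := hI.lo_lo _ hbase hme
  have hnot : ∀ b, M.base < b → b ≤ M.len → G.lo b = b → e ∉ G.pl b := fun b h1 h2 h3 h4 =>
    hune (h.edge.mem_pl b h1 h2 h3 e h4).2.2.1
  refine ⟨hme, Function.update G.pl b₀ (e :: G.pl b₀), ⟨h.static.n_eq, h.static.z_eq,
      h.static.hl_eq, h.static.hd_iff, h.static.chain,
      h.static.nodup, h.static.mem_iff⟩, h.cur_le, h.cur_dead, h.stack, h.interval,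
      ⟨hF, h.link.rk_zero, h.link.low_rt, h.link.root_lo⟩,
      h.path, h.workInv, hT, ⟨?_, ?_, ?_, ?_, ?_, ?_⟩, hO, h.outInv⟩ <;> dsimp only
  · intro e' h1 h2 h3 h4 h5
    by_cases hee : e' = e
    · subst hee
      left
      change e ∈ Function.update G.pl b₀ (e :: G.pl b₀) b₀
      rw [Function.update_self]
      exact List.mem_cons_self
    · rw [hu e' hee] at h3
      rw [hm e' hee] at h5 ⊢
      refine (h.edge.registered e' h1 h2 h3 h4 h5).imp_left fun h6 => ?_
      change e' ∈ Function.update G.pl b₀ (e :: G.pl b₀) (G.lo (M.minp e'))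
      by_cases hb : G.lo (M.minp e') = b₀
      · rw [hb] at h6 ⊢
        rw [Function.update_self]
        exact List.mem_cons_of_mem _ h6
      · rwa [Function.update_of_ne hb]
  · intro e' h1 h2 h3
    by_cases hee : e' = e
    · subst hee; exact h.edge.fresh_of_un e h1 h2 hune
    · rw [hu e' hee] at h3; exact h.edge.fresh_of_un e' h1 h2 h3
  · intro b h1 h2 h3
    by_cases hb : b = b₀
    · subst hb
      rw [Function.update_self, Function.update_self]
      refine ⟨rfl, by omega, ?_⟩
      rw [Function.update_self]
      exact (h.edge.chain b₀ h1 h2 h3).update _ (hnot b₀ h1 h2 h3)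
    · rw [Function.update_of_ne hb, Function.update_of_ne hb]
      exact (h.edge.chain b h1 h2 h3).update _ (hnot b h1 h2 h3)
  · intro b h1 h2 h3
    by_cases hb : b = b₀
    · subst hb
      rw [Function.update_self]
      exact List.nodup_cons.2 ⟨hnot b₀ h1 h2 h3, h.edge.nodup b₀ h1 h2 h3⟩
    · rw [Function.update_of_ne hb]
      exact h.edge.nodup b h1 h2 h3
  · intro b h1 h2 h3 e' he'
    by_cases hee : e' = e
    · subst hee
      have hb : b = b₀ := by
        by_contra hb
        rw [Function.update_of_ne hb] at he'
        exact hnot b h1 h2 h3 he'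
      exact ⟨⟨he1, he2⟩, h.edge.fresh_of_un e he1 he2 hune, hun0, hne, hbase, hb.symm⟩
    · have he'' : e' ∈ G.pl b := by
        by_cases hb : b = b₀
        · subst hb
          rw [Function.update_self] at he'
          exact (List.mem_cons.1 he').resolve_left hee
        · rwa [Function.update_of_ne hb] at he'
      rw [hu e' hee, hm e' hee]
      exact h.edge.mem_pl b h1 h2 h3 e' he''
  · intro x hx
    have hx' : M.len < x := hx
    rw [Function.update_of_ne (by omega)]
    exact h.edge.pend_zero x hx

/-- Each tail occurrence is processed once. -/
theorem SearchInv.slot_sum (h : SearchInv D ol M G) (hocc : M.occ ≠ 0) :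
    ∑ e ∈ Finset.Icc 1 D.m, M.slot.cnt e + 1 = ∑ e ∈ Finset.Icc 1 D.m, M.cnt e := by
  obtain ⟨⟨he1, he2⟩, _, hune, _, _⟩ := h.slot hocc
  have hmem := Finset.mem_Icc.2 ⟨he1, he2⟩
  rw [← Finset.add_sum_erase _ _ hmem, ← Finset.add_sum_erase _ _ hmem]
  have h1 : M.cnt (M.edgeof M.occ) ≠ 0 := by
    rw [h.tail.cnt_eq _ he1 he2]
    exact fun h0 => hune (Finset.card_eq_zero.1 h0)
  have h2 : ∑ e ∈ (Finset.Icc 1 D.m).erase (M.edgeof M.occ), M.slot.cnt e =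
      ∑ e ∈ (Finset.Icc 1 D.m).erase (M.edgeof M.occ), M.cnt e :=
    Finset.sum_congr rfl fun e he => Function.update_of_ne (Finset.ne_of_mem_erase he) _ _
  have h3 : M.slot.cnt (M.edgeof M.occ) = M.cnt (M.edgeof M.occ) - 1 := Function.update_self ..
  omega

end Steps

/-! ### The search program -/

namespace RAM

/-! The registers, with `a`, …, `h` for intermediate results, and the arrays. -/

@[simp] def Reg.n : ℕ := 0
@[simp] def Reg.len : ℕ := 1
@[simp] def Reg.base : ℕ := 2
@[simp] def Reg.top : ℕ := 3
@[simp] def Reg.cur : ℕ := 4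
@[simp] def Reg.wl : ℕ := 5
@[simp] def Reg.occ : ℕ := 6
@[simp] def Reg.z : ℕ := 7
@[simp] def Reg.op : ℕ := 8
@[simp] def Reg.cc : ℕ := 9
@[simp] def Reg.a : ℕ := 10
@[simp] def Reg.b : ℕ := 11
@[simp] def Reg.c : ℕ := 12
@[simp] def Reg.d : ℕ := 13
@[simp] def Reg.e : ℕ := 14
@[simp] def Reg.f : ℕ := 15
@[simp] def Reg.g : ℕ := 16
@[simp] def Reg.h : ℕ := 17

@[simp] def Arr.inp : ℕ := 0
@[simp] def Arr.out : ℕ := 1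
@[simp] def Arr.pos : ℕ := 2
@[simp] def Arr.stk : ℕ := 3
@[simp] def Arr.work : ℕ := 4
@[simp] def Arr.wb : ℕ := 5
@[simp] def Arr.prevb : ℕ := 6
@[simp] def Arr.par : ℕ := 7
@[simp] def Arr.rk : ℕ := 8
@[simp] def Arr.low : ℕ := 9
@[simp] def Arr.root : ℕ := 10
@[simp] def Arr.pend : ℕ := 11
@[simp] def Arr.nextp : ℕ := 12
@[simp] def Arr.cnt : ℕ := 13
@[simp] def Arr.minp : ℕ := 14
@[simp] def Arr.hp : ℕ := 15
@[simp] def Arr.occh : ℕ := 16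
@[simp] def Arr.nexto : ℕ := 17
@[simp] def Arr.edgeof : ℕ := 18

/-- The registers and arrays that the search uses, by name. -/
def State.view (s : State) : Memory where
  n := s.reg Reg.n
  len := s.reg Reg.len
  base := s.reg Reg.base
  top := s.reg Reg.top
  cur := s.reg Reg.cur
  wl := s.reg Reg.wl
  occ := s.reg Reg.occ
  z := s.reg Reg.z
  op := s.reg Reg.op
  cc := s.reg Reg.cc
  inp := s.arr Arr.inp
  out := s.arr Arr.out
  pos := s.arr Arr.pos
  stk := s.arr Arr.stk
  work := s.arr Arr.work
  wb := s.arr Arr.wb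
  prevb := s.arr Arr.prevb
  par := s.arr Arr.par
  rk := s.arr Arr.rk
  low := s.arr Arr.low
  root := s.arr Arr.root
  pend := s.arr Arr.pend
  nextp := s.arr Arr.nextp
  cnt := s.arr Arr.cnt
  minp := s.arr Arr.minp
  hp := s.arr Arr.hp
  occh := s.arr Arr.occh
  nexto := s.arr Arr.nexto
  edgeof := s.arr Arr.edgeof

/-- `b` becomes the root of the tree of `a`, with path compression. -/
def findProg : Program :=
  .seq (block [.copy Reg.b Reg.a, .load Reg.c Arr.par Reg.b])
    (.seq (.loop (.ne Reg.c Reg.b) (block [.copy Reg.b Reg.c, .load Reg.c Arr.par Reg.b]))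
      (.loop (.ne Reg.a Reg.b)
        (block [.load Reg.c Arr.par Reg.a, .store Arr.par Reg.a Reg.b, .copy Reg.a Reg.c])))

/-- The node in register `r` is visited. -/
def pushProg (r : ℕ) : Program :=
  block [.inc Reg.len, .store Arr.pos r Reg.len, .store Arr.stk Reg.len r,
    .store Arr.wb Reg.len Reg.wl, .store Arr.prevb Reg.len Reg.top,
    .store Arr.par Reg.len Reg.len, .store Arr.low Reg.len Reg.len,
    .store Arr.root Reg.len Reg.len, .copy Reg.top Reg.len, .load Reg.occ Arr.occh r]

/-- The first of the remaining tail occurrences of the last node is processed. If it completes the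
tail of a hyperedge without dead tail nodes, the hyperedge is put into the list of the interval that
contains the least position of its tail. -/
def slotProg : Program :=
  .seq (block [.load Reg.d Arr.edgeof Reg.occ, .load Reg.e Arr.cnt Reg.d, .dec Reg.e,
      .store Arr.cnt Reg.d Reg.e, .load Reg.a Arr.minp Reg.d, .const Reg.f 0,
      .load Reg.occ Arr.nexto Reg.occ])
    (.seq (.cond (.eq Reg.a Reg.f) (block [.copy Reg.a Reg.len]) .skip)
      (.seq (block [.store Arr.minp Reg.d Reg.a])
        (.cond (.eq Reg.e Reg.f)
          (.cond (.lt Reg.base Reg.a)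
            (.seq findProg
              (block [.load Reg.a Arr.low Reg.b, .load Reg.c Arr.pend Reg.a,
                .store Arr.nextp Reg.d Reg.c, .store Arr.pend Reg.a Reg.d]))
            .skip)
          .skip)))

/-- The hyperedge `a` is removed from the list of the top interval, and its heads are copied to
the work stack. -/
def activateProg : Program :=
  .seq (block [.load Reg.b Arr.nextp Reg.a, .store Arr.pend Reg.top Reg.b,
      .load Reg.c Arr.hp Reg.a, .load Reg.d Arr.inp Reg.c, .const Reg.e 0])
    (.loop (.lt Reg.e Reg.d)
      (block [.inc Reg.c, .load Reg.b Arr.inp Reg.c, .store Arr.work Reg.wl Reg.b,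
        .inc Reg.wl, .inc Reg.e]))

/-- The top interval is merged with the one below it, with union by rank. -/
def mergeProg : Program :=
  .seq (block [.load Reg.a Arr.prevb Reg.top, .load Reg.b Arr.root Reg.top,
      .load Reg.c Arr.root Reg.a, .load Reg.d Arr.rk Reg.b, .load Reg.e Arr.rk Reg.c])
    (.seq (.cond (.lt Reg.e Reg.d)
        (block [.copy Reg.f Reg.b, .copy Reg.b Reg.c, .copy Reg.c Reg.f, .copy Reg.f Reg.d,
          .copy Reg.d Reg.e, .copy Reg.e Reg.f]) .skip)
      (.seq (block [.store Arr.par Reg.b Reg.c])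
        (.seq (.cond (.eq Reg.d Reg.e) (block [.inc Reg.e, .store Arr.rk Reg.c Reg.e]) .skip)
          (block [.store Arr.root Reg.a Reg.c, .store Arr.low Reg.c Reg.a,
            .copy Reg.top Reg.a]))))

/-- The nodes of the top interval are written to the output as a component, and the path dies. -/
def outputProg : Program :=
  .seq (block [.copy Reg.a Reg.op, .inc Reg.op, .copy Reg.b Reg.top, .const Reg.c 0])
    (.seq (.loop (.le Reg.b Reg.len)
        (block [.load Reg.d Arr.stk Reg.b, .store Arr.out Reg.op Reg.d, .inc Reg.op, .inc Reg.c,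
          .inc Reg.b]))
      (block [.store Arr.out Reg.a Reg.c, .inc Reg.cc, .copy Reg.base Reg.len]))

/-- `h` becomes a node that is reachable from the top interval. -/
def chooseProg : Program :=
  .seq (block [.load Reg.g Arr.wb Reg.top])
    (.cond (.lt Reg.g Reg.wl) (block [.copy Reg.h Reg.wl, .dec Reg.h, .load Reg.h Arr.work Reg.h])
      (.cond (.eq Reg.z Reg.f) (block [.load Reg.h Arr.stk Reg.top])
        (block [.copy Reg.h Reg.z, .dec Reg.h])))

/-- A node reachable from the top interval is examined: it is visited if it is new, the path dies if
it is dead, and the top interval is merged with the one below it if it lies below the top interval.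
If it lies in the top interval, it is removed from the work stack; if there was none to remove,
the top interval is a component. -/
def exploreProg : Program :=
  .seq chooseProg
    (.seq (block [.load Reg.b Arr.pos Reg.h])
      (.cond (.eq Reg.b Reg.f) (pushProg Reg.h)
        (.cond (.le Reg.b Reg.base) (block [.copy Reg.base Reg.len])
          (.cond (.lt Reg.b Reg.top) mergeProg
            (.cond (.lt Reg.g Reg.wl) (block [.dec Reg.wl]) outputProg)))))

/-- One step of the search. -/
def bodyProg : Program :=
  .seq (block [.const Reg.f 0])
    (.cond (.lt Reg.base Reg.len)
      (.cond (.ne Reg.occ Reg.f) slotProg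
        (.seq (block [.load Reg.a Arr.pend Reg.top])
          (.cond (.ne Reg.a Reg.f) activateProg exploreProg)))
      (.seq (block [.load Reg.a Arr.pos Reg.cur])
        (.cond (.eq Reg.a Reg.f) (pushProg Reg.cur) (block [.inc Reg.cur]))))

/-- The search, until there are no starting nodes left. -/
def searchProg : Program := .loop (.lt Reg.cur Reg.n) bodyProg

/-! ### The search program performs the steps of the search -/

theorem climb_runs {r l x : ℕ} {s : State} (hc : Climb (s.arr Arr.par) x r l)
    (hb : s.reg Reg.b = x) (hpar : s.reg Reg.c = s.arr Arr.par x) :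
    ∃ s', Runs (.loop (.ne Reg.c Reg.b) (block [.copy Reg.b Reg.c, .load Reg.c Arr.par Reg.b]))
        s s' (3 * l + 1) ∧ s'.reg Reg.b = r ∧
      (∀ i, i ≠ Reg.b → i ≠ Reg.c → s'.reg i = s.reg i) ∧ s'.arr = s.arr := by
  induction hc' : l generalizing s x l with
  | zero =>
    subst hc'
    cases hc with
    | root _ h =>
      refine ⟨s, .loopFalse ?_, hb, fun _ _ _ => rfl, rfl⟩
      simp only [Test.Holds, hb, hpar, h, ne_eq, not_true, not_false_iff]
  | succ l' ih =>
    subst hc'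
    cases hc with
    | step _ _ _ h hc =>
      set l := [Instr.copy Reg.b Reg.c, Instr.load Reg.c Arr.par Reg.b] with hl
      have harr : (execs s l).arr = s.arr := by simp [hl, execs, Instr.apply]
      have hreg : ∀ i, i ≠ Reg.b → i ≠ Reg.c → (execs s l).reg i = s.reg i := by
        intro i h1 h2
        simp only [Reg.b, Reg.c, ne_eq] at h1 h2
        simp [hl, execs, Instr.apply, h1, h2]
      obtain ⟨s', hr, h1, h2, h3⟩ := ih (s := execs s l) (x := s.arr Arr.par x) (l := l')
        (by rw [harr]; exact hc)
        (by simpa [hl, execs, Instr.apply] using hpar)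
        (by simp [hl, execs, Instr.apply] at hpar ⊢; rw [hpar]) rfl
      refine ⟨s', ?_, h1, fun i hi hi' => (h2 i hi hi').trans (hreg i hi hi'), h3.trans harr⟩
      have := Runs.loopTrue (b := .ne Reg.c Reg.b) (by
        simp only [Test.Holds, hb, hpar, ne_eq]; exact h) (runs_block l s) hr
      convert this using 1
      simp only [hl, List.length_cons, List.length_nil]
      ring

theorem compress_runs {r l x : ℕ} {par par' : ℕ → ℕ} {s : State} (hc : Compress r par x par' l)
    (hpar : s.arr Arr.par = par) (ha : s.reg Reg.a = x) (hb : s.reg Reg.b = r) :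
    ∃ s', Runs (.loop (.ne Reg.a Reg.b)
        (block [.load Reg.c Arr.par Reg.a, .store Arr.par Reg.a Reg.b, .copy Reg.a Reg.c]))
        s s' (4 * l + 1) ∧ s'.reg Reg.b = r ∧
      (∀ i, i ≠ Reg.a → i ≠ Reg.c → s'.reg i = s.reg i) ∧
      s'.arr = Function.update s.arr Arr.par par' := by
  induction hc generalizing s with
  | done par =>
    refine ⟨s, .loopFalse ?_, hb, fun _ _ _ => rfl, ?_⟩
    · simp only [Test.Holds, ha, hb, ne_eq, not_true, not_false_iff]
    · rw [← hpar, Function.update_eq_self]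
  | step par x par' l h hc ih =>
    set is := [Instr.load Reg.c Arr.par Reg.a, Instr.store Arr.par Reg.a Reg.b,
      Instr.copy Reg.a Reg.c] with his
    have harr : (execs s is).arr =
        Function.update s.arr Arr.par (Function.update par x r) := by
      simp only [Arr.par, Reg.a, Reg.b] at hpar ha hb
      simp [his, execs, Instr.apply, hpar, ha, hb]
    have hreg : ∀ i, i ≠ Reg.a → i ≠ Reg.c → (execs s is).reg i = s.reg i := by
      intro i h1 h2
      simp only [Reg.a, Reg.c, ne_eq] at h1 h2
      simp [his, execs, Instr.apply, h1, h2]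
    obtain ⟨s', hr, h1, h2, h3⟩ := ih (s := execs s is)
      (by rw [harr, Function.update_self])
      (by
        simp only [Arr.par, Reg.a] at hpar ha
        simp [his, execs, Instr.apply, hpar, ha])
      (by rw [hreg Reg.b (by decide) (by decide), hb])
    refine ⟨s', ?_, h1, fun i hi hi' => (h2 i hi hi').trans (hreg i hi hi'), ?_⟩
    · have := Runs.loopTrue (b := .ne Reg.a Reg.b) (by
        simp only [Test.Holds, ha, hb, ne_eq]; exact h) (runs_block is s) hr
      convert this using 1
      simp only [his, List.length_cons, List.length_nil]
      ring
    · rw [h3, harr, Function.update_idem]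

theorem ends_find {r l : ℕ} {par' : ℕ → ℕ} {s : State}
    (hc : Climb (s.arr Arr.par) (s.reg Reg.a) r l)
    (hc' : Compress r (s.arr Arr.par) (s.reg Reg.a) par' l) :
    Ends findProg s fun s' t => t = 7 * l + 4 ∧ s'.reg Reg.b = r ∧
      (∀ i, i ≠ Reg.a → i ≠ Reg.b → i ≠ Reg.c → s'.reg i = s.reg i) ∧
      s'.arr = Function.update s.arr Arr.par par' := by
  set is := [Instr.copy Reg.b Reg.a, Instr.load Reg.c Arr.par Reg.b] with his
  have harr : (execs s is).arr = s.arr := by simp [his, execs, Instr.apply]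
  have hreg : ∀ i, i ≠ Reg.b → i ≠ Reg.c → (execs s is).reg i = s.reg i := by
    intro i h1 h2
    simp only [Reg.b, Reg.c, ne_eq] at h1 h2
    simp [his, execs, Instr.apply, h1, h2]
  obtain ⟨s₁, hr₁, h1, h2, h3⟩ := climb_runs (s := execs s is) (x := s.reg Reg.a) (r := r) (l := l)
    (by rw [harr]; exact hc) (by simp [his, execs, Instr.apply])
    (by simp [his, execs, Instr.apply])
  obtain ⟨s₂, hr₂, h4, h5, h6⟩ := compress_runs (s := s₁) hc' (by rw [h3, harr])
    (by rw [h2 _ (by decide) (by decide), hreg _ (by decide) (by decide)]) h1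
  refine ⟨s₂, _, .seq (runs_block is s) (.seq hr₁ hr₂), ?_, h4, ?_, ?_⟩
  · simp only [his, List.length_cons, List.length_nil]; ring
  · intro i hi hi' hi''
    rw [h5 i hi hi'', h2 i hi' hi'', hreg i hi' hi'']
  · rw [h6, h3, harr]

theorem view_push (s : State) (r : ℕ) (hr : r ≠ Reg.len) (hr' : r ≠ Reg.top) :
    Ends (pushProg r) s fun s' t => t = 10 ∧ s'.view = s.view.push (s.reg r) := by
  apply Ends.block
  simp only [Reg.len, Reg.top, ne_eq] at hr hr'
  simp [execs, Instr.apply, State.view, Memory.push, hr, hr']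

end RAM

namespace RAM

variable {D : SearchProblem} {ol : ℕ → List ℕ} {s : State} {G : Ghost} {K : ℕ}

theorem ends_push (h : SearchInv D ol s.view G) (r : ℕ) (hr : r ≠ Reg.len) (hr' : r ≠ Reg.top)
    (hx : s.reg r < D.n) (hpos : s.view.pos (s.reg r) = 0) (hrest : G.rest = [])
    (hreach : s.view.base < s.view.len → D.Reach (s.view.stk s.view.top) (s.reg r)) :
    Ends (pushProg r) s fun s' t => ∃ G', SearchInv D ol s'.view G' ∧
      t + 30 + searchPotential D K s'.view G' ≤ searchPotential D K s.view G := by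
  refine (view_push s r hr hr').mono ?_
  rintro s' t ⟨rfl, hv⟩
  have h' := h.push hx hpos hrest hreach
  refine ⟨_, by rw [hv]; exact h', ?_⟩
  have := h.push_potential (x := s.reg r) (ol (s.reg r)) K h'.stack.len_le
  rw [hv]
  omega

theorem ends_slot (hK : D.n < ack K 1) (h : SearchInv D ol s.view G) (hocc : s.view.occ ≠ 0) :
    Ends slotProg s fun s' t => ∃ G', SearchInv D ol s'.view G' ∧
      t + 30 + searchPotential D K s'.view G' ≤ searchPotential D K s.view G := by
  have hsum := h.slot_sum hocc
  obtain ⟨he, hbl, _⟩ := h.slot hocc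
  have hskip : ∀ (s' : State) (t : ℕ), t ≤ 20 → s'.view = s.view.slot →
      (s.view.slot.cnt (s.view.edgeof s.view.occ) = 0 →
        s.view.slot.minp (s.view.edgeof s.view.occ) ≤ s.view.base) →
      ∃ G', SearchInv D ol s'.view G' ∧
        t + 30 + searchPotential D K s'.view G' ≤ searchPotential D K s.view G := by
    intro s' t ht hv hs
    refine ⟨_, by rw [hv]; exact h.slot_skip hocc hs, ?_⟩
    rw [hv]
    have h1 : (7 * K + 60) * ∑ e ∈ Finset.Icc 1 D.m, s.view.cnt e =
        (7 * K + 60) * (∑ e ∈ Finset.Icc 1 D.m, s.view.slot.cnt e) + (7 * K + 60) := by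
      rw [← hsum]; ring
    simp only [searchPotential, h1]
    simp only [Memory.slot, Ghost.slot]
    omega
  apply Ends.seq
  apply Ends.block
  set is₁ := [Instr.load Reg.d Arr.edgeof Reg.occ, Instr.load Reg.e Arr.cnt Reg.d,
    Instr.dec Reg.e, Instr.store Arr.cnt Reg.d Reg.e, Instr.load Reg.a Arr.minp Reg.d,
    Instr.const Reg.f 0, Instr.load Reg.occ Arr.nexto Reg.occ] with his₁
  set s₁ := execs s is₁ with hs₁
  have hv₁ : s₁.view = { s.view with
      occ := s.view.nexto s.view.occ
      cnt := Function.update s.view.cnt (s.view.edgeof s.view.occ)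
        (s.view.cnt (s.view.edgeof s.view.occ) - 1) } := by
    simp [hs₁, his₁, execs, Instr.apply, State.view]
  have hd₁ : s₁.reg Reg.d = s.view.edgeof s.view.occ := by
    simp [hs₁, his₁, execs, Instr.apply, State.view]
  have he₁ : s₁.reg Reg.e = s.view.slot.cnt (s.view.edgeof s.view.occ) := by
    simp [hs₁, his₁, execs, Instr.apply, State.view, Memory.slot]
  have ha₁ : s₁.reg Reg.a = s.view.minp (s.view.edgeof s.view.occ) := by
    simp [hs₁, his₁, execs, Instr.apply, State.view]
  have hf₁ : s₁.reg Reg.f = 0 := by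
    simp [hs₁, his₁, execs, Instr.apply]
  have hlen₁ : is₁.length = 7 := rfl
  clear_value s₁ is₁
  apply Ends.seq
  have hmid : Ends (.cond (.eq Reg.a Reg.f) (block [.copy Reg.a Reg.len]) .skip) s₁ fun s₂ t =>
      t ≤ 2 ∧ s₂.view = s₁.view ∧ s₂.reg Reg.d = s₁.reg Reg.d ∧ s₂.reg Reg.e = s₁.reg Reg.e ∧
      s₂.reg Reg.f = 0 ∧
      s₂.reg Reg.a = s.view.slot.minp (s.view.edgeof s.view.occ) := by
    apply Ends.cond
    · intro hb
      apply Ends.block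
      have hb' : s.view.minp (s.view.edgeof s.view.occ) = 0 := by
        simp only [Test.Holds] at hb
        rw [← ha₁, hb, hf₁]
      refine ⟨by simp, by simp [execs, Instr.apply, State.view],
        by simp [execs, Instr.apply], by simp [execs, Instr.apply],
        by simpa [execs, Instr.apply] using hf₁, ?_⟩
      have : s₁.view.len = s.view.len := by rw [hv₁]
      simp only [State.view, Reg.len] at this
      simp [execs, Instr.apply, Memory.slot, hb', this]
      simp [State.view]
    · intro hb
      apply Ends.skip
      have hb' : s.view.minp (s.view.edgeof s.view.occ) ≠ 0 := by
        simp only [Test.Holds] at hb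
        rwa [ha₁, hf₁] at hb
      refine ⟨by simp, rfl, rfl, rfl, hf₁, ?_⟩
      rw [ha₁]
      simp [Memory.slot, hb']
  refine hmid.mono ?_
  rintro s₂ t₂ ⟨ht₂, hv₂, hd₂, he₂, hf₂, ha₂⟩
  apply Ends.seq
  apply Ends.block
  set s₃ := execs s₂ [Instr.store Arr.minp Reg.d Reg.a] with hs₃
  have hv₃ : s₃.view = s.view.slot := by
    have h1 : s₃.view = { s₂.view with
        minp := Function.update s₂.view.minp (s₂.reg Reg.d) (s₂.reg Reg.a) } := by
      simp [hs₃, execs, Instr.apply, State.view]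
    rw [h1, hv₂, hd₂, hd₁, ha₂, hv₁]
    simp [Memory.slot]
  have hreg₃ : s₃.reg = s₂.reg := by simp [hs₃, execs, Instr.apply]
  clear_value s₃
  apply Ends.cond
  · intro hb
    have hcnt : s.view.slot.cnt (s.view.edgeof s.view.occ) = 0 := by
      simp only [Test.Holds] at hb
      rwa [hreg₃, he₂, he₁, hf₂] at hb
    apply Ends.cond
    · intro hb'
      have hbase : s.view.base < s.view.slot.minp (s.view.edgeof s.view.occ) := by
        simp only [Test.Holds] at hb'
        rw [hreg₃, ha₂, ← hreg₃] at hb'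
        have : s₃.reg Reg.base = s₃.view.base := rfl
        rwa [this, hv₃] at hb'
      set x := s.view.slot.minp (s.view.edgeof s.view.occ) with hx
      obtain ⟨hxlen, _⟩ := h.slot_register hocc hcnt hbase h.link.forest
      have hK' : s.view.len < ack K 1 := h.stack.len_le.trans_lt hK
      obtain ⟨par', l, hc, hc', hF, hpot⟩ := h.link.forest.find hK' 10 (by omega) hxlen
      obtain ⟨_, pl, hinv⟩ := h.slot_register hocc hcnt hbase hF
      have hpar₃ : s₃.arr Arr.par = s.view.par := by
        have : s₃.arr Arr.par = s₃.view.par := rfl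
        rw [this, hv₃]; rfl
      apply Ends.seq
      refine (ends_find (s := s₃) (by rw [hpar₃, hreg₃, ha₂]; exact hc)
        (by rw [hpar₃, hreg₃, ha₂]; exact hc')).mono ?_
      rintro s₄ t₄ ⟨rfl, hb₄, hreg₄, harr₄⟩
      have hv₄ : s₄.view = { s.view.slot with par := par' } := by
        have hr : ∀ i, i ≠ 10 → i ≠ 11 → i ≠ 12 → s₄.reg i = s₃.reg i := hreg₄
        rw [← hv₃]
        simp [State.view, hr, harr₄]
      have hd₄ : s₄.reg Reg.d = s.view.edgeof s.view.occ := by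
        rw [hreg₄ _ (by decide) (by decide) (by decide), hreg₃, hd₂, hd₁]
      apply Ends.block
      set s₅ := execs s₄ [Instr.load Reg.a Arr.low Reg.b, Instr.load Reg.c Arr.pend Reg.a,
        Instr.store Arr.nextp Reg.d Reg.c, Instr.store Arr.pend Reg.a Reg.d] with hs₅
      have hv₅ : s₅.view = { s₄.view with
          nextp := Function.update s₄.view.nextp (s₄.reg Reg.d)
            (s₄.view.pend (s₄.view.low (s₄.reg Reg.b)))
          pend := Function.update s₄.view.pend (s₄.view.low (s₄.reg Reg.b))
            (s₄.reg Reg.d) } := by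
        simp [hs₅, execs, Instr.apply, State.view]
      have hlow : s₄.view.low (s₄.reg Reg.b) = G.lo x := by
        rw [hb₄, hv₄]
        exact h.link.low_rt x hbase hxlen
      rw [hlow, hd₄, hv₄] at hv₅
      refine ⟨_, by rw [hv₅]; exact hinv, ?_⟩
      rw [hv₅]
      have h1 : (7 * K + 60) * ∑ e ∈ Finset.Icc 1 D.m, s.view.cnt e =
          (7 * K + 60) * (∑ e ∈ Finset.Icc 1 D.m, s.view.slot.cnt e) + (7 * K + 60) := by
        rw [← hsum]; ring
      simp only [searchPotential, h1]
      simp only [Memory.slot, Ghost.slot, hlen₁, List.length_cons, List.length_nil]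
      omega
    · intro hb'
      apply Ends.skip
      apply hskip _ _ (by simp only [hlen₁, List.length_cons, List.length_nil]; omega) hv₃
      intro _
      simp only [Test.Holds] at hb'
      rw [hreg₃, ha₂, ← hreg₃] at hb'
      have : s₃.reg Reg.base = s₃.view.base := rfl
      rw [this, hv₃] at hb'
      exact Nat.not_lt.1 hb'
  · intro hb
    apply Ends.skip
    apply hskip _ _ (by simp only [hlen₁, List.length_cons, List.length_nil]; omega) hv₃
    intro h0
    simp only [Test.Holds] at hb
    rw [hreg₃, he₂, he₁, hf₂] at hb
    exact absurd h0 hb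

theorem ends_activate (h : SearchInv D ol s.view G) (hbl : s.view.base < s.view.len)
    (ha : s.reg Reg.a = s.view.pend s.view.top) (hpend : s.view.pend s.view.top ≠ 0) :
    Ends activateProg s fun s' t => ∃ G', SearchInv D ol s'.view G' ∧
      t + 30 + searchPotential D K s'.view G' ≤ searchPotential D K s.view G := by
  set e := s.view.pend s.view.top with he
  obtain ⟨ht1, ht2, ht3⟩ := h.lo_top hbl
  have hem : 1 ≤ e ∧ e ≤ D.m := by
    obtain ⟨l, hl, _⟩ := (h.edge.chain _ ht1 ht2 ht3).exists_cons hpend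
    exact (h.edge.mem_pl _ ht1 ht2 ht3 e (by rw [hl]; exact List.mem_cons_self)).1
  have hhl := h.static.hl_eq e hem.1 hem.2
  apply Ends.seq
  apply Ends.block
  set is₁ := [Instr.load Reg.b Arr.nextp Reg.a, Instr.store Arr.pend Reg.top Reg.b,
      Instr.load Reg.c Arr.hp Reg.a, Instr.load Reg.d Arr.inp Reg.c, Instr.const Reg.e 0] with his₁
  set s₁ := execs s is₁ with hs₁
  have hlen₁ : is₁.length = 5 := rfl
  have hv₁ : s₁.view = { s.view with
      pend := Function.update s.view.pend s.view.top (s.view.nextp e) } := by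
    rw [← ha]
    simp [hs₁, his₁, execs, Instr.apply, State.view]
  have hc₁ : s₁.reg Reg.c = s.view.hp e := by
    rw [← ha]
    simp [hs₁, his₁, execs, Instr.apply, State.view]
  have hd₁ : s₁.reg Reg.d = D.hl e := by
    rw [← hhl, ← ha]
    simp [hs₁, his₁, execs, Instr.apply, State.view]
  have he₁ : s₁.reg Reg.e = 0 := by
    simp [hs₁, his₁, execs, Instr.apply]
  clear_value s₁ is₁
  refine (Ends.loop (fun s' d => ∃ j ≤ D.hl e, ∃ work, d = 6 * (D.hl e - j) ∧
    s'.view = { s.view with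
      pend := Function.update s.view.pend s.view.top (s.view.nextp e)
      wl := s.view.wl + j
      work := work } ∧ s'.reg Reg.c = s.view.hp e + j ∧ s'.reg Reg.d = D.hl e ∧
      s'.reg Reg.e = j ∧ (∀ i < s.view.wl, work i = s.view.work i) ∧
      (∀ i < j, work (s.view.wl + i) = s.view.inp (s.view.hp e + 1 + i))) ?_
    (d := 6 * D.hl e) ⟨0, Nat.zero_le _, s.view.work, rfl, hv₁, hc₁, hd₁, he₁,
      fun _ _ => rfl, fun _ hi => absurd hi (Nat.not_lt_zero _)⟩).mono ?_
  · rintro s' d ⟨j, hj, work, rfl, hv, hc, hd, he', hw, hw'⟩ hb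
    have hjlt : j < D.hl e := by
      simp only [Test.Holds] at hb
      rwa [hd, he'] at hb
    apply Ends.block
    set s₂ := execs s' [Instr.inc Reg.c, Instr.load Reg.b Arr.inp Reg.c,
      Instr.store Arr.work Reg.wl Reg.b, Instr.inc Reg.wl, Instr.inc Reg.e] with hs₂
    have hv₂ : s₂.view = { s'.view with
        wl := s'.view.wl + 1
        work := Function.update s'.view.work s'.view.wl (s'.view.inp (s'.reg Reg.c + 1)) } := by
      simp [hs₂, execs, Instr.apply, State.view]
    rw [hv, hc] at hv₂
    dsimp only at hv₂
    refine ⟨6 * (D.hl e - (j + 1)), ⟨j + 1, hjlt, _, rfl, hv₂, ?_, ?_, ?_, ?_, ?_⟩, ?_⟩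
    · have : s₂.reg Reg.c = s'.reg Reg.c + 1 := by simp [hs₂, execs, Instr.apply]
      rw [this, hc]; ring
    · have : s₂.reg Reg.d = s'.reg Reg.d := by simp [hs₂, execs, Instr.apply]
      rw [this, hd]
    · have : s₂.reg Reg.e = s'.reg Reg.e + 1 := by simp [hs₂, execs, Instr.apply]
      rw [this, he']
    · intro i hi
      rw [Function.update_of_ne (by omega)]
      exact hw i hi
    · intro i hi
      rcases Nat.lt_succ_iff_lt_or_eq.1 hi with hi | rfl
      · rw [Function.update_of_ne (by omega)]
        exact hw' i hi
      · rw [Function.update_self, Nat.add_right_comm]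
    · simp only [List.length_cons, List.length_nil]
      omega
  · rintro s' t ⟨d, ⟨j, hj, work, rfl, hv, hc, hd, he', hw, hw'⟩, hb, ht⟩
    have hjeq : j = D.hl e := by
      simp only [Test.Holds] at hb
      rw [hd, he'] at hb
      omega
    subst hjeq
    obtain ⟨_, hfresh, l, hinv⟩ := h.activate hbl hpend hw hw'
    refine ⟨_, by rw [hv]; exact hinv, ?_⟩
    rw [hv]
    have := SearchInv.activate_potential (D := D) (M := s.view) (e := e) hfresh K
      (Function.update s.view.pend s.view.top (s.view.nextp e)) work
      (Function.update G.pl s.view.top l)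
    rw [hlen₁]
    exact le_trans (Nat.add_le_add_right (by omega) _) (Nat.add_comm _ _ ▸ this)

theorem ends_merge (h : SearchInv D ol s.view G) (hbl : s.view.base < s.view.len) {w : ℕ}
    (hw : w < D.n) (hreach : D.Reach (s.view.stk s.view.top) w)
    (hlive : s.view.base < s.view.pos w) (hpos : s.view.pos w < s.view.top)
    (hpend : s.view.pend s.view.top = 0) :
    Ends mergeProg s fun s' t => ∃ G', SearchInv D ol s'.view G' ∧
      t + 30 + searchPotential D K s'.view G' ≤ searchPotential D K s.view G := by
  apply Ends.seq
  apply Ends.block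
  set is₁ := [Instr.load Reg.a Arr.prevb Reg.top, Instr.load Reg.b Arr.root Reg.top,
      Instr.load Reg.c Arr.root Reg.a, Instr.load Reg.d Arr.rk Reg.b,
      Instr.load Reg.e Arr.rk Reg.c] with his₁
  have hlen₁ : is₁.length = 5 := rfl
  set s₁ := execs s is₁ with hs₁
  have hv₁ : s₁.view = s.view := by simp [hs₁, his₁, execs, Instr.apply, State.view]
  have ha₁ : s₁.reg Reg.a = s.view.prevb s.view.top := by
    simp [hs₁, his₁, execs, Instr.apply, State.view]
  have hb₁ : s₁.reg Reg.b = s.view.root s.view.top := by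
    simp [hs₁, his₁, execs, Instr.apply, State.view]
  have hc₁ : s₁.reg Reg.c = s.view.root (s.view.prevb s.view.top) := by
    simp [hs₁, his₁, execs, Instr.apply, State.view]
  have hd₁ : s₁.reg Reg.d = s.view.rk (s.view.root s.view.top) := by
    simp [hs₁, his₁, execs, Instr.apply, State.view]
  have he₁ : s₁.reg Reg.e = s.view.rk (s.view.root (s.view.prevb s.view.top)) := by
    simp [hs₁, his₁, execs, Instr.apply, State.view]
  clear_value s₁ is₁
  apply Ends.seq
  have hmid : Ends (.cond (.lt Reg.e Reg.d)
        (block [.copy Reg.f Reg.b, .copy Reg.b Reg.c, .copy Reg.c Reg.f, .copy Reg.f Reg.d,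
          .copy Reg.d Reg.e, .copy Reg.e Reg.f]) .skip) s₁ fun s₂ t =>
      t ≤ 7 ∧ s₂.view = s.view ∧ s₂.reg Reg.a = s.view.prevb s.view.top ∧ ∃ x y,
        ((x = s.view.root s.view.top ∧ y = s.view.root (s.view.prevb s.view.top)) ∨
          (y = s.view.root s.view.top ∧ x = s.view.root (s.view.prevb s.view.top))) ∧
        s.view.rk x ≤ s.view.rk y ∧ s₂.reg Reg.b = x ∧ s₂.reg Reg.c = y ∧
        s₂.reg Reg.d = s.view.rk x ∧ s₂.reg Reg.e = s.view.rk y := by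
    apply Ends.cond
    · intro hb
      apply Ends.block
      simp only [Test.Holds] at hb
      rw [hd₁, he₁] at hb
      refine ⟨by simp, ?_, ?_, _, _, .inr ⟨rfl, rfl⟩, hb.le, ?_, ?_, ?_, ?_⟩
      · rw [← hv₁]; simp [execs, Instr.apply, State.view]
      · rw [← ha₁]; simp [execs, Instr.apply]
      · rw [← hc₁]; simp [execs, Instr.apply]
      · rw [← hb₁]; simp [execs, Instr.apply]
      · rw [← he₁]; simp [execs, Instr.apply]
      · rw [← hd₁]; simp [execs, Instr.apply]
    · intro hb
      apply Ends.skip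
      simp only [Test.Holds] at hb
      rw [hd₁, he₁] at hb
      exact ⟨by simp, hv₁, ha₁, _, _, .inl ⟨rfl, rfl⟩, Nat.not_lt.1 hb, hb₁, hc₁, hd₁, he₁⟩
  refine hmid.mono ?_
  rintro s₂ t₂ ⟨ht₂, hv₂, ha₂, x, y, hxy, hrk, hb₂, hc₂, hd₂, he₂⟩
  apply Ends.seq
  apply Ends.block
  set s₃ := execs s₂ [Instr.store Arr.par Reg.b Reg.c] with hs₃
  have hv₃ : s₃.view = { s.view with par := Function.update s.view.par x y } := by
    have : s₃.view = { s₂.view with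
        par := Function.update s₂.view.par (s₂.reg Reg.b) (s₂.reg Reg.c) } := by
      simp [hs₃, execs, Instr.apply, State.view]
    rw [this, hv₂, hb₂, hc₂]
  have hreg₃ : s₃.reg = s₂.reg := by simp [hs₃, execs, Instr.apply]
  clear_value s₃
  apply Ends.seq
  have hmid' : Ends (.cond (.eq Reg.d Reg.e) (block [.inc Reg.e, .store Arr.rk Reg.c Reg.e]) .skip)
      s₃ fun s₄ t => t ≤ 3 ∧ s₄.reg Reg.a = s.view.prevb s.view.top ∧ s₄.reg Reg.c = y ∧
        ∃ rk : ℕ → ℕ, s₄.view = { s₃.view with rk := rk } ∧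
          (∀ v, v ≠ y → rk v = s.view.rk v) ∧
          rk y = if s.view.rk x = s.view.rk y then s.view.rk y + 1 else s.view.rk y := by
    apply Ends.cond
    · intro hb
      apply Ends.block
      simp only [Test.Holds] at hb
      rw [hreg₃, hd₂, he₂] at hb
      refine ⟨by simp, ?_, ?_, Function.update s.view.rk y (s.view.rk y + 1), ?_, ?_, ?_⟩
      · rw [← ha₂, ← hreg₃]; simp [execs, Instr.apply]
      · rw [← hc₂, ← hreg₃]; simp [execs, Instr.apply]
      · have h1 : s₃.view.rk = s.view.rk := by rw [hv₃]
        rw [← h1]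
        have h2 : s₃.view.rk y = s₃.reg Reg.e := by rw [h1, hreg₃, he₂]
        rw [h2, ← hc₂, ← hreg₃]
        simp [execs, Instr.apply, State.view]
      · exact fun v hv => Function.update_of_ne hv _ _
      · rw [if_pos hb, Function.update_self]
    · intro hb
      apply Ends.skip
      simp only [Test.Holds] at hb
      rw [hreg₃, hd₂, he₂] at hb
      refine ⟨by simp, by rw [hreg₃, ha₂], by rw [hreg₃, hc₂], s.view.rk, ?_, fun _ _ => rfl,
        by rw [if_neg hb]⟩
      rw [hv₃]
  refine hmid'.mono ?_
  rintro s₄ t₄ ⟨ht₄, ha₄, hc₄, rk, hv₄, hrk', hrky⟩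
  apply Ends.block
  set s₅ := execs s₄ [Instr.store Arr.root Reg.a Reg.c, Instr.store Arr.low Reg.c Reg.a,
    Instr.copy Reg.top Reg.a] with hs₅
  have hv₅ : s₅.view = { s₄.view with
      root := Function.update s₄.view.root (s₄.reg Reg.a) (s₄.reg Reg.c)
      low := Function.update s₄.view.low (s₄.reg Reg.c) (s₄.reg Reg.a)
      top := s₄.reg Reg.a } := by
    simp [hs₅, execs, Instr.apply, State.view]
  rw [ha₄, hc₄, hv₄, hv₃] at hv₅
  obtain ⟨hinv, hpot⟩ := h.merge hbl hw hreach hlive hpos hpend hxy hrk hrk' hrky K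
  refine ⟨_, by rw [hv₅]; exact hinv, ?_⟩
  rw [hv₅]
  simp only [searchPotential, hlen₁, List.length_cons, List.length_nil]
  omega

/-- If there is nothing left to explore from the top interval, it is a minimal component. -/
theorem ends_output (h : SearchInv D ol s.view G) (hbl : s.view.base < s.view.len)
    (hrest : G.rest = []) (hpend : s.view.pend s.view.top = 0)
    (hwl : s.view.wl ≤ s.view.wb s.view.top)
    (hz : D.z ≠ 0 → s.view.top ≤ s.view.pos (D.z - 1)) :
    Ends outputProg s fun s' t => ∃ G', SearchInv D ol s'.view G' ∧
      t + 30 + searchPotential D K s'.view G' ≤ searchPotential D K s.view G := by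
  obtain ⟨ht1, ht2, ht3⟩ := h.lo_top hbl
  set k := s.view.len + 1 - s.view.top with hk
  apply Ends.seq
  apply Ends.block
  set is₁ := [Instr.copy Reg.a Reg.op, Instr.inc Reg.op, Instr.copy Reg.b Reg.top,
    Instr.const Reg.c 0] with his₁
  have hlen₁ : is₁.length = 4 := rfl
  set s₁ := execs s is₁ with hs₁
  have hv₁ : s₁.view = { s.view with op := s.view.op + 1 } := by
    simp [hs₁, his₁, execs, Instr.apply, State.view]
  have ha₁ : s₁.reg Reg.a = s.view.op := by simp [hs₁, his₁, execs, Instr.apply, State.view]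
  have hb₁ : s₁.reg Reg.b = s.view.top := by simp [hs₁, his₁, execs, Instr.apply, State.view]
  have hc₁ : s₁.reg Reg.c = 0 := by simp [hs₁, his₁, execs, Instr.apply]
  clear_value s₁ is₁
  apply Ends.seq
  refine (Ends.loop (fun s' d => ∃ j ≤ k, ∃ out, d = 6 * (k - j) ∧
    s'.view = { s.view with op := s.view.op + 1 + j, out := out } ∧
      s'.reg Reg.a = s.view.op ∧ s'.reg Reg.b = s.view.top + j ∧ s'.reg Reg.c = j ∧
      (∀ i < s.view.op, out i = s.view.out i) ∧
      (∀ i < j, out (s.view.op + 1 + i) = s.view.stk (s.view.top + i))) ?_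
    (d := 6 * k) ⟨0, Nat.zero_le _, s.view.out, rfl, hv₁, ha₁, hb₁, hc₁,
      fun _ _ => rfl, fun _ hi => absurd hi (Nat.not_lt_zero _)⟩).mono ?_
  · rintro s' d ⟨j, hj, out, rfl, hv, ha, hb, hc, ho, ho'⟩ htest
    have hjlt : j < k := by
      simp only [Test.Holds] at htest
      have : s'.reg Reg.len = s'.view.len := rfl
      rw [hb, this, hv] at htest
      dsimp only at htest
      omega
    apply Ends.block
    set s₂ := execs s' [Instr.load Reg.d Arr.stk Reg.b, Instr.store Arr.out Reg.op Reg.d,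
      Instr.inc Reg.op, Instr.inc Reg.c, Instr.inc Reg.b] with hs₂
    have hv₂ : s₂.view = { s'.view with
        op := s'.view.op + 1
        out := Function.update s'.view.out s'.view.op (s'.view.stk (s'.reg Reg.b)) } := by
      simp [hs₂, execs, Instr.apply, State.view]
    rw [hv, hb] at hv₂
    dsimp only at hv₂
    refine ⟨6 * (k - (j + 1)), ⟨j + 1, hjlt, _, rfl, hv₂, ?_, ?_, ?_, ?_, ?_⟩, ?_⟩
    · have : s₂.reg Reg.a = s'.reg Reg.a := by simp [hs₂, execs, Instr.apply]
      rw [this, ha]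
    · have : s₂.reg Reg.b = s'.reg Reg.b + 1 := by simp [hs₂, execs, Instr.apply]
      rw [this, hb]; ring
    · have : s₂.reg Reg.c = s'.reg Reg.c + 1 := by simp [hs₂, execs, Instr.apply]
      rw [this, hc]
    · intro i hi
      rw [Function.update_of_ne (by omega)]
      exact ho i hi
    · intro i hi
      rcases Nat.lt_succ_iff_lt_or_eq.1 hi with hi | rfl
      · rw [Function.update_of_ne (by omega)]
        exact ho' i hi
      · rw [Function.update_self]
    · simp only [List.length_cons, List.length_nil]
      omega
  · rintro s' t ⟨d, ⟨j, hj, out, rfl, hv, ha, hb, hc, ho, ho'⟩, htest, ht⟩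
    have hjeq : j = k := by
      simp only [Test.Holds] at htest
      have : s'.reg Reg.len = s'.view.len := rfl
      rw [hb, this, hv] at htest
      dsimp only at htest
      omega
    subst hjeq
    apply Ends.block
    set s₂ := execs s' [Instr.store Arr.out Reg.a Reg.c, Instr.inc Reg.cc,
      Instr.copy Reg.base Reg.len] with hs₂
    have hv₂ : s₂.view = { s'.view with
        cc := s'.view.cc + 1
        base := s'.view.len
        out := Function.update s'.view.out (s'.reg Reg.a) (s'.reg Reg.c) } := by
      simp [hs₂, execs, Instr.apply, State.view]
    rw [hv, ha, hc] at hv₂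
    have hout := h.outInv_of_closed hbl hrest hpend hwl hz (out := Function.update out s.view.op k)
      (fun i hi => by rw [Function.update_of_ne (by omega)]; exact ho i hi)
      (by rw [Function.update_self])
      (fun i hi => by rw [Function.update_of_ne (by omega)]; exact ho' i hi)
    refine ⟨_, by rw [hv₂]; exact h.kill hrest hout, ?_⟩
    rw [hv₂]
    simp only [searchPotential, hlen₁, List.length_cons, List.length_nil]
    omega

/-- The node chosen is the last one on the work stack if the segment of the top interval is
nonempty; otherwise it is `z - 1` if there is one, and a node of the top interval if not. -/
theorem ends_choose (h : SearchInv D ol s.view G) (hbl : s.view.base < s.view.len)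
    (hf : s.reg Reg.f = 0) :
    Ends chooseProg s fun s' t => t ≤ 6 ∧ s'.view = s.view ∧ s'.reg Reg.f = 0 ∧
      s'.reg Reg.g = s.view.wb s.view.top ∧ s'.reg Reg.h < D.n ∧
      D.Reach (s.view.stk s.view.top) (s'.reg Reg.h) ∧
      (s.view.wb s.view.top < s.view.wl → s'.reg Reg.h = s.view.work (s.view.wl - 1)) ∧
      (s.view.wl ≤ s.view.wb s.view.top → D.z ≠ 0 → s'.reg Reg.h = D.z - 1) := by
  obtain ⟨ht1, ht2, ht3⟩ := h.lo_top hbl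
  have htn : s.view.stk s.view.top < D.n := h.stack.stk_lt _ (by omega) ht2
  have hz : s.view.z = D.z := h.static.z_eq
  apply Ends.seq
  apply Ends.block
  set s₁ := execs s [Instr.load Reg.g Arr.wb Reg.top] with hs₁
  have hv₁ : s₁.view = s.view := by simp [hs₁, execs, Instr.apply, State.view]
  have hg₁ : s₁.reg Reg.g = s.view.wb s.view.top := by
    simp [hs₁, execs, Instr.apply, State.view]
  have hf₁ : s₁.reg Reg.f = 0 := by rw [← hf]; simp [hs₁, execs, Instr.apply]
  clear_value s₁
  have hwl₁ : s₁.reg Reg.wl = s.view.wl := by rw [← hv₁]; rfl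
  apply Ends.cond
  · intro hb
    simp only [Test.Holds] at hb
    rw [hg₁, hwl₁] at hb
    apply Ends.block
    set s₂ := execs s₁ [Instr.copy Reg.h Reg.wl, Instr.dec Reg.h,
      Instr.load Reg.h Arr.work Reg.h] with hs₂
    have hh : s₂.reg Reg.h = s.view.work (s.view.wl - 1) := by
      rw [← hv₁]; simp [hs₂, execs, Instr.apply, State.view]
    obtain ⟨h1, h2⟩ := h.workInv.reach _ ht1 ht2 ht3 (s.view.wl - 1) (by omega) (by omega)
    refine ⟨by simp, ?_, ?_, ?_, by rwa [hh], by rwa [hh], fun _ => hh, fun h3 => by omega⟩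
    · rw [← hv₁]; simp [hs₂, execs, Instr.apply, State.view]
    · rw [← hf₁]; simp [hs₂, execs, Instr.apply]
    · rw [← hg₁]; simp [hs₂, execs, Instr.apply]
  · intro hb
    simp only [Test.Holds] at hb
    rw [hg₁, hwl₁] at hb
    have hz₁ : s₁.reg Reg.z = D.z := by rw [← hz, ← hv₁]; rfl
    apply Ends.cond
    · intro hb'
      simp only [Test.Holds] at hb'
      rw [hz₁, hf₁] at hb'
      apply Ends.block
      set s₂ := execs s₁ [Instr.load Reg.h Arr.stk Reg.top] with hs₂
      have hh : s₂.reg Reg.h = s.view.stk s.view.top := by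
        rw [← hv₁]; simp [hs₂, execs, Instr.apply, State.view]
      refine ⟨by simp, ?_, ?_, ?_, by rwa [hh], by rw [hh]; exact D.refl _ htn,
        fun h3 => by omega, fun _ h3 => absurd hb' h3⟩
      · rw [← hv₁]; simp [hs₂, execs, Instr.apply, State.view]
      · rw [← hf₁]; simp [hs₂, execs, Instr.apply]
      · rw [← hg₁]; simp [hs₂, execs, Instr.apply]
    · intro hb'
      simp only [Test.Holds] at hb'
      rw [hz₁, hf₁] at hb'
      apply Ends.block
      set s₂ := execs s₁ [Instr.copy Reg.h Reg.z, Instr.dec Reg.h] with hs₂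
      have hh : s₂.reg Reg.h = D.z - 1 := by
        rw [← hz₁]; simp [hs₂, execs, Instr.apply]
      refine ⟨by simp, ?_, ?_, ?_, by rw [hh]; exact D.z_lt hb', by
        rw [hh]; exact D.z_reach hb' _ htn, fun h3 => by omega, fun _ _ => hh⟩
      · rw [← hv₁]; simp [hs₂, execs, Instr.apply, State.view]
      · rw [← hf₁]; simp [hs₂, execs, Instr.apply]
      · rw [← hg₁]; simp [hs₂, execs, Instr.apply]

theorem ends_explore (h : SearchInv D ol s.view G) (hbl : s.view.base < s.view.len)
    (hrest : G.rest = []) (hpend : s.view.pend s.view.top = 0) (hf : s.reg Reg.f = 0) :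
    Ends exploreProg s fun s' t => ∃ G', SearchInv D ol s'.view G' ∧
      t + 8 + searchPotential D K s'.view G' ≤ searchPotential D K s.view G := by
  apply Ends.seq
  refine (ends_choose h hbl hf).mono ?_
  rintro s₁ t₁ ⟨ht₁, hv₁, hf₁, hg₁, hn, hreach, hwork, hz⟩
  apply Ends.seq
  apply Ends.block
  set s₂ := execs s₁ [Instr.load Reg.b Arr.pos Reg.h] with hs₂
  have hv₂ : s₂.view = s.view := by rw [← hv₁]; simp [hs₂, execs, Instr.apply, State.view]
  have hh₂ : s₂.reg Reg.h = s₁.reg Reg.h := by simp [hs₂, execs, Instr.apply]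
  have hg₂ : s₂.reg Reg.g = s.view.wb s.view.top := by
    rw [← hg₁]; simp [hs₂, execs, Instr.apply]
  have hf₂ : s₂.reg Reg.f = 0 := by rw [← hf₁]; simp [hs₂, execs, Instr.apply]
  have hb₂ : s₂.reg Reg.b = s.view.pos (s₁.reg Reg.h) := by
    rw [← hv₁]; simp [hs₂, execs, Instr.apply, State.view]
  clear_value s₂
  generalize s₁.reg Reg.h = w at *
  simp only [List.length_cons, List.length_nil]
  have hbase₂ : s₂.reg Reg.base = s.view.base := by rw [← hv₂]; rfl
  have htop₂ : s₂.reg Reg.top = s.view.top := by rw [← hv₂]; rfl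
  have hwl₂ : s₂.reg Reg.wl = s.view.wl := by rw [← hv₂]; rfl
  have hfin : ∀ {p : Program} {c : ℕ}, c ≤ 14 → Ends p s₂ (fun s' t =>
      ∃ G', SearchInv D ol s'.view G' ∧
        t + 30 + searchPotential D K s'.view G' ≤ searchPotential D K s.view G) →
      Ends p s₂ (fun s' t => ∃ G', SearchInv D ol s'.view G' ∧
        t₁ + (0 + 1 + (t + c)) + 8 + searchPotential D K s'.view G' ≤
          searchPotential D K s.view G) := by
    intro p c hc hp
    refine hp.mono ?_
    rintro s' t ⟨G', h1, h2⟩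
    exact ⟨G', h1, by omega⟩
  apply Ends.cond
  · intro hb
    simp only [Test.Holds] at hb
    rw [hb₂, hf₂] at hb
    refine hfin (by omega) ?_
    rw [← hv₂] at h hb hreach ⊢
    exact ends_push h Reg.h (by decide) (by decide) (by rwa [hh₂]) (by rwa [hh₂]) hrest
      (fun _ => by rwa [hh₂])
  · intro hb
    simp only [Test.Holds] at hb
    rw [hb₂, hf₂] at hb
    apply Ends.cond
    · intro hb'
      simp only [Test.Holds] at hb'
      rw [hb₂, hbase₂] at hb'
      refine hfin (c := 1 + 1) (by omega) ?_
      apply Ends.block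
      have hv₃ : (execs s₂ [Instr.copy Reg.base Reg.len]).view =
          { s.view with base := s.view.len } := by
        rw [← hv₂]; simp [execs, Instr.apply, State.view]
      refine ⟨_, by rw [hv₃]; exact h.kill hrest (h.outInv_of_dead hbl hn hreach hb hb'), ?_⟩
      rw [hv₃]
      simp only [searchPotential, List.length_cons, List.length_nil]
      omega
    · intro hb'
      simp only [Test.Holds] at hb'
      rw [hb₂, hbase₂] at hb'
      apply Ends.cond
      · intro hb''
        simp only [Test.Holds] at hb''
        rw [hb₂, htop₂] at hb''
        refine hfin (c := 1 + 1 + 1) (by omega) ?_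
        rw [← hv₂] at h hbl hreach hb' hb'' hpend ⊢
        exact ends_merge h hbl hn hreach (by omega) hb'' hpend
      · intro hb''
        simp only [Test.Holds] at hb''
        rw [hb₂, htop₂] at hb''
        apply Ends.cond
        · intro hb₄
          simp only [Test.Holds] at hb₄
          rw [hg₂, hwl₂] at hb₄
          apply Ends.block
          have hv₃ : (execs s₂ [Instr.dec Reg.wl]).view =
              { s.view with wl := s.view.wl - 1 } := by
            rw [← hv₂]; simp [execs, Instr.apply, State.view]
          refine ⟨_, by
            rw [hv₃]; exact h.pop hbl hb₄ (by rw [← hwork hb₄]; omega), ?_⟩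
          rw [hv₃]
          simp only [searchPotential, List.length_cons, List.length_nil]
          omega
        · intro hb₄
          simp only [Test.Holds] at hb₄
          rw [hg₂, hwl₂] at hb₄
          refine hfin (c := 1 + 1 + 1 + 1) (by omega) ?_
          rw [← hv₂] at h hbl hb'' hpend hb₄ hz ⊢
          exact ends_output h hbl hrest hpend (by omega)
            (fun h0 => by rw [← hz (by omega) h0]; omega)

theorem ends_body (hK : D.n < ack K 1) (h : SearchInv D ol s.view G) (hcur : s.view.cur < D.n) :
    Ends bodyProg s fun s' t => ∃ G', SearchInv D ol s'.view G' ∧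
      t + 1 + searchPotential D K s'.view G' ≤ searchPotential D K s.view G := by
  apply Ends.seq
  apply Ends.block
  set s₁ := execs s [Instr.const Reg.f 0] with hs₁
  have hv₁ : s₁.view = s.view := by simp [hs₁, execs, Instr.apply, State.view]
  have hf₁ : s₁.reg Reg.f = 0 := by simp [hs₁, execs, Instr.apply]
  clear_value s₁
  rw [← hv₁] at h hcur ⊢
  clear hv₁
  simp only [List.length_cons, List.length_nil]
  have hbase : s₁.reg Reg.base = s₁.view.base := rfl
  have hlen : s₁.reg Reg.len = s₁.view.len := rfl
  have hocc : s₁.reg Reg.occ = s₁.view.occ := rfl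
  apply Ends.cond
  · intro hbl
    simp only [Test.Holds] at hbl
    rw [hbase, hlen] at hbl
    apply Ends.cond
    · intro hb
      simp only [Test.Holds] at hb
      rw [hocc, hf₁] at hb
      refine (ends_slot hK h hb).mono ?_
      rintro s' t ⟨G', h1, h2⟩
      exact ⟨G', h1, by omega⟩
    · intro hb
      simp only [Test.Holds, not_not] at hb
      rw [hocc, hf₁] at hb
      have hrest : G.rest = [] := by
        have := h.occInv.chain
        rw [hb] at this
        exact this.eq_nil
      apply Ends.seq
      apply Ends.block
      set s₂ := execs s₁ [Instr.load Reg.a Arr.pend Reg.top] with hs₂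
      have hv₂ : s₂.view = s₁.view := by simp [hs₂, execs, Instr.apply, State.view]
      have ha₂ : s₂.reg Reg.a = s₁.view.pend s₁.view.top := by
        simp [hs₂, execs, Instr.apply, State.view]
      have hf₂ : s₂.reg Reg.f = 0 := by rw [← hf₁]; simp [hs₂, execs, Instr.apply]
      clear_value s₂
      rw [← hv₂] at h hbl ha₂ ⊢
      simp only [List.length_cons, List.length_nil]
      apply Ends.cond
      · intro hb'
        simp only [Test.Holds] at hb'
        rw [hf₂, ha₂] at hb'
        refine (ends_activate (K := K) h hbl ha₂ hb').mono ?_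
        rintro s' t ⟨G', h1, h2⟩
        exact ⟨G', h1, by omega⟩
      · intro hb'
        simp only [Test.Holds, not_not] at hb'
        rw [hf₂, ha₂] at hb'
        refine (ends_explore (K := K) h hbl hrest hb' hf₂).mono ?_
        rintro s' t ⟨G', h1, h2⟩
        exact ⟨G', h1, by omega⟩
  · intro hbl
    simp only [Test.Holds] at hbl
    rw [hbase, hlen] at hbl
    have hrest := h.occInv.rest_nil (le_antisymm h.interval.base_le (Nat.not_lt.1 hbl))
    apply Ends.seq
    apply Ends.block
    set s₂ := execs s₁ [Instr.load Reg.a Arr.pos Reg.cur] with hs₂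
    have hv₂ : s₂.view = s₁.view := by simp [hs₂, execs, Instr.apply, State.view]
    have ha₂ : s₂.reg Reg.a = s₁.view.pos s₁.view.cur := by
      simp [hs₂, execs, Instr.apply, State.view]
    have hf₂ : s₂.reg Reg.f = 0 := by rw [← hf₁]; simp [hs₂, execs, Instr.apply]
    clear_value s₂
    rw [← hv₂] at h hbl ha₂ hcur ⊢
    simp only [List.length_cons, List.length_nil]
    apply Ends.cond
    · intro hb
      simp only [Test.Holds] at hb
      rw [ha₂, hf₂] at hb
      refine (ends_push (K := K) h Reg.cur (by decide) (by decide) hcur hb hrest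
        (fun h0 => absurd h0 hbl)).mono ?_
      rintro s' t ⟨G', h1, h2⟩
      exact ⟨G', h1, by omega⟩
    · intro hb
      simp only [Test.Holds] at hb
      rw [ha₂, hf₂] at hb
      apply Ends.block
      have hv₃ : (execs s₂ [Instr.inc Reg.cur]).view =
          { s₂.view with cur := s₂.view.cur + 1 } := by
        simp [execs, Instr.apply, State.view]
      have hbase' := le_antisymm h.interval.base_le (Nat.not_lt.1 hbl)
      refine ⟨G, by rw [hv₃]; exact h.next hcur hb hbase', ?_⟩
      rw [hv₃]
      simp only [searchPotential, List.length_cons, List.length_nil]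
      omega

/-- The search ends within its potential, and the invariant then describes the output. -/
theorem ends_search (hK : D.n < ack K 1) (h : SearchInv D ol s.view G) :
    Ends searchProg s fun s' t => ∃ G', SearchInv D ol s'.view G' ∧ D.n ≤ s'.view.cur ∧
      t ≤ searchPotential D K s.view G + 1 := by
  refine (Ends.loop (fun s' d => ∃ G', SearchInv D ol s'.view G' ∧
    d = searchPotential D K s'.view G') ?_ ⟨G, h, rfl⟩).mono ?_
  · rintro s' d ⟨G', h', rfl⟩ hb
    simp only [Test.Holds] at hb
    have hn : s'.reg Reg.n = D.n := h'.static.n_eq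
    rw [hn] at hb
    refine (ends_body hK h' hb).mono ?_
    rintro s'' t ⟨G'', h1, h2⟩
    exact ⟨_, ⟨G'', h1, rfl⟩, h2⟩
  · rintro s' t ⟨d, ⟨G', h', rfl⟩, hb, ht⟩
    simp only [Test.Holds] at hb
    have hn : s'.reg Reg.n = D.n := h'.static.n_eq
    rw [hn] at hb
    exact ⟨G', h', Nat.not_lt.1 hb, by omega⟩

end RAM

/-! ### Reading the input -/

/-- The position of the length of the tail of hyperedge number `e` (from `0` on) in the input
array `a`. -/
def tailPos (a : ℕ → ℕ) : ℕ → ℕ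
  | 0 => 2
  | e + 1 => tailPos a e + 1 + a (tailPos a e) + 1 + a (tailPos a e + 1 + a (tailPos a e))

/-- The position of the length of the head of hyperedge number `e` in the input array `a`. -/
def headPos (a : ℕ → ℕ) (e : ℕ) : ℕ := tailPos a e + 1 + a (tailPos a e)

theorem tailPos_succ (a : ℕ → ℕ) (e : ℕ) :
    tailPos a (e + 1) = headPos a e + 1 + a (headPos a e) := rfl

/-- If one of the first `e` hyperedges has an empty tail and a nonempty head, then the first
element of the head of the first such hyperedge, plus `1`; otherwise `0`. -/
def zMark (a : ℕ → ℕ) : ℕ → ℕ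
  | 0 => 0
  | e + 1 => if zMark a e = 0 ∧ a (tailPos a e) = 0 ∧ a (headPos a e) ≠ 0 then
      a (headPos a e + 1) + 1 else zMark a e

/-- The tail of the hyperedge `t` (from `1` on), where an empty tail is replaced by the node given
by `zMark` if the head is nonempty. -/
def tailSet (a : ℕ → ℕ) (t : ℕ) : Finset ℕ :=
  if a (tailPos a (t - 1)) = 0 then
    if a (headPos a (t - 1)) = 0 then ∅ else {zMark a t - 1}
  else (Finset.range (a (tailPos a (t - 1)))).image fun i => a (tailPos a (t - 1) + 1 + i)

/-- The head of the hyperedge `t` (from `1` on). -/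
def headSet (a : ℕ → ℕ) (t : ℕ) : Finset ℕ :=
  (Finset.range (a (headPos a (t - 1)))).image fun i => a (headPos a (t - 1) + 1 + i)

/-- Linked lists `ol v` of slots below `bound` such that the slots of `v` name the hyperedges `t`
with `v ∈ T t`, each once. -/
structure OccTable (T : ℕ → Finset ℕ) (bound : ℕ) (occh nexto edgeof : ℕ → ℕ)
    (ol : ℕ → List ℕ) : Prop where
  chain : ∀ v, Chain nexto (occh v) (ol v)
  lt : ∀ v, ∀ x ∈ ol v, x < bound
  nodup : ∀ v, ((ol v).map edgeof).Nodup
  mem_iff : ∀ v t, t ∈ (ol v).map edgeof ↔ v ∈ T t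

/-- The node `v` is added to the tail of `t`, in the slot `x`. -/
theorem OccTable.insert {T T' : ℕ → Finset ℕ} {bound : ℕ} {occh nexto edgeof : ℕ → ℕ}
    {ol : ℕ → List ℕ} (h : OccTable T bound occh nexto edgeof ol) {x v t : ℕ} (hx : bound ≤ x)
    (hx0 : x ≠ 0) (hv : v ∉ T t) (hT : T' t = Insert.insert v (T t))
    (hT' : ∀ t', t' ≠ t → T' t' = T t') :
    OccTable T' (x + 1) (Function.update occh v x) (Function.update nexto x (occh v))
      (Function.update edgeof x t) (Function.update ol v (x :: ol v)) := by
  have hnot : ∀ u, x ∉ ol u := fun u hu => absurd (h.lt u x hu) (by omega)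
  have hmap : ∀ u, (ol u).map (Function.update edgeof x t) = (ol u).map edgeof := by
    intro u
    refine List.map_congr_left fun y hy => Function.update_of_ne ?_ _ _
    rintro rfl
    exact hnot u hy
  refine ⟨?_, ?_, ?_, ?_⟩
  · intro u
    by_cases hu : u = v
    · subst hu
      rw [Function.update_self, Function.update_self]
      refine ⟨rfl, hx0, ?_⟩
      rw [Function.update_self]
      exact (h.chain u).update _ (hnot u)
    · rw [Function.update_of_ne hu, Function.update_of_ne hu]
      exact (h.chain u).update _ (hnot u)
  · intro u y hy
    by_cases hu : u = v
    · subst hu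
      rw [Function.update_self, List.mem_cons] at hy
      rcases hy with rfl | hy
      · omega
      · have := h.lt u y hy; omega
    · rw [Function.update_of_ne hu] at hy
      have := h.lt u y hy; omega
  · intro u
    by_cases hu : u = v
    · subst hu
      rw [Function.update_self, List.map_cons, hmap, Function.update_self, List.nodup_cons,
        h.mem_iff]
      exact ⟨hv, h.nodup u⟩
    · rw [Function.update_of_ne hu, hmap]
      exact h.nodup u
  · intro u t'
    by_cases hu : u = v
    · subst hu
      rw [Function.update_self, List.map_cons, hmap, Function.update_self, List.mem_cons,
        h.mem_iff]
      by_cases ht : t' = t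
      · subst ht; simp [hT]
      · simp [ht, hT' t' ht]
    · rw [Function.update_of_ne hu, hmap, h.mem_iff]
      by_cases ht : t' = t
      · subst ht; simp [hT, hu]
      · rw [hT' t' ht]

theorem OccTable.congr {T T' : ℕ → Finset ℕ} {bound bound' : ℕ} {occh nexto edgeof : ℕ → ℕ}
    {ol : ℕ → List ℕ} (h : OccTable T bound occh nexto edgeof ol) (hT : ∀ t, T' t = T t)
    (hb : bound ≤ bound') : OccTable T' bound' occh nexto edgeof ol :=
  ⟨h.chain, fun v x hx => (h.lt v x hx).trans_le hb, h.nodup,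
    fun v t => by rw [h.mem_iff, hT]⟩

/-- The tails of the hyperedges `1, …, e`, and empty sets after them. -/
def stageTails (a : ℕ → ℕ) (e t : ℕ) : Finset ℕ :=
  if 1 ≤ t ∧ t ≤ e then tailSet a t else ∅

/-- The memory `M` after the first `e` hyperedges have been read, `M₀` being the initial memory. -/
structure ParseInv (a : ℕ → ℕ) (M₀ M : Memory) (e : ℕ) (ol : ℕ → List ℕ) : Prop where
  frame : M = { M₀ with
    n := a 0
    op := 1
    z := zMark a e
    cnt := M.cnt
    hp := M.hp
    occh := M.occh
    nexto := M.nexto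
    edgeof := M.edgeof }
  table : OccTable (stageTails a e) (tailPos a e) M.occh M.nexto M.edgeof ol
  cnt_eq : ∀ t, 1 ≤ t → t ≤ e → M.cnt t = (tailSet a t).card
  cnt_zero : ∀ t, e < t → M.cnt t = 0
  hp_eq : ∀ t, 1 ≤ t → t ≤ e → M.hp t = headPos a (t - 1)

theorem two_le_tailPos (a : ℕ → ℕ) (e : ℕ) : 2 ≤ tailPos a e := by
  induction e with
  | zero => exact le_rfl
  | succ e ih => rw [tailPos_succ, headPos]; omega

namespace RAM

/-- The tail of length `d = 0` at position `a` is read. -/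
def emptyTailProg : Program :=
  .seq (block [.copy Reg.f Reg.a, .inc Reg.f, .load Reg.g Arr.inp Reg.f])
    (.cond (.ne Reg.g Reg.e)
      (.seq
        (.cond (.eq Reg.z Reg.e)
          (block [.copy Reg.z Reg.f, .inc Reg.z, .load Reg.z Arr.inp Reg.z, .inc Reg.z]) .skip)
        (block [.copy Reg.f Reg.z, .dec Reg.f, .load Reg.g Arr.occh Reg.f,
          .store Arr.nexto Reg.a Reg.g, .store Arr.occh Reg.f Reg.a,
          .store Arr.edgeof Reg.a Reg.b, .const Reg.h 1, .store Arr.cnt Reg.b Reg.h]))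
      .skip)

/-- The tail of length `d > 0` at position `a` is read. -/
def tailProg : Program :=
  .seq (block [.store Arr.cnt Reg.b Reg.d])
    (.loop (.lt Reg.e Reg.d)
      (block [.inc Reg.a, .inc Reg.e, .load Reg.f Arr.inp Reg.a, .load Reg.g Arr.occh Reg.f,
        .store Arr.nexto Reg.a Reg.g, .store Arr.occh Reg.f Reg.a,
        .store Arr.edgeof Reg.a Reg.b]))

/-- The position of the head is recorded, and the head is skipped. -/
def headProg : Program :=
  .seq (block [.inc Reg.a, .store Arr.hp Reg.b Reg.a, .load Reg.d Arr.inp Reg.a, .const Reg.e 0])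
    (.seq (.loop (.lt Reg.e Reg.d) (block [.inc Reg.a, .inc Reg.e])) (block [.inc Reg.a]))

/-- The hyperedge at position `a` is read. -/
def readEdgeProg : Program :=
  .seq (block [.inc Reg.b, .load Reg.d Arr.inp Reg.a, .const Reg.e 0])
    (.seq (.cond (.eq Reg.d Reg.e) emptyTailProg tailProg) headProg)

/-- The input is read. -/
def parseProg : Program :=
  .seq (block [.const Reg.f 0, .load Reg.n Arr.inp Reg.f, .inc Reg.f, .load Reg.c Arr.inp Reg.f,
      .const Reg.a 2, .const Reg.op 1])
    (.loop (.lt Reg.b Reg.c) readEdgeProg)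

/-- The tail of hyperedge number `e` has been read. -/
structure TailRead (a : ℕ → ℕ) (M₀ M : Memory) (e : ℕ) (ol : ℕ → List ℕ) : Prop where
  frame : M = { M₀ with
    n := a 0
    op := 1
    z := zMark a (e + 1)
    cnt := M.cnt
    hp := M.hp
    occh := M.occh
    nexto := M.nexto
    edgeof := M.edgeof }
  table : OccTable (stageTails a (e + 1)) (headPos a e) M.occh M.nexto M.edgeof ol
  cnt_eq : ∀ t, 1 ≤ t → t ≤ e + 1 → M.cnt t = (tailSet a t).card
  cnt_zero : ∀ t, e + 1 < t → M.cnt t = 0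
  hp_eq : ∀ t, 1 ≤ t → t ≤ e → M.hp t = headPos a (t - 1)

variable {a : ℕ → ℕ} {M₀ : Memory} {s : State} {e : ℕ} {ol : ℕ → List ℕ}

theorem stageTails_of_ne {e t : ℕ} (ht : t ≠ e + 1) :
    stageTails a (e + 1) t = stageTails a e t := by
  unfold stageTails
  by_cases h : 1 ≤ t ∧ t ≤ e
  · rw [if_pos h, if_pos ⟨h.1, by omega⟩]
  · rw [if_neg h, if_neg (by omega)]

theorem stageTails_self (e : ℕ) : stageTails a (e + 1) (e + 1) = tailSet a (e + 1) := by
  rw [stageTails, if_pos ⟨by omega, le_rfl⟩]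

theorem stageTails_succ_self (e : ℕ) : stageTails a e (e + 1) = ∅ := by
  rw [stageTails, if_neg (by omega)]

theorem ends_emptyTail (hinp : M₀.inp = a) (h : ParseInv a M₀ s.view e ol)
    (ha : s.reg Reg.a = tailPos a e) (hb : s.reg Reg.b = e + 1) (he : s.reg Reg.e = 0)
    (htail : a (tailPos a e) = 0) :
    Ends emptyTailProg s fun s' t => t ≤ 20 ∧ (∃ ol, TailRead a M₀ s'.view e ol) ∧
      s'.reg Reg.a + 1 = headPos a e ∧ s'.reg Reg.b = e + 1 ∧ s'.reg Reg.c = s.reg Reg.c := by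
  have hinp' : s.view.inp = a := by rw [h.frame]; exact hinp
  have hz : s.view.z = zMark a e := by rw [h.frame]
  have hhp : headPos a e = tailPos a e + 1 := by rw [headPos, htail]
  apply Ends.seq
  apply Ends.block
  set s₁ := execs s [Instr.copy Reg.f Reg.a, Instr.inc Reg.f, Instr.load Reg.g Arr.inp Reg.f]
    with hs₁
  have hv₁ : s₁.view = s.view := by simp [hs₁, execs, Instr.apply, State.view]
  have hf₁ : s₁.reg Reg.f = headPos a e := by
    rw [hhp, ← ha]; simp [hs₁, execs, Instr.apply]
  have hg₁ : s₁.reg Reg.g = a (headPos a e) := by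
    rw [hhp, ← ha, ← hinp']; simp [hs₁, execs, Instr.apply, State.view]
  have ha₁ : s₁.reg Reg.a = tailPos a e := by rw [← ha]; simp [hs₁, execs, Instr.apply]
  have hb₁ : s₁.reg Reg.b = e + 1 := by rw [← hb]; simp [hs₁, execs, Instr.apply]
  have hc₁ : s₁.reg Reg.c = s.reg Reg.c := by simp [hs₁, execs, Instr.apply]
  have he₁ : s₁.reg Reg.e = 0 := by rw [← he]; simp [hs₁, execs, Instr.apply]
  clear_value s₁
  apply Ends.cond
  · intro htest
    simp only [Test.Holds] at htest
    rw [hg₁, he₁] at htest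
    have hts : tailSet a (e + 1) = {zMark a (e + 1) - 1} := by
      rw [tailSet, Nat.add_sub_cancel, if_pos htail, if_neg htest]
    apply Ends.seq
    have hmid : Ends (.cond (.eq Reg.z Reg.e)
        (block [.copy Reg.z Reg.f, .inc Reg.z, .load Reg.z Arr.inp Reg.z, .inc Reg.z]) .skip) s₁
        fun s₂ t => t ≤ 5 ∧ s₂.view = { s.view with z := zMark a (e + 1) } ∧
          s₂.reg Reg.a = tailPos a e ∧ s₂.reg Reg.b = e + 1 ∧ s₂.reg Reg.c = s.reg Reg.c := by
      have hz₁ : s₁.reg Reg.z = zMark a e := by rw [← hz, ← hv₁]; rfl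
      apply Ends.cond
      · intro hb'
        simp only [Test.Holds] at hb'
        rw [hz₁, he₁] at hb'
        apply Ends.block
        refine ⟨by simp, ?_, ?_, ?_, ?_⟩
        · rw [zMark, if_pos ⟨hb', htail, htest⟩, ← hf₁, ← hinp', ← hv₁]
          simp [execs, Instr.apply, State.view]
        · rw [← ha₁]; simp [execs, Instr.apply]
        · rw [← hb₁]; simp [execs, Instr.apply]
        · rw [← hc₁]; simp [execs, Instr.apply]
      · intro hb'
        simp only [Test.Holds] at hb'
        rw [hz₁, he₁] at hb'
        apply Ends.skip
        refine ⟨by simp, ?_, ha₁, hb₁, hc₁⟩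
        rw [zMark, if_neg (fun h0 => hb' h0.1), ← hz, hv₁]
    refine hmid.mono ?_
    rintro s₂ t₂ ⟨ht₂, hv₂, ha₂, hb₂, hc₂⟩
    apply Ends.block
    set s₃ := execs s₂ [Instr.copy Reg.f Reg.z, Instr.dec Reg.f, Instr.load Reg.g Arr.occh Reg.f,
          Instr.store Arr.nexto Reg.a Reg.g, Instr.store Arr.occh Reg.f Reg.a,
          Instr.store Arr.edgeof Reg.a Reg.b, Instr.const Reg.h 1,
          Instr.store Arr.cnt Reg.b Reg.h] with hs₃
    have hv₃ : s₃.view = { s₂.view with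
        nexto := Function.update s₂.view.nexto (s₂.reg Reg.a) (s₂.view.occh (s₂.view.z - 1))
        occh := Function.update s₂.view.occh (s₂.view.z - 1) (s₂.reg Reg.a)
        edgeof := Function.update s₂.view.edgeof (s₂.reg Reg.a) (s₂.reg Reg.b)
        cnt := Function.update s₂.view.cnt (s₂.reg Reg.b) 1 } := by
      simp [hs₃, execs, Instr.apply, State.view]
    rw [hv₂, ha₂, hb₂] at hv₃
    dsimp only at hv₃
    refine ⟨?_, ⟨Function.update ol (zMark a (e + 1) - 1)
      (tailPos a e :: ol (zMark a (e + 1) - 1)), ?_⟩, ?_, ?_, ?_⟩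
    · simp only [List.length_cons, List.length_nil]; omega
    · rw [hv₃]
      refine ⟨?_, ?_, ?_, ?_, h.hp_eq⟩ <;> dsimp only
      · rw [h.frame]
      · rw [hhp]
        refine h.table.insert le_rfl (by have := two_le_tailPos a e; omega)
          (t := e + 1) ?_ ?_ fun t' ht' => stageTails_of_ne ht'
        · rw [stageTails_succ_self]; simp
        · rw [stageTails_succ_self, stageTails_self, hts]; rfl
      · intro t h1 h2
        by_cases ht : t = e + 1
        · subst ht; rw [Function.update_self, hts, Finset.card_singleton]
        · rw [Function.update_of_ne ht]; exact h.cnt_eq t h1 (by omega)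
      · intro t ht
        rw [Function.update_of_ne (by omega)]; exact h.cnt_zero t (by omega)
    · rw [hhp, ← ha₂]; simp [hs₃, execs, Instr.apply]
    · rw [← hb₂]; simp [hs₃, execs, Instr.apply]
    · rw [← hc₂]; simp [hs₃, execs, Instr.apply]
  · intro htest
    simp only [Test.Holds, not_not] at htest
    rw [hg₁, he₁] at htest
    have hts : tailSet a (e + 1) = ∅ := by
      rw [tailSet, Nat.add_sub_cancel, if_pos htail, if_pos htest]
    have hzz : zMark a (e + 1) = zMark a e := by
      rw [zMark, if_neg (fun h0 => h0.2.2 htest)]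
    apply Ends.skip
    refine ⟨by simp, ⟨ol, ?_⟩, by rw [ha₁, hhp], hb₁, hc₁⟩
    rw [hv₁]
    refine ⟨by rw [hzz]; exact h.frame, ?_, ?_, fun t ht => h.cnt_zero t (by omega), h.hp_eq⟩
    · refine h.table.congr (fun t => ?_) (by omega)
      by_cases ht : t = e + 1
      · subst ht; rw [stageTails_self, stageTails_succ_self, hts]
      · exact stageTails_of_ne ht
    · intro t h1 h2
      by_cases ht : t = e + 1
      · subst ht; rw [hts, Finset.card_empty]; exact h.cnt_zero _ (by omega)
      · exact h.cnt_eq t h1 (by omega)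

theorem ends_tail (hinp : M₀.inp = a) (h : ParseInv a M₀ s.view e ol)
    (ha : s.reg Reg.a = tailPos a e) (hb : s.reg Reg.b = e + 1) (he : s.reg Reg.e = 0)
    (hd : s.reg Reg.d = a (tailPos a e)) (htail : a (tailPos a e) ≠ 0)
    (hinj : ∀ i < a (tailPos a e), ∀ j < a (tailPos a e),
      a (tailPos a e + 1 + i) = a (tailPos a e + 1 + j) → i = j) :
    Ends tailProg s fun s' t => t ≤ 8 * a (tailPos a e) + 2 ∧
      (∃ ol, TailRead a M₀ s'.view e ol) ∧
      s'.reg Reg.a + 1 = headPos a e ∧ s'.reg Reg.b = e + 1 ∧ s'.reg Reg.c = s.reg Reg.c := by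
  have hz : zMark a (e + 1) = zMark a e := by
    rw [zMark, if_neg (fun h0 => htail h0.2.1)]
  set k := a (tailPos a e) with hk
  set p := tailPos a e with hp
  have hts : tailSet a (e + 1) = (Finset.range k).image fun i => a (p + 1 + i) := by
    rw [tailSet, Nat.add_sub_cancel, if_neg htail]
  apply Ends.seq
  apply Ends.block
  set s₁ := execs s [Instr.store Arr.cnt Reg.b Reg.d] with hs₁
  have hv₁ : s₁.view = { s.view with cnt := Function.update s.view.cnt (e + 1) k } := by
    rw [← hb, ← hd]; simp [hs₁, execs, Instr.apply, State.view]
  have hreg₁ : s₁.reg = s.reg := by simp [hs₁, execs, Instr.apply]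
  clear_value s₁
  refine (Ends.loop (fun s' d => ∃ j ≤ k, ∃ occh nexto edgeof : ℕ → ℕ, ∃ ol, d = 8 * (k - j) ∧
    s'.view = { s.view with
      cnt := Function.update s.view.cnt (e + 1) k
      occh := occh
      nexto := nexto
      edgeof := edgeof } ∧
    s'.reg Reg.a = p + j ∧ s'.reg Reg.b = e + 1 ∧ s'.reg Reg.c = s.reg Reg.c ∧
    s'.reg Reg.d = k ∧ s'.reg Reg.e = j ∧
    OccTable (fun t => if t = e + 1 then (Finset.range j).image fun i => a (p + 1 + i)
      else stageTails a e t) (p + 1 + j) occh nexto edgeof ol) ?_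
    (d := 8 * k) ⟨0, Nat.zero_le _, s.view.occh, s.view.nexto, s.view.edgeof, ol, rfl, hv₁,
      by rw [hreg₁, ha]; rfl, by rw [hreg₁, hb], by rw [hreg₁], by rw [hreg₁, hd],
      by rw [hreg₁, he], ?_⟩).mono ?_
  · rintro s' d ⟨j, hj, occh, nexto, edgeof, ol', rfl, hv, ha', hb', hc', hd', he', hO⟩ htest
    have hjlt : j < k := by
      simp only [Test.Holds] at htest
      rwa [hd', he'] at htest
    have hinp' : s'.view.inp = a := by
      rw [hv]; dsimp only; rw [h.frame]; exact hinp
    apply Ends.block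
    set s₂ := execs s' [Instr.inc Reg.a, Instr.inc Reg.e, Instr.load Reg.f Arr.inp Reg.a,
        Instr.load Reg.g Arr.occh Reg.f,
        Instr.store Arr.nexto Reg.a Reg.g, Instr.store Arr.occh Reg.f Reg.a,
        Instr.store Arr.edgeof Reg.a Reg.b] with hs₂
    have hv₂ : s₂.view = { s'.view with
        nexto := Function.update s'.view.nexto (s'.reg Reg.a + 1)
          (s'.view.occh (s'.view.inp (s'.reg Reg.a + 1)))
        occh := Function.update s'.view.occh (s'.view.inp (s'.reg Reg.a + 1)) (s'.reg Reg.a + 1)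
        edgeof := Function.update s'.view.edgeof (s'.reg Reg.a + 1) (s'.reg Reg.b) } := by
      simp [hs₂, execs, Instr.apply, State.view]
    rw [hinp', hv, ha', hb', show p + j + 1 = p + 1 + j by ring] at hv₂
    dsimp only at hv₂
    refine ⟨8 * (k - (j + 1)), ⟨j + 1, hjlt, _, _, _, _, rfl, hv₂, ?_, ?_, ?_, ?_, ?_,
      hO.insert le_rfl (x := p + 1 + j) (by omega) (t := e + 1) ?_ ?_ ?_⟩, ?_⟩
    · have : s₂.reg Reg.a = s'.reg Reg.a + 1 := by simp [hs₂, execs, Instr.apply]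
      rw [this, ha']; ring
    · rw [← hb']; simp [hs₂, execs, Instr.apply]
    · rw [← hc']; simp [hs₂, execs, Instr.apply]
    · rw [← hd']; simp [hs₂, execs, Instr.apply]
    · have : s₂.reg Reg.e = s'.reg Reg.e + 1 := by simp [hs₂, execs, Instr.apply]
      rw [this, he']
    · simp only [if_true, Finset.mem_image, Finset.mem_range, not_exists, not_and]
      intro i hi heq
      have := hinj i (by omega) j hjlt heq
      omega
    · simp only [if_true, Finset.range_add_one, Finset.image_insert]
    · intro t' ht'
      simp only [if_neg ht']
    · simp only [List.length_cons, List.length_nil]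
      omega
  · refine h.table.congr (fun t => ?_) (by omega)
    split_ifs with ht
    · subst ht; rw [stageTails_succ_self]; rfl
    · rfl
  · rintro s' t ⟨d, ⟨j, hj, occh, nexto, edgeof, ol', rfl, hv, ha', hb', hc', hd', he', hO⟩,
      htest, ht⟩
    have hjeq : j = k := by
      simp only [Test.Holds] at htest
      rw [hd', he'] at htest
      omega
    subst hjeq
    refine ⟨by simp only [List.length_cons, List.length_nil]; omega, ⟨ol', ?_⟩, ?_, hb', hc'⟩
    · rw [hv]
      refine ⟨?_, ?_, ?_, ?_, h.hp_eq⟩ <;> dsimp only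
      · rw [h.frame, hz]
      · refine hO.congr (fun t => ?_) (by rw [headPos])
        split_ifs with ht
        · subst ht; rw [stageTails_self, hts]
        · exact stageTails_of_ne ht
      · intro t h1 h2
        by_cases ht : t = e + 1
        · subst ht
          rw [Function.update_self, hts, Finset.card_image_of_injOn, Finset.card_range]
          intro i hi j hj hij
          simp only [Finset.coe_range, Set.mem_Iio] at hi hj
          exact hinj i hi j hj hij
        · rw [Function.update_of_ne ht]; exact h.cnt_eq t h1 (by omega)
      · intro t ht
        rw [Function.update_of_ne (by omega)]; exact h.cnt_zero t (by omega)
    · rw [ha', headPos]; omega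

theorem ends_head (hinp : M₀.inp = a) (h : TailRead a M₀ s.view e ol)
    (ha : s.reg Reg.a + 1 = headPos a e) (hb : s.reg Reg.b = e + 1) :
    Ends headProg s fun s' t => t ≤ 3 * a (headPos a e) + 6 ∧ ParseInv a M₀ s'.view (e + 1) ol ∧
      s'.reg Reg.a = tailPos a (e + 1) ∧ s'.reg Reg.b = e + 1 ∧ s'.reg Reg.c = s.reg Reg.c := by
  have hinp' : s.view.inp = a := by rw [h.frame]; exact hinp
  set k := a (headPos a e) with hk
  apply Ends.seq
  apply Ends.block
  set s₁ := execs s [Instr.inc Reg.a, Instr.store Arr.hp Reg.b Reg.a,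
    Instr.load Reg.d Arr.inp Reg.a, Instr.const Reg.e 0] with hs₁
  have hv₁ : s₁.view = { s.view with
      hp := Function.update s.view.hp (e + 1) (headPos a e) } := by
    rw [← hb, ← ha]; simp [hs₁, execs, Instr.apply, State.view]
  have ha₁ : s₁.reg Reg.a = headPos a e := by
    rw [← ha]; simp [hs₁, execs, Instr.apply]
  have hb₁ : s₁.reg Reg.b = e + 1 := by rw [← hb]; simp [hs₁, execs, Instr.apply]
  have hc₁ : s₁.reg Reg.c = s.reg Reg.c := by simp [hs₁, execs, Instr.apply]
  have hd₁ : s₁.reg Reg.d = k := by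
    rw [hk, ← ha, ← hinp']; simp [hs₁, execs, Instr.apply, State.view]
  have he₁ : s₁.reg Reg.e = 0 := by simp [hs₁, execs, Instr.apply]
  clear_value s₁
  apply Ends.seq
  refine (Ends.loop (fun s' d => ∃ j ≤ k, d = 3 * (k - j) ∧ s'.view = s₁.view ∧
    s'.reg Reg.a = headPos a e + j ∧ s'.reg Reg.b = e + 1 ∧ s'.reg Reg.c = s.reg Reg.c ∧
    s'.reg Reg.d = k ∧ s'.reg Reg.e = j) ?_
    (d := 3 * k) ⟨0, Nat.zero_le _, rfl, rfl, ha₁, hb₁, hc₁, hd₁, he₁⟩).mono ?_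
  · rintro s' d ⟨j, hj, rfl, hv, ha', hb', hc', hd', he'⟩ htest
    have hjlt : j < k := by
      simp only [Test.Holds] at htest
      rwa [hd', he'] at htest
    apply Ends.block
    set s₂ := execs s' [Instr.inc Reg.a, Instr.inc Reg.e] with hs₂
    refine ⟨3 * (k - (j + 1)), ⟨j + 1, hjlt, rfl, ?_, ?_, ?_, ?_, ?_, ?_⟩, ?_⟩
    · rw [← hv]; simp [hs₂, execs, Instr.apply, State.view]
    · have : s₂.reg Reg.a = s'.reg Reg.a + 1 := by simp [hs₂, execs, Instr.apply]
      rw [this, ha']; ring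
    · rw [← hb']; simp [hs₂, execs, Instr.apply]
    · rw [← hc']; simp [hs₂, execs, Instr.apply]
    · rw [← hd']; simp [hs₂, execs, Instr.apply]
    · have : s₂.reg Reg.e = s'.reg Reg.e + 1 := by simp [hs₂, execs, Instr.apply]
      rw [this, he']
    · simp only [List.length_cons, List.length_nil]
      omega
  · rintro s' t ⟨d, ⟨j, hj, rfl, hv, ha', hb', hc', hd', he'⟩, htest, ht⟩
    have hjeq : j = k := by
      simp only [Test.Holds] at htest
      rw [hd', he'] at htest
      omega
    subst hjeq
    apply Ends.block
    set s₂ := execs s' [Instr.inc Reg.a] with hs₂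
    have hv₂ : s₂.view = s₁.view := by
      rw [← hv]; simp [hs₂, execs, Instr.apply, State.view]
    refine ⟨by simp only [List.length_cons, List.length_nil]; omega, ?_, ?_, ?_, ?_⟩
    · rw [hv₂, hv₁]
      refine ⟨?_, ?_, h.cnt_eq, h.cnt_zero, ?_⟩ <;> dsimp only
      · rw [h.frame]
      · exact h.table.congr (fun _ => rfl) (by rw [tailPos_succ]; omega)
      · intro t h1 h2
        by_cases ht : t = e + 1
        · subst ht; rw [Function.update_self, Nat.add_sub_cancel]
        · rw [Function.update_of_ne ht]; exact h.hp_eq t h1 (by omega)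
    · have : s₂.reg Reg.a = s'.reg Reg.a + 1 := by simp [hs₂, execs, Instr.apply]
      rw [this, ha', tailPos_succ]; omega
    · rw [← hb']; simp [hs₂, execs, Instr.apply]
    · rw [← hc']; simp [hs₂, execs, Instr.apply]

/-- The hyperedges in the input are read in linear time. -/
theorem ends_parse (hs : s.view = M₀) (hb : s.reg Reg.b = 0) (hinp : M₀.inp = a)
    (hz : M₀.z = 0) (hcnt : ∀ t, M₀.cnt t = 0) (hocc : ∀ v, M₀.occh v = 0)
    (hinj : ∀ e < a 1, ∀ i < a (tailPos a e), ∀ j < a (tailPos a e),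
      a (tailPos a e + 1 + i) = a (tailPos a e + 1 + j) → i = j) :
    Ends parseProg s fun s' t => (∃ ol, ParseInv a M₀ s'.view (a 1) ol) ∧
      t ≤ ∑ e ∈ Finset.range (a 1), (8 * (a (tailPos a e) + a (headPos a e)) + 40) + 7 := by
  apply Ends.seq
  apply Ends.block
  set s₁ := execs s [Instr.const Reg.f 0, Instr.load Reg.n Arr.inp Reg.f, Instr.inc Reg.f,
      Instr.load Reg.c Arr.inp Reg.f, Instr.const Reg.a 2, Instr.const Reg.op 1] with hs₁
  have hv₁ : s₁.view = { M₀ with n := a 0, op := 1 } := by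
    rw [← hinp, ← hs]; simp [hs₁, execs, Instr.apply, State.view]
  have ha₁ : s₁.reg Reg.a = 2 := by simp [hs₁, execs, Instr.apply]
  have hb₁ : s₁.reg Reg.b = 0 := by rw [← hb]; simp [hs₁, execs, Instr.apply]
  have hc₁ : s₁.reg Reg.c = a 1 := by
    rw [← hinp, ← hs]; simp [hs₁, execs, Instr.apply, State.view]
  clear_value s₁
  set m := a 1
  set cost : ℕ → ℕ := fun e => 8 * (a (tailPos a e) + a (headPos a e)) + 40 with hcost
  refine (Ends.loop (fun s' d => ∃ e ≤ m, d = ∑ i ∈ Finset.Ico e m, cost i ∧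
    (∃ ol, ParseInv a M₀ s'.view e ol) ∧ s'.reg Reg.a = tailPos a e ∧ s'.reg Reg.b = e ∧
    s'.reg Reg.c = m) ?_
    (d := ∑ i ∈ Finset.Ico 0 m, cost i) ⟨0, Nat.zero_le _, rfl, ⟨fun _ => [], ?_⟩, ha₁, hb₁,
      hc₁⟩).mono ?_
  · rintro s' d ⟨e, he, rfl, ⟨ol, h⟩, ha', hb', hc'⟩ htest
    have helt : e < m := by
      simp only [Test.Holds] at htest
      rwa [hb', hc'] at htest
    have hinp' : s'.view.inp = a := by rw [h.frame]; exact hinp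
    rw [Finset.sum_eq_sum_Ico_succ_bot helt]
    apply Ends.seq
    apply Ends.block
    set s₂ := execs s' [Instr.inc Reg.b, Instr.load Reg.d Arr.inp Reg.a, Instr.const Reg.e 0]
      with hs₂
    have hv₂ : s₂.view = s'.view := by simp [hs₂, execs, Instr.apply, State.view]
    have ha₂ : s₂.reg Reg.a = tailPos a e := by rw [← ha']; simp [hs₂, execs, Instr.apply]
    have hb₂ : s₂.reg Reg.b = e + 1 := by rw [← hb']; simp [hs₂, execs, Instr.apply]
    have hc₂ : s₂.reg Reg.c = m := by rw [← hc']; simp [hs₂, execs, Instr.apply]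
    have hd₂ : s₂.reg Reg.d = a (tailPos a e) := by
      rw [← ha', ← hinp']; simp [hs₂, execs, Instr.apply, State.view]
    have he₂ : s₂.reg Reg.e = 0 := by simp [hs₂, execs, Instr.apply]
    clear_value s₂
    rw [← hv₂] at h
    apply Ends.seq
    have hmid : Ends (.cond (.eq Reg.d Reg.e) emptyTailProg tailProg) s₂ fun s₃ t =>
        t ≤ 8 * a (tailPos a e) + 21 ∧ (∃ ol, TailRead a M₀ s₃.view e ol) ∧
        s₃.reg Reg.a + 1 = headPos a e ∧ s₃.reg Reg.b = e + 1 ∧ s₃.reg Reg.c = m := by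
      apply Ends.cond
      · intro hb
        simp only [Test.Holds] at hb
        rw [hd₂, he₂] at hb
        refine (ends_emptyTail hinp h ha₂ hb₂ he₂ hb).mono ?_
        rintro s₃ t₃ ⟨h1, h2, h3, h4, h5⟩
        exact ⟨by omega, h2, h3, h4, h5.trans hc₂⟩
      · intro hb
        simp only [Test.Holds] at hb
        rw [hd₂, he₂] at hb
        refine (ends_tail hinp h ha₂ hb₂ he₂ hd₂ hb (hinj e helt)).mono ?_
        rintro s₃ t₃ ⟨h1, h2, h3, h4, h5⟩
        exact ⟨by omega, h2, h3, h4, h5.trans hc₂⟩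
    refine hmid.mono ?_
    rintro s₃ t₃ ⟨ht₃, ⟨ol₃, h₃⟩, ha₃, hb₃, hc₃⟩
    refine (ends_head hinp h₃ ha₃ hb₃).mono ?_
    rintro s₄ t₄ ⟨ht₄, h₄, ha₄, hb₄, hc₄⟩
    refine ⟨_, ⟨e + 1, helt, rfl, ⟨ol₃, h₄⟩, ha₄, hb₄, hc₄.trans hc₃⟩, ?_⟩
    simp only [List.length_cons, List.length_nil, hcost]
    omega
  · rw [hv₁]
    refine ⟨?_, ⟨?_, by simp, by simp, ?_⟩, by omega, fun t _ => hcnt t, by omega⟩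
    · rw [zMark]; simp only [← hz]
    · exact fun v => hocc v
    · intro v t
      rw [stageTails, if_neg (by omega)]
      simp
  · rintro s' t ⟨d, ⟨e, he, rfl, hP, ha', hb', hc'⟩, htest, ht⟩
    have heq : e = m := by
      simp only [Test.Holds] at htest
      rw [hb', hc'] at htest
      omega
    subst heq
    refine ⟨hP, ?_⟩
    rw [Finset.range_eq_Ico]
    have hsum : ∑ i ∈ Finset.Ico 0 m, cost i = (Finset.Ico 0 m).sum cost := rfl
    rw [hsum] at ht
    simp only [List.length_cons, List.length_nil]
    omega

end RAM

/-! ### The input word -/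

section Input

variable {N : Type*} [Fintype N] {ν : N ≃ Fin (Fintype.card N)} {H : DirectedHypergraph N}

/-- The word `a` describes the hyperedges `E 0, …, E (m - 1)` of `H` in the format that `tailPos`
and `headPos` presuppose. -/
structure EncodesEdges (ν : N ≃ Fin (Fintype.card N)) (H : DirectedHypergraph N) (a : ℕ → ℕ) (m : ℕ)
    (E : ℕ → Finset N × Finset N) : Prop where
  mem : ∀ e < m, E e ∈ H.edges
  inj : ∀ e < m, ∀ e' < m, E e = E e' → e = e'
  surj : ∀ p ∈ H.edges, ∃ e < m, E e = p
  tail_card : ∀ e < m, a (tailPos a e) = (E e).1.card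
  tail_iff : ∀ e < m, ∀ v, (∃ i < a (tailPos a e), a (tailPos a e + 1 + i) = v) ↔
    ∃ x ∈ (E e).1, (ν x : ℕ) = v
  tail_inj : ∀ e < m, ∀ i < a (tailPos a e), ∀ j < a (tailPos a e),
    a (tailPos a e + 1 + i) = a (tailPos a e + 1 + j) → i = j
  head_card : ∀ e < m, a (headPos a e) = (E e).2.card
  head_iff : ∀ e < m, ∀ v, (∃ i < a (headPos a e), a (headPos a e + 1 + i) = v) ↔
    ∃ x ∈ (E e).2, (ν x : ℕ) = v

theorem Enumerates.length_eq_card {X : Type*} {l : List X} {S : Finset X}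
    (h : Enumerates l {v | v ∈ S}) : l.length = S.card := by
  classical
  rw [← List.toFinset_card_of_nodup h.1]
  congr 1
  ext x
  simpa using h.2 x

/-- A segment of an array that holds the numbers of the nodes of a list. -/
theorem Enumerates.exists_segment_iff {l : List N} {S : Finset N} (h : Enumerates l {v | v ∈ S})
    {b : ℕ → ℕ} (hb : ∀ i (hi : i < l.length), b i = ν l[i]) (v : ℕ) :
    (∃ i < l.length, b i = v) ↔ ∃ x ∈ S, (ν x : ℕ) = v := by
  constructor
  · rintro ⟨i, hi, rfl⟩
    exact ⟨l[i], (h.2 _).1 (List.getElem_mem hi), (hb i hi).symm⟩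
  · rintro ⟨x, hx, rfl⟩
    obtain ⟨i, hi, rfl⟩ := List.mem_iff_getElem.1 ((h.2 x).2 hx)
    exact ⟨i, hi, hb i hi⟩

theorem Enumerates.segment_inj {l : List N} {S : Finset N} (h : Enumerates l {v | v ∈ S})
    {b : ℕ → ℕ} (hb : ∀ i (hi : i < l.length), b i = ν l[i]) :
    ∀ i < l.length, ∀ j < l.length, b i = b j → i = j := by
  intro i hi j hj hij
  rw [hb i hi, hb j hj, Fin.val_inj, ν.apply_eq_iff_eq, h.1.getElem_inj_iff] at hij
  exact hij

section Word

variable (ν) (L : List (List N × List N))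

theorem length_encodeNodes (l : List N) : (encodeNodes ν l).length = l.length + 1 := by
  simp [encodeNodes]

/-- The description of a hyperedge at the beginning of a word. -/
theorem edge_of_drop {w : List ℕ} {k : ℕ} {p : List N × List N} {rest : List ℕ}
    (h : w.drop k = encodeNodes ν p.1 ++ encodeNodes ν p.2 ++ rest) :
    w.getD k 0 = p.1.length ∧ (∀ i (hi : i < p.1.length), w.getD (k + 1 + i) 0 = ν p.1[i]) ∧
    w.getD (k + 1 + p.1.length) 0 = p.2.length ∧
    (∀ i (hi : i < p.2.length), w.getD (k + 1 + p.1.length + 1 + i) 0 = ν p.2[i]) ∧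
    w.drop (k + 1 + p.1.length + 1 + p.2.length) = rest := by
  have key : ∀ j, w.getD (k + j) 0 =
      (encodeNodes ν p.1 ++ (encodeNodes ν p.2 ++ rest)).getD j 0 := by
    intro j
    rw [← List.append_assoc, ← h]
    simp only [List.getD_eq_getElem?_getD, List.getElem?_drop]
  have h1 := length_encodeNodes ν p.1
  have h2 := length_encodeNodes ν p.2
  refine ⟨?_, ?_, ?_, ?_, ?_⟩
  · have := key 0
    rw [Nat.add_zero] at this
    rw [this]; simp [encodeNodes]
  · intro i hi
    rw [show k + 1 + i = k + (i + 1) by ring, key, List.getD_append _ _ _ _ (by omega)]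
    simp [encodeNodes, hi]
  · rw [show k + 1 + p.1.length = k + (p.1.length + 1) by ring, key,
      List.getD_append_right _ _ _ _ (by omega), h1, Nat.sub_self]
    simp [encodeNodes]
  · intro i hi
    rw [show k + 1 + p.1.length + 1 + i = k + (p.1.length + 1 + (i + 1)) by ring, key,
      List.getD_append_right _ _ _ _ (by omega), h1, Nat.add_sub_cancel_left,
      List.getD_append _ _ _ _ (by omega)]
    simp [encodeNodes, hi]
  · rw [show k + 1 + p.1.length + 1 + p.2.length = k + (p.1.length + 1 + (p.2.length + 1)) by ring,
      ← List.drop_drop, h]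
    exact List.drop_left' (by rw [List.length_append, h1, h2])

/-- The description of hyperedge number `e` begins at `tailPos a e`. -/
theorem drop_tailPos {a : ℕ → ℕ} (ha : ∀ i, a i = (encodeHypergraph ν L).getD i 0) {e : ℕ}
    (he : e ≤ L.length) : (encodeHypergraph ν L).drop (tailPos a e) =
      (L.drop e).flatMap fun p => encodeNodes ν p.1 ++ encodeNodes ν p.2 := by
  induction e with
  | zero => simp [tailPos, encodeHypergraph]
  | succ e ih =>
    have h := ih (by omega)
    rw [List.drop_eq_getElem_cons (by omega : e < L.length), List.flatMap_cons] at h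
    obtain ⟨h1, _, h2, _, h3⟩ := edge_of_drop ν h
    rw [← ha] at h1 h2
    rw [tailPos_succ, headPos, h1, h2, h3]

theorem exists_encodesEdges {L : List (List N × List N)} (hL : ListsEdges L H) {a : ℕ → ℕ}
    (ha : ∀ i, a i = (encodeHypergraph ν L).getD i 0) :
    ∃ E, EncodesEdges ν H a L.length E := by
  obtain ⟨es, ⟨hnd, hmem⟩, hF⟩ := hL
  have hlen := hF.length_eq
  have hE : ∀ e (he : e < es.length), es.getD e (∅, ∅) = es[e] := fun e he =>
    List.getD_eq_getElem _ _ he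
  have key : ∀ e (he : e < L.length),
      (a (tailPos a e) = L[e].1.length ∧
        ∀ i (hi : i < L[e].1.length), a (tailPos a e + 1 + i) = ν L[e].1[i]) ∧
      (a (headPos a e) = L[e].2.length ∧
        ∀ i (hi : i < L[e].2.length), a (headPos a e + 1 + i) = ν L[e].2[i]) ∧
      Enumerates L[e].1 {v | v ∈ (es.getD e (∅, ∅)).1} ∧
      Enumerates L[e].2 {v | v ∈ (es.getD e (∅, ∅)).2} := by
    intro e he
    have h := drop_tailPos ν L ha he.le
    rw [List.drop_eq_getElem_cons he, List.flatMap_cons] at h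
    obtain ⟨h1, h2, h3, h4, _⟩ := edge_of_drop ν h
    simp only [← ha] at h1 h2 h3 h4
    have h5 := hF.get (i := e) (by omega) he
    rw [hE e (by omega), headPos, h1]
    exact ⟨⟨rfl, h2⟩, ⟨h3, h4⟩, h5⟩
  refine ⟨fun e => es.getD e (∅, ∅), ?_, ?_, ?_, ?_, ?_, ?_, ?_, ?_⟩
  · intro e he
    rw [hE e (by omega)]
    exact (hmem _).1 (List.getElem_mem _)
  · intro e he e' he' h
    rwa [hE e (by omega), hE e' (by omega), hnd.getElem_inj_iff] at h
  · intro p hp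
    obtain ⟨e, he, rfl⟩ := List.mem_iff_getElem.1 ((hmem p).2 hp)
    exact ⟨e, by omega, hE e he⟩
  · intro e he
    obtain ⟨⟨h1, _⟩, _, h2, _⟩ := key e he
    rw [h1, h2.length_eq_card]
  · intro e he v
    obtain ⟨⟨h1, h3⟩, _, h2, _⟩ := key e he
    rw [h1]
    exact h2.exists_segment_iff (b := fun i => a (tailPos a e + 1 + i)) h3 v
  · intro e he
    obtain ⟨⟨h1, h3⟩, _, h2, _⟩ := key e he
    rw [h1]
    exact h2.segment_inj (b := fun i => a (tailPos a e + 1 + i)) h3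
  · intro e he
    obtain ⟨_, ⟨h1, _⟩, _, h2⟩ := key e he
    rw [h1, h2.length_eq_card]
  · intro e he v
    obtain ⟨_, ⟨h1, h3⟩, _, h2⟩ := key e he
    rw [h1]
    exact h2.exists_segment_iff (b := fun i => a (headPos a e + 1 + i)) h3 v

end Word

variable {a : ℕ → ℕ} {m : ℕ} {E : ℕ → Finset N × Finset N}

theorem EncodesEdges.sum_eq (h : EncodesEdges ν H a m E) :
    ∑ e ∈ Finset.range m, (a (tailPos a e) + a (headPos a e)) =
      ∑ p ∈ H.edges, (p.1.card + p.2.card) := by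
  refine Finset.sum_bij (fun e _ => E e) ?_ ?_ ?_ ?_
  · exact fun e he => h.mem e (Finset.mem_range.1 he)
  · exact fun e he e' he' => h.inj e (Finset.mem_range.1 he) e' (Finset.mem_range.1 he')
  · intro p hp
    obtain ⟨e, he, rfl⟩ := h.surj p hp
    exact ⟨e, Finset.mem_range.2 he, rfl⟩
  · intro e he
    rw [h.tail_card e (Finset.mem_range.1 he), h.head_card e (Finset.mem_range.1 he)]

/-- At most one hyperedge has an empty tail and an empty head. -/
theorem EncodesEdges.le_sum_add_one (h : EncodesEdges ν H a m E) :
    m ≤ ∑ e ∈ Finset.range m, (a (tailPos a e) + a (headPos a e)) + 1 := by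
  classical
  have hm : m = H.edges.card := by
    rw [← Finset.card_range m]
    refine Finset.card_bij (fun e _ => E e) ?_ ?_ ?_
    · exact fun e he => h.mem e (Finset.mem_range.1 he)
    · exact fun e he e' he' => h.inj e (Finset.mem_range.1 he) e' (Finset.mem_range.1 he')
    · intro p hp
      obtain ⟨e, he, rfl⟩ := h.surj p hp
      exact ⟨e, Finset.mem_range.2 he, rfl⟩
  rw [h.sum_eq]
  have h1 := Finset.pred_card_le_card_erase (s := H.edges) (a := (∅, ∅))
  have h2 : (H.edges.erase (∅, ∅)).card ≤ ∑ p ∈ H.edges.erase (∅, ∅), (p.1.card + p.2.card) := by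
    rw [Finset.card_eq_sum_ones]
    refine Finset.sum_le_sum fun p hp => ?_
    by_contra h0
    refine Finset.ne_of_mem_erase hp (Prod.ext ?_ ?_)
    · exact Finset.card_eq_zero.1 (by omega)
    · exact Finset.card_eq_zero.1 (by omega)
  have h3 : ∑ p ∈ H.edges.erase (∅, ∅), (p.1.card + p.2.card) ≤
      ∑ p ∈ H.edges, (p.1.card + p.2.card) :=
    Finset.sum_le_sum_of_subset (Finset.erase_subset _ _)
  omega

theorem zMark_eq_of_le {e e' : ℕ} (hne : zMark a e ≠ 0) (hle : e ≤ e') :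
    zMark a e' = zMark a e := by
  induction e', hle using Nat.le_induction with
  | base => rfl
  | succ k _ ih => rw [zMark, ih, if_neg fun h => hne h.1]

theorem exists_edge_of_zMark_ne_zero {e : ℕ} (hne : zMark a e ≠ 0) :
    ∃ k < e, a (tailPos a k) = 0 ∧ a (headPos a k) ≠ 0 ∧
      zMark a e = a (headPos a k + 1) + 1 := by
  induction e with
  | zero => exact absurd rfl hne
  | succ e ih =>
    rw [zMark] at hne ⊢
    split_ifs at hne ⊢ with h
    · exact ⟨e, by omega, h.2.1, h.2.2, rfl⟩
    · obtain ⟨k, hk, h1⟩ := ih hne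
      exact ⟨k, by omega, h1⟩

/-- The only node in the set that replaces an empty tail is `z - 1`, for the final value of `z`. -/
theorem tailSet_of_empty {e : ℕ} (he : e < m) (ht : a (tailPos a e) = 0)
    (hh : a (headPos a e) ≠ 0) : zMark a m ≠ 0 ∧ tailSet a (e + 1) = {zMark a m - 1} := by
  have h1 : zMark a (e + 1) ≠ 0 := by
    rw [zMark]
    split_ifs with h
    · omega
    · exact fun h0 => h ⟨h0, ht, hh⟩
  have h2 := zMark_eq_of_le h1 (show e + 1 ≤ m by omega)
  refine ⟨by rwa [h2], ?_⟩
  rw [tailSet, Nat.add_sub_cancel, if_pos ht, if_neg hh, h2]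

theorem card_tailSet_le (a : ℕ → ℕ) (e : ℕ) :
    (tailSet a (e + 1)).card ≤ a (tailPos a e) + a (headPos a e) := by
  rw [tailSet, Nat.add_sub_cancel]
  split_ifs with h1 h2
  · simp
  · rw [Finset.card_singleton]; omega
  · refine Finset.card_image_le.trans ?_
    rw [Finset.card_range]
    exact Nat.le_add_right _ _

theorem EncodesEdges.mem_tailSet (h : EncodesEdges ν H a m E) {e : ℕ} (he : e < m)
    (ht : a (tailPos a e) ≠ 0) (v : ℕ) :
    v ∈ tailSet a (e + 1) ↔ ∃ x ∈ (E e).1, (ν x : ℕ) = v := by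
  rw [← h.tail_iff e he, tailSet, Nat.add_sub_cancel, if_neg ht]
  simp

theorem mem_headSet_iff {e : ℕ} (v : ℕ) :
    v ∈ headSet a (e + 1) ↔ ∃ i < a (headPos a e), a (headPos a e + 1 + i) = v := by
  simp [headSet]

theorem EncodesEdges.mem_headSet (h : EncodesEdges ν H a m E) {e : ℕ} (he : e < m) (v : ℕ) :
    v ∈ headSet a (e + 1) ↔ ∃ x ∈ (E e).2, (ν x : ℕ) = v := by
  rw [← h.head_iff e he, mem_headSet_iff]

/-- The number `z - 1` belongs to a node that is reachable from all nodes. -/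
theorem EncodesEdges.exists_node_zMark (h : EncodesEdges ν H a m E) (hz : zMark a m ≠ 0) :
    ∃ y, (ν y : ℕ) = zMark a m - 1 ∧ ∀ x, H.Reaches x y := by
  obtain ⟨e, he, h1, h2, h3⟩ := exists_edge_of_zMark_ne_zero hz
  obtain ⟨y, hy, hy'⟩ := (h.head_iff e he _).1 ⟨0, by omega, rfl⟩
  refine ⟨y, by rw [hy', h3]; rfl, fun x => .step (E e) y (h.mem e he) hy ?_⟩
  have : (E e).1 = ∅ := by rw [← Finset.card_eq_zero, ← h.tail_card e he, h1]
  simp [this]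

theorem exists_eq_succ {t m : ℕ} (h1 : 1 ≤ t) (h2 : t ≤ m) : ∃ e < m, t = e + 1 :=
  ⟨t - 1, by omega, by omega⟩

/-- The hypergraph described by the word `a`, as an instance of the search. -/
def EncodesEdges.problem (h : EncodesEdges ν H a m E) : SearchProblem where
  n := Fintype.card N
  m := m
  z := zMark a m
  tl := tailSet a
  hd := headSet a
  hl t := a (headPos a (t - 1))
  Reach u v := ∃ x y, (ν x : ℕ) = u ∧ (ν y : ℕ) = v ∧ H.Reaches x y
  refl u hu := ⟨ν.symm ⟨u, hu⟩, ν.symm ⟨u, hu⟩, by simp, by simp, .refl⟩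
  trans := by
    rintro _ _ _ ⟨x, y, rfl, rfl, hxy⟩ ⟨y', w, hy, rfl, hyw⟩
    rw [Fin.val_inj, ν.apply_eq_iff_eq] at hy
    subst hy
    exact ⟨x, w, rfl, rfl, hxy.trans hyw⟩
  tl_lt := by
    intro t h1 h2 v hv
    obtain ⟨e, he, rfl⟩ := exists_eq_succ h1 h2
    by_cases ht : a (tailPos a e) = 0
    · by_cases hh : a (headPos a e) = 0
      · rw [tailSet, Nat.add_sub_cancel, if_pos ht, if_pos hh] at hv
        simp at hv
      · obtain ⟨hz, hts⟩ := tailSet_of_empty he ht hh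
        obtain ⟨y, hy, _⟩ := h.exists_node_zMark hz
        rw [hts, Finset.mem_singleton, ← hy] at hv
        rw [hv]; exact (ν y).2
    · obtain ⟨x, _, rfl⟩ := (h.mem_tailSet he ht v).1 hv
      exact (ν x).2
  hd_lt := by
    intro t h1 h2 v hv
    obtain ⟨e, he, rfl⟩ := exists_eq_succ h1 h2
    obtain ⟨x, _, rfl⟩ := (h.mem_headSet he v).1 hv
    exact (ν x).2
  edge := by
    intro t h1 h2 u hu htl w hw
    obtain ⟨e, he, rfl⟩ := exists_eq_succ h1 h2
    obtain ⟨y, hy, rfl⟩ := (h.mem_headSet he w).1 hw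
    refine ⟨ν.symm ⟨u, hu⟩, y, by simp, rfl, .step (E e) y (h.mem e he) hy fun x hx => ?_⟩
    have ht : a (tailPos a e) ≠ 0 := by
      rw [h.tail_card e he]
      exact Finset.card_ne_zero_of_mem hx
    obtain ⟨x₁, x₂, h3, h4, h5⟩ := htl _ ((h.mem_tailSet he ht _).2 ⟨x, hx, rfl⟩)
    rw [Fin.val_inj, ν.apply_eq_iff_eq] at h4
    have h6 : ν.symm ⟨u, hu⟩ = x₁ := by
      rw [Equiv.symm_apply_eq]
      exact Fin.ext h3.symm
    rw [h6, ← h4]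
    exact h5
  z_lt := by
    intro hz
    obtain ⟨y, hy, _⟩ := h.exists_node_zMark hz
    rw [← hy]; exact (ν y).2
  z_reach := by
    intro hz u hu
    obtain ⟨y, hy, hr⟩ := h.exists_node_zMark hz
    exact ⟨ν.symm ⟨u, hu⟩, y, by simp, hy, hr _⟩
  closed := by
    rintro C _ hC hz _ hu _ ⟨x, y, rfl, rfl, hr⟩
    induction hr with
    | refl => exact hu
    | step p y hp hy _ ih =>
      obtain ⟨e, he, rfl⟩ := h.surj p hp
      have hmem := (h.mem_headSet he _).2 ⟨y, hy, rfl⟩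
      by_cases ht : a (tailPos a e) = 0
      · have hh : a (headPos a e) ≠ 0 := by
          rw [h.head_card e he]
          exact Finset.card_ne_zero_of_mem hy
        obtain ⟨hz', hts⟩ := tailSet_of_empty he ht hh
        -- the tail is empty, and `z - 1`, which replaces it, lies in `C` by assumption
        refine hC (e + 1) (by omega) he (by rw [hts]; simp) ?_ _ hmem
        rw [hts]
        intro v hv
        rw [Finset.mem_singleton.1 hv]
        exact hz hz'
      · refine hC (e + 1) (by omega) he ?_ ?_ _ hmem
        · rw [h.tail_card e he, ← ne_eq, Finset.card_ne_zero] at ht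
          obtain ⟨x', hx'⟩ := ht
          have ht : a (tailPos a e) ≠ 0 := by
            rw [h.tail_card e he]
            exact Finset.card_ne_zero_of_mem hx'
          exact ⟨_, (h.mem_tailSet he ht _).2 ⟨x', hx', rfl⟩⟩
        · intro v hv
          obtain ⟨x', hx', rfl⟩ := (h.mem_tailSet he ht v).1 hv
          exact ih x' hx'

end Input

/-! ### The start of the search -/

section Start

variable {N : Type*} [Fintype N] {ν : N ≃ Fin (Fintype.card N)} {H : DirectedHypergraph N}
variable {a : ℕ → ℕ} {m : ℕ} {E : ℕ → Finset N × Finset N}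

/-- The auxiliary data at the beginning of the search. -/
def Ghost.initial (a : ℕ → ℕ) (m : ℕ) : Ghost where
  lo := id
  rt := id
  pl _ := []
  fresh := Finset.Icc 1 m
  un := tailSet a
  rest := []
  comps := []

/-- The memory that contains only the input word `a`. -/
def Memory.initial (a : ℕ → ℕ) : Memory where
  n := 0
  len := 0
  base := 0
  top := 0
  cur := 0
  wl := 0
  occ := 0
  z := 0
  op := 0
  cc := 0
  inp := a
  out _ := 0
  pos _ := 0
  stk _ := 0
  work _ := 0
  wb _ := 0
  prevb _ := 0
  par _ := 0
  rk _ := 0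
  low _ := 0
  root _ := 0
  pend _ := 0
  nextp _ := 0
  cnt _ := 0
  minp _ := 0
  hp _ := 0
  occh _ := 0
  nexto _ := 0
  edgeof _ := 0

/-- The invariant of the search holds after the input has been read. -/
theorem EncodesEdges.searchInv (h : EncodesEdges ν H a m E) (h0 : a 0 = Fintype.card N)
    {M : Memory} {ol : ℕ → List ℕ} (hM : ParseInv a (Memory.initial a) M m ol) :
    SearchInv h.problem ol M (Ghost.initial a m) := by
  obtain ⟨hframe, htable, hcnt, _, hhp⟩ := hM
  generalize M.cnt = cnt at *
  generalize M.hp = hp at *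
  generalize M.occh = occh at *
  generalize M.nexto = nexto at *
  generalize M.edgeof = edgeof at *
  subst hframe
  have habs : ∀ {x : ℕ} {p : Prop}, 0 < x → x ≤ 0 → p := fun h1 h2 =>
    absurd h1 (Nat.not_lt.2 h2)
  refine ⟨⟨h0, rfl, ?_, ?_, fun v _ => htable.chain v, fun v _ => htable.nodup v, ?_⟩,
    Nat.zero_le _, fun v hv => absurd hv (Nat.not_lt_zero v), ?_, ?_, ?_, ?_, ?_, ?_, ?_, ?_, ?_⟩
  · intro e h1 h2
    exact congrArg a (hhp e h1 h2)
  · intro t h1 h2 v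
    obtain ⟨e, he, rfl⟩ := exists_eq_succ h1 h2
    have := mem_headSet_iff (a := a) (e := e) v
    have h3 := hhp (e + 1) h1 h2
    rw [Nat.add_sub_cancel] at h3
    simpa only [Memory.initial, h3, EncodesEdges.problem, Nat.add_sub_cancel] using this
  · intro v _ e
    have := htable.mem_iff v e
    rw [stageTails] at this
    rw [this]
    split_ifs with h1
    · exact ⟨fun h2 => ⟨h1, h2⟩, fun h2 => h2.2⟩
    · exact ⟨fun h2 => by simp at h2, fun h2 => absurd h2.1 h1⟩
  · exact ⟨Nat.zero_le _, fun x h1 h2 => habs h1 h2, fun x h1 h2 => habs h1 h2,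
      fun v _ hv => absurd rfl hv, fun v _ => le_rfl⟩
  · exact ⟨le_rfl, fun x h1 h2 => habs h1 h2, fun x h1 h2 => habs h1 h2, fun x h1 h2 => habs h1 h2,
      fun x y h1 h2 h3 => habs h1 (h2.trans h3), fun h1 => habs h1 le_rfl,
      fun b h1 h2 => habs (by omega) h2⟩
  · exact ⟨⟨fun x h1 h2 => habs h1 h2, fun x h1 h2 => habs h1 h2, fun x h1 h2 => habs h1 h2,
      fun x h1 h2 => habs h1 h2, fun x h1 h2 => habs h1 h2, fun x h1 h2 => habs h1 h2,
      fun x h1 h2 => habs h1 h2⟩, fun _ _ => rfl, fun x h1 h2 => habs h1 h2,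
      fun x h1 h2 => habs h1 h2⟩
  · exact ⟨fun x y h1 h2 h3 => habs h1 (h2.trans h3), fun x h1 h2 => habs h1 h2⟩
  · exact ⟨fun x h1 h2 => habs h1 h2, fun x y h1 h2 h3 => habs h1 (h2.trans h3),
      fun x h1 h2 => habs h1 h2⟩
  · refine ⟨fun e _ _ v => ?_, hcnt, ?_, ?_⟩
    · exact ⟨fun hv => ⟨hv, .inl rfl⟩, fun hv => hv.1⟩
    · exact fun e _ _ v hv hv' => absurd hv hv'
    · exact fun e _ _ h1 => absurd rfl h1
  · exact ⟨fun e _ _ _ _ h1 => absurd h1 (Nat.lt_irrefl 0),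
      fun e h1 h2 _ => Finset.mem_Icc.2 ⟨h1, h2⟩, fun x h1 h2 => habs h1 h2,
      fun x h1 h2 => habs h1 h2, fun x h1 h2 => habs h1 h2, fun _ _ => rfl⟩
  · exact ⟨rfl, List.nodup_nil, fun e he => absurd he List.not_mem_nil, fun _ => rfl⟩
  · exact ⟨rfl, rfl, fun i hi => absurd hi (Nat.not_lt_zero i),
      fun l hl => absurd hl List.not_mem_nil, fun l hl => absurd hl List.not_mem_nil,
      fun l hl => absurd hl List.not_mem_nil,
      fun l hl => absurd hl List.not_mem_nil, List.Pairwise.nil, fun x h1 h2 => habs h1 h2⟩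

theorem sum_Icc_one_eq_sum_range (f : ℕ → ℕ) (m : ℕ) :
    ∑ t ∈ Finset.Icc 1 m, f t = ∑ e ∈ Finset.range m, f (e + 1) := by
  rw [Finset.sum_bij (fun e _ => e - 1)]
  · intro t ht
    rw [Finset.mem_Icc] at ht
    rw [Finset.mem_range]; omega
  · intro t ht t' ht' h
    rw [Finset.mem_Icc] at ht ht'
    omega
  · intro e he
    exact ⟨e + 1, Finset.mem_Icc.2 ⟨by omega, Finset.mem_range.1 he⟩, rfl⟩
  · intro t ht
    rw [Finset.mem_Icc] at ht
    rw [Nat.sub_add_cancel ht.1]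

theorem EncodesEdges.searchPotential_initial_le (h : EncodesEdges ν H a m E) (K : ℕ)
    {M : Memory} {ol : ℕ → List ℕ} (hM : ParseInv a (Memory.initial a) M m ol) :
    searchPotential h.problem K M (Ghost.initial a m) ≤ (21 * K + 260) * Fintype.card N +
      (7 * K + 110) * ∑ e ∈ Finset.range m, (a (tailPos a e) + a (headPos a e)) + 50 * m := by
  have h1 : M.len = 0 := by rw [hM.frame]; rfl
  have h2 : M.base = 0 := by rw [hM.frame]; rfl
  have h3 : M.cur = 0 := by rw [hM.frame]; rfl
  have h4 : M.wl = 0 := by rw [hM.frame]; rfl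
  have h5 : ∑ t ∈ Finset.Icc 1 m, M.cnt t ≤
      ∑ e ∈ Finset.range m, (a (tailPos a e) + a (headPos a e)) := by
    rw [sum_Icc_one_eq_sum_range]
    refine Finset.sum_le_sum fun e he => ?_
    rw [hM.cnt_eq (e + 1) (by omega) (Finset.mem_range.1 he)]
    exact card_tailSet_le a e
  have h6 : ∑ t ∈ Finset.Icc 1 m, (a (headPos a (t - 1)) + 1) ≤
      ∑ e ∈ Finset.range m, (a (tailPos a e) + a (headPos a e)) + m := by
    rw [sum_Icc_one_eq_sum_range]
    calc _ ≤ ∑ e ∈ Finset.range m, ((a (tailPos a e) + a (headPos a e)) + 1) :=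
          Finset.sum_le_sum fun e _ => by rw [Nat.add_sub_cancel]; omega
      _ = _ := by rw [Finset.sum_add_distrib]; simp
  have h7 : forestPotential K 10 0 M.par M.rk = 0 := by simp [forestPotential]
  simp only [searchPotential, h1, h2, h3, h4, h7, EncodesEdges.problem, Ghost.initial]
  have h8 := Nat.mul_le_mul_left (7 * K + 60) h5
  have h9 := Nat.mul_le_mul_left 50 h6
  generalize ∑ e ∈ Finset.range m, (a (tailPos a e) + a (headPos a e)) = S at *
  calc _ ≤ 7 * 0 + (21 * K + 200) * (Fintype.card N - 0) + 60 * (0 - 0) +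
        60 * (Fintype.card N - 0) + (7 * K + 60) * S + 50 * (S + m) + 40 * 0 := by omega
    _ = _ := by rw [Nat.sub_zero]; ring

end Start

/-! ### The output word -/

section Output

variable {N : Type*}

/-- Mutually reachable classes that are closed under reachability, such that one of them is
reachable from each node, are the minimal strongly connected components. -/
theorem DirectedHypergraph.listsFamily_minimalSccs (H : DirectedHypergraph N) {L : List (List N)}
    (hnodup : ∀ l ∈ L, l.Nodup) (hne : ∀ l ∈ L, l ≠ [])
    (hscc : ∀ l ∈ L, ∀ u ∈ l, ∀ v, v ∈ l ↔ H.Reaches u v) (hdisj : L.Pairwise List.Disjoint)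
    (hreach : ∀ x, ∃ l ∈ L, ∃ u ∈ l, H.Reaches x u) : ListsFamily L H.minimalSccs := by
  have hclass : ∀ l ∈ L, ∀ u ∈ l, {x | x ∈ l} = {x | H.sccSetoid x u} := by
    intro l hl u hu
    ext x
    refine ⟨fun hx => ⟨(hscc l hl x hx u).1 hu, (hscc l hl u hu x).1 hx⟩, fun hx => ?_⟩
    exact (hscc l hl u hu x).2 hx.2
  have hmem : ∀ l ∈ L, {x | x ∈ l} ∈ H.sccs := by
    intro l hl
    obtain ⟨u, hu⟩ := List.exists_mem_of_ne_nil l (hne l hl)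
    exact ⟨u, hclass l hl u hu⟩
  refine ⟨L.map fun l => {x | x ∈ l}, ⟨?_, ?_⟩, ?_⟩
  · rw [List.Nodup, List.pairwise_map]
    refine hdisj.imp_of_mem fun {l l'} hl _ h heq => ?_
    obtain ⟨u, hu⟩ := List.exists_mem_of_ne_nil l (hne l hl)
    exact h hu ((Set.ext_iff.1 heq u).1 hu)
  · intro C
    rw [List.mem_map]
    constructor
    · rintro ⟨l, hl, rfl⟩
      refine ⟨hmem l hl, ?_⟩
      rintro C' ⟨y, rfl⟩ ⟨u, hu, v, hv, hr⟩
      have hul := (hscc l hl v hv u).2 hr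
      rw [hclass l hl u hul]
      ext x
      exact ⟨fun hx => H.sccSetoid.trans hx (H.sccSetoid.symm hu),
        fun hx => H.sccSetoid.trans hx hu⟩
    · rintro ⟨⟨y, rfl⟩, hmin⟩
      obtain ⟨l, hl, u, hu, hr⟩ := hreach y
      exact ⟨l, hl, hmin _ (hmem l hl) ⟨u, hu, y, H.sccSetoid.refl y, hr⟩⟩
  · rw [List.forall₂_map_left_iff]
    exact List.forall₂_same.2 fun l hl => ⟨hnodup l hl, fun _ => Iff.rfl⟩

theorem exists_map_map_eq {X Y : Type*} (f : X → Y) {L : List (List Y)}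
    (h : ∀ l ∈ L, ∀ y ∈ l, ∃ x, f x = y) : ∃ L' : List (List X), L'.map (List.map f) = L := by
  have h1 : L ∈ Set.range (List.map (List.map f)) := by
    rw [Set.range_list_map]
    intro l hl
    rw [Set.range_list_map]
    exact h l hl
  exact h1

variable [Fintype N] {ν : N ≃ Fin (Fintype.card N)}

theorem encodeFamily_eq (L : List (List N)) :
    encodeFamily ν L = L.length :: (L.map (List.map fun v => (ν v : ℕ))).flatMap withLength := by
  rw [encodeFamily, List.flatMap_map]
  congr 2
  ext l
  simp [encodeNodes, withLength]

variable {H : DirectedHypergraph N} {a : ℕ → ℕ} {m : ℕ} {E : ℕ → Finset N × Finset N}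

/-- After the search, the components found are the minimal strongly connected components. -/
theorem EncodesEdges.exists_listsFamily (h : EncodesEdges ν H a m E) {M : Memory} {G : Ghost}
    {ol : ℕ → List ℕ} (hM : SearchInv h.problem ol M G) (hcur : Fintype.card N ≤ M.cur) :
    ∃ L : List (List N), L.map (List.map fun v => (ν v : ℕ)) = G.comps ∧
      ListsFamily L H.minimalSccs := by
  have hO := hM.outInv
  obtain ⟨L, hL⟩ := exists_map_map_eq (fun v => (ν v : ℕ)) (L := G.comps) fun l hl v hv =>
    ⟨ν.symm ⟨v, (hO.dead l hl v hv).1⟩, by simp⟩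
  have hinj : Function.Injective fun v => (ν v : ℕ) := Fin.val_injective.comp ν.injective
  have hmem : ∀ l ∈ L, l.map (fun v => (ν v : ℕ)) ∈ G.comps := fun l hl => by
    rw [← hL]; exact List.mem_map_of_mem hl
  have hreach : ∀ x y, h.problem.Reach (ν x) (ν y) ↔ H.Reaches x y := by
    refine fun x y => ⟨?_, fun hr => ⟨x, y, rfl, rfl, hr⟩⟩
    rintro ⟨x', y', hx, hy, hr⟩
    rwa [← hinj hx, ← hinj hy]
  refine ⟨L, hL, H.listsFamily_minimalSccs ?_ ?_ ?_ ?_ ?_⟩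
  · exact fun l hl => (hO.nodup _ (hmem l hl)).of_map _
  · exact fun l hl h0 => hO.ne_nil _ (hmem l hl) (by rw [h0]; rfl)
  · intro l hl u hu v
    rw [← hreach, ← hO.scc _ (hmem l hl) (ν u) (List.mem_map_of_mem (f := fun v => (ν v : ℕ)) hu),
      List.mem_map_of_injective hinj]
  · have := hO.disjoint
    rw [← hL, List.pairwise_map] at this
    refine this.imp fun hd v hv hv' => hd (List.mem_map_of_mem hv) (List.mem_map_of_mem hv')
  · intro x
    obtain ⟨h1, h2⟩ := hM.cur_dead (ν x) ((ν x).2.trans_le hcur)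
    obtain ⟨l, hl, u, hu, hr⟩ := hO.reach _ (Nat.pos_of_ne_zero h1) h2
    rw [hM.stack.stk_pos _ (ν x).2 h1] at hr
    rw [← hL, List.mem_map] at hl
    obtain ⟨l, hl, rfl⟩ := hl
    obtain ⟨v, hv, rfl⟩ := List.mem_map.1 hu
    exact ⟨l, hl, v, hv, (hreach x v).1 hr⟩

end Output

/-! ### The running time -/

namespace RAM

/-- The program: the input is read, the search is performed, and the number of components is written
in front of the list of components. -/
def minimalSccsProg : Program :=
  .seq parseProg (.seq searchProg (block [.const Reg.a 0, .store Arr.out Reg.a Reg.cc]))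

end RAM

/-- The steps of reading and searching, in terms of the size `n + S` of the hypergraph. -/
theorem steps_le {K α n S m t₁ t₂ : ℕ} (hK : K = α + 2) (hα : 1 ≤ α) (hm : m ≤ S + 1)
    (h₁ : t₁ ≤ 8 * S + 40 * m + 7)
    (h₂ : t₂ ≤ (21 * K + 260) * n + (7 * K + 110) * S + 50 * m + 1) :
    t₁ + (t₂ + 2) ≤ 400 * ((n + S) * α) + 400 := by
  subst hK
  obtain ⟨β, rfl⟩ := Nat.exists_eq_add_of_le hα
  calc t₁ + (t₂ + 2) ≤ (21 * (1 + β + 2) + 260) * n + (7 * (1 + β + 2) + 208) * S + 100 := by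
        linarith
    _ ≤ _ := by nlinarith [Nat.zero_le (β * n), Nat.zero_le (β * S)]

theorem mainTheorem4 :
    ∃ (P : RAM.Program) (c : ℕ), ∀ (N : Type*) [Fintype N] (ν : N ≃ Fin (Fintype.card N))
      (H : DirectedHypergraph N) (L : List (List N × List N)), ListsEdges L H →
      ∃ (s : RAM.State) (t : ℕ) (L' : List (List N)),
        RAM.Runs P (RAM.initial (encodeHypergraph ν L)) s t ∧
        t ≤ c * (H.size * inverseAckermann (Fintype.card N)) + c ∧
        ListsFamily L' H.minimalSccs ∧
        s.HasOutput (encodeFamily ν L') := by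
  refine ⟨RAM.minimalSccsProg, 400, fun N _ ν H L hL => ?_⟩
  set a : ℕ → ℕ := fun i => (encodeHypergraph ν L).getD i 0 with ha
  have ha0 : a 0 = Fintype.card N := rfl
  have ha1 : a 1 = L.length := rfl
  obtain ⟨E, hE⟩ := exists_encodesEdges ν hL (a := a) fun _ => rfl
  have hview : (RAM.initial (encodeHypergraph ν L)).view = Memory.initial a := rfl
  have hparse := RAM.ends_parse (a := a) hview rfl rfl rfl (fun _ => rfl) (fun _ => rfl)
    (by rw [ha1]; exact hE.tail_inj)
  rw [ha1] at hparse
  have hends : RAM.Ends RAM.minimalSccsProg (RAM.initial (encodeHypergraph ν L)) fun s t =>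
      ∃ L' : List (List N), t ≤ 400 * (H.size * inverseAckermann (Fintype.card N)) + 400 ∧
        ListsFamily L' H.minimalSccs ∧ s.HasOutput (encodeFamily ν L') := by
    apply RAM.Ends.seq
    refine hparse.mono ?_
    rintro s₁ t₁ ⟨⟨ol, hP⟩, ht₁⟩
    have hS := hE.searchInv ha0 hP
    apply RAM.Ends.seq
    refine (RAM.ends_search (lt_ack_inverseAckermann_add_two _) hS).mono ?_
    rintro s₂ t₂ ⟨G, hS', hcur, ht₂⟩
    apply RAM.Ends.block
    obtain ⟨L', hL', hF⟩ := hE.exists_listsFamily hS' hcur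
    refine ⟨L', ?_, hF, ?_⟩
    · have h1 := hE.searchPotential_initial_le (inverseAckermann (Fintype.card N) + 2) hP
      have h2 : ∑ e ∈ Finset.range L.length, (8 * (a (tailPos a e) + a (headPos a e)) + 40) =
          8 * ∑ e ∈ Finset.range L.length, (a (tailPos a e) + a (headPos a e)) +
            40 * L.length := by
        rw [Finset.sum_add_distrib, ← Finset.mul_sum]
        simp [mul_comm]
      rw [h2] at ht₁
      have h3 := steps_le rfl (one_le_inverseAckermann _) hE.le_sum_add_one ht₁
        (ht₂.trans (Nat.add_le_add_right h1 1))
      rw [hE.sum_eq] at h3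
      exact h3
    · have hO := hS'.outInv
      have hcc : G.comps.length = L'.length := by rw [← hL', List.length_map]
      intro i hi
      rw [encodeFamily_eq, hL'] at hi ⊢
      cases i with
      | zero =>
        rw [List.getD_cons_zero, ← hcc, ← hO.cc_eq]
        simp [RAM.execs, RAM.Instr.apply, RAM.State.view]
      | succ i =>
        rw [List.getD_cons_succ, ← hO.out_eq i (by simpa using hi)]
        simp [RAM.execs, RAM.Instr.apply, RAM.State.view]
  obtain ⟨s, t, hr, L', ht, hF, ho⟩ := hends
  exact ⟨s, t, L', hr, ht, hF, ho⟩
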